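/- Let $\mathcal C$ be an essentially small category with a Grothendieck topology and let $R$ be a sheaf of commutative rings on $\mathcal C$. Let $\mathcal N$ be the category of presheaves of $R$-modules on $\mathcal C$ and $\mathrm{ch}(\mathcal N)$ the category of unbounded chain complexes in $\mathcal N$, with its usual tensor product $\otimes=\otimes_R$, and let $F(X,-)$ be the right adjoint of $X\otimes-$ (the inner hom). For $c\in\mathcal C$ let $R_c\in\mathcal N$ be the free presheaf of $R$-modules on the presheaf of sets represented by $c$. Let $I$ be the set of the maps $i_{c,n}$, $c\in\mathcal C$, $n\in\mathbb Z$, from the complex $R_c$ concentrated in degree $n$ to the complex with $R_c$ in degrees $n+1$ and $n$, with differential $\mathrm{id}\colon R_c\to R_c$, and $0$ elsewhere; $i_{c,n}$ is the identity in degree $n$. The *projective model structure* on $\mathrm{ch}(\mathcal N)$ is the model structure whose weak equivalences are the maps $f$ such that $H_n(f)$ is an isomorphism of presheaves for all $n\in\mathbb Z$, whose fibrations are the maps $f$ such that $f_n(c)$ is surjective for all $n\in\mathbb Z$, $c\in\mathcal C$, and whose cofibrations are the retracts of relative $I$-cell complexes (transfinite compositions of pushouts of coproducts of maps in $I$). Let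 $k$ be the inclusion of nonnegative chain complexes in unbounded ones, and $\tau_{\ge 0}$ the functor sending $X$ to $\cdots\to X_2\to X_1\to\ker(X_0\to X_{-1})$ in nonnegative degrees. Let $N$ be the normalized chain complex functor from simplicial objects to nonnegative chain complexes, and $D$ the inverse equivalence in the Dold–Kan correspondence for abelian groups (followed by the forgetful functor to simplicial sets). For a simplicial set $S$ let $R[S]$ be the free simplicial presheaf of $R$-modules on $S$, that is, the free presheaf of $R$-modules on the constant presheaf $S_n$ in simplicial degree $n$. For $M\in\mathcal N$ let $\Gamma M=\lim_{c\in\mathcal C^{op}}M(c)$ be the global sections ($M(t)$ if $\mathcal C$ has a terminal object $t$), applied degreewise to complexes, and let $j$ be the functor that forgets from $\Gamma R$-modules to abelian groups. A *quasi-simplicial structure* on a model category $\mathcal K$ is an enrichment $\mathrm{Map}(-,-)$ of $\mathcal K$ in the category $\mathcal S$ of simplicial sets, with $\mathcal K$ as its underlying category, together with functors $X\mathbin\square S$ (tensor) and $F_\square(S,X)$ (cotensor), for $X\in\mathcal K$ and $S\in\mathcal S$, such that: - (weakM6) there are isomorphisms of simplicial sets $\mathrm{Map}(X\mathbin\square S,Y)\cong\mathrm{Map}(X,F_\square(S,Y))$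 and bijections of sets $\mathcal S(S,\mathrm{Map}(X,Y))\cong\mathcal K(X\mathbin\square S,Y)$, both natural in $X$, $S$ and $Y$; - (M7) for every cofibration $i\colon A\to B$ and every fibration $f\colon X\to Y$ in $\mathcal K$, the map $$i^*\times f_*\colon \mathrm{Map}(B,X)\to\mathrm{Map}(A,X)\times_{\mathrm{Map}(A,Y)}\mathrm{Map}(B,Y)$$ is a Kan fibration, and it is also a weak equivalence of simplicial sets if $i$ or $f$ is a weak equivalence. **Claim.** The projective model structure on $\mathrm{ch}(\mathcal N)$ exists (with all small limits and colimits, and with functorial factorizations), and it has a quasi-simplicial structure with tensor and cotensor $$X\mathbin\square S=X\otimes kNR[S],\qquad F_\square(S,X)=F(kNR[S],X),$$ and with mapping spaces given, up to an isomorphism natural in $X$ and $Y$, by $$\mathrm{Map}(X,Y)\cong D\,j\,\tau_{\ge 0}\,\Gamma\big(F(X,Y)\big).$$ -/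

import Mathlib

open CategoryTheory Limits MonoidalCategory Opposite HomotopicalAlgebra

universe u v₁ u₁ v₂ u₂

noncomputable section

/-! ### Weak equivalences of simplicial sets -/

/-- A map `f : X ⟶ Y` of simplicial sets is a weak (homotopy) equivalence if, for every Kan
complex `Z`, restriction along `f` induces a bijection `π₀ (Z ^ Y) → π₀ (Z ^ X)`. -/
def SSet.IsWeakHomotopyEquivalence {X Y : SSet.{u}} (f : X ⟶ Y) : Prop :=
  ∀ (Z : SSet.{u}), SSet.KanComplex Z →
    Function.Bijective (SSet.mapπ₀ ((MonoidalClosed.pre f).app Z))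

/-- The Kan fibrations: right lifting property with respect to all horn inclusions. -/
def SSet.IsKanFibration {X Y : SSet.{u}} (f : X ⟶ Y) : Prop :=
  SSet.modelCategoryQuillen.J.rlp f

/-! ### Quasi-simplicial model categories -/

section QuasiSimplicial

variable (K : Type u₁) [Category.{v₁} K]

/-- A quasi-simplicial structure on a model category `K`: a simplicial enrichment `Map` of `K`,
with a tensor and a cotensor over simplicial sets, such that
* there are natural isomorphisms of simplicial sets `Map (X □ S) Y ≅ Map X (F S Y)`;
* there are natural bijections of sets `Hom (S, Map X Y) ≃ Hom (X □ S, Y)`;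
* for a cofibration `i : A ⟶ B` and a fibration `f : X ⟶ Y`, the map
  `Map B X ⟶ Map A X ×_{Map A Y} Map B Y` is a Kan fibration, which is moreover a weak
  equivalence if `i` or `f` is a weak equivalence.
The functoriality of `Map` in both variables is the one given by the enrichment. -/
structure QuasiSimplicialStructure [ModelCategory K] where
  /-- the simplicial enrichment -/
  enriched : EnrichedOrdinaryCategory SSet.{u} K
  /-- the tensor `X □ S` -/
  tensor : K ⥤ SSet.{u} ⥤ K
  /-- the cotensor `F (S, X)` -/
  cotensor : SSet.{u}ᵒᵖ ⥤ K ⥤ K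
  /-- the isomorphism of simplicial sets `Map (X □ S) Y ≅ Map X (F S Y)` -/
  mapTensorIso (X : K) (S : SSet.{u}) (Y : K) :
    (((tensor.obj X).obj S) ⟶[SSet.{u}] Y) ≅ (X ⟶[SSet.{u}] ((cotensor.obj (op S)).obj Y))
  mapTensorIso_naturality_left {X X' : K} (f : X ⟶ X') (S : SSet.{u}) (Y : K) :
    eHomWhiskerRight SSet.{u} ((tensor.map f).app S) Y ≫ (mapTensorIso X S Y).hom =
      (mapTensorIso X' S Y).hom ≫ eHomWhiskerRight SSet.{u} f ((cotensor.obj (op S)).obj Y)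
  mapTensorIso_naturality_middle (X : K) {S S' : SSet.{u}} (g : S ⟶ S') (Y : K) :
    eHomWhiskerRight SSet.{u} ((tensor.obj X).map g) Y ≫ (mapTensorIso X S Y).hom =
      (mapTensorIso X S' Y).hom ≫ eHomWhiskerLeft SSet.{u} X ((cotensor.map g.op).app Y)
  mapTensorIso_naturality_right (X : K) (S : SSet.{u}) {Y Y' : K} (h : Y ⟶ Y') :
    eHomWhiskerLeft SSet.{u} ((tensor.obj X).obj S) h ≫ (mapTensorIso X S Y').hom =
      (mapTensorIso X S Y).hom ≫ eHomWhiskerLeft SSet.{u} X ((cotensor.obj (op S)).map h)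
  /-- the bijection of sets `Hom (S, Map X Y) ≃ Hom (X □ S, Y)` -/
  homMapEquiv (X : K) (S : SSet.{u}) (Y : K) :
    (S ⟶ (X ⟶[SSet.{u}] Y)) ≃ ((tensor.obj X).obj S ⟶ Y)
  homMapEquiv_naturality_left {X X' : K} (f : X ⟶ X') (S : SSet.{u}) (Y : K)
    (a : S ⟶ (X' ⟶[SSet.{u}] Y)) :
    homMapEquiv X S Y (a ≫ eHomWhiskerRight SSet.{u} f Y) =
      (tensor.map f).app S ≫ homMapEquiv X' S Y a
  homMapEquiv_naturality_middle (X : K) {S S' : SSet.{u}} (g : S ⟶ S') (Y : K)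
    (a : S' ⟶ (X ⟶[SSet.{u}] Y)) :
    homMapEquiv X S Y (g ≫ a) = (tensor.obj X).map g ≫ homMapEquiv X S' Y a
  homMapEquiv_naturality_right (X : K) (S : SSet.{u}) {Y Y' : K} (h : Y ⟶ Y')
    (a : S ⟶ (X ⟶[SSet.{u}] Y)) :
    homMapEquiv X S Y' (a ≫ eHomWhiskerLeft SSet.{u} X h) = homMapEquiv X S Y a ≫ h
  isKanFibration {A B X Y : K} (i : A ⟶ B) (f : X ⟶ Y) (hi : cofibrations K i)
    (hf : fibrations K f) :
    SSet.IsKanFibration (pullback.lift (f := eHomWhiskerLeft SSet.{u} A f)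
      (g := eHomWhiskerRight SSet.{u} i Y) (eHomWhiskerRight SSet.{u} i X)
      (eHomWhiskerLeft SSet.{u} B f) (eHom_whisker_exchange SSet.{u} i f).symm)
  isWeakHomotopyEquivalence {A B X Y : K} (i : A ⟶ B) (f : X ⟶ Y) (hi : cofibrations K i)
    (hf : fibrations K f) (hif : weakEquivalences K i ∨ weakEquivalences K f) :
    SSet.IsWeakHomotopyEquivalence (pullback.lift (f := eHomWhiskerLeft SSet.{u} A f)
      (g := eHomWhiskerRight SSet.{u} i Y) (eHomWhiskerRight SSet.{u} i X)
      (eHomWhiskerLeft SSet.{u} B f) (eHom_whisker_exchange SSet.{u} i f).symm)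

end QuasiSimplicial

/-! ### Chain complexes of presheaves of modules and their tensor product -/

variable {C : Type u₁} [Category.{v₁} C]

/-- Presheaves of modules over a presheaf of commutative rings `R`. -/
abbrev PMod (R : Cᵒᵖ ⥤ CommRingCat.{u}) :=
  PresheafOfModules.{u} (R ⋙ forget₂ CommRingCat RingCat)

/-- Unbounded chain complexes of presheaves of `R`-modules. -/
abbrev PCh (R : Cᵒᵖ ⥤ CommRingCat.{u}) := ChainComplex (PMod R) ℤ

/-- The usual Koszul signs: the differential of `K ⊗ L` is `d ⊗ 1 + (-1) ^ p • (1 ⊗ d)` on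
`K_p ⊗ L_q`. -/
instance : (ComplexShape.down ℤ).TensorSigns where
  ε' := MonoidHom.mk' Int.negOnePow Int.negOnePow_add
  rel_add p q r hpq := by
    have h : q + 1 = p := hpq
    show q + r + 1 = p + r
    lia
  add_rel p q r hpq := by
    have h : q + 1 = p := hpq
    show r + q + 1 = r + p
    lia
  ε'_succ := by
    rintro _ p rfl
    show p.negOnePow = -(p + 1).negOnePow
    rw [Int.negOnePow_succ, neg_neg]

instance : (ComplexShape.down ℤ).HasNoLoop where
  not_rel_self j := by simp

section Tensor

variable (R : Cᵒᵖ ⥤ CommRingCat.{u})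

instance : MonoidalPreadditive (PMod R) where
  whiskerLeft_zero {X Y Z} := by
    ext1 c
    exact MonoidalPreadditive.whiskerLeft_zero (C := ModuleCat (R.obj c)) (X := X.obj c) (Y := Y.obj c) (Z := Z.obj c)
  zero_whiskerRight {X Y Z} := by
    ext1 c
    exact MonoidalPreadditive.zero_whiskerRight (C := ModuleCat (R.obj c)) (X := X.obj c) (Y := Y.obj c) (Z := Z.obj c)
  whiskerLeft_add {X Y Z} f g := by
    ext1 c
    exact MonoidalPreadditive.whiskerLeft_add (C := ModuleCat (R.obj c)) (f.app c) (g.app c)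
  add_whiskerRight {X Y Z} f g := by
    ext1 c
    exact MonoidalPreadditive.add_whiskerRight (C := ModuleCat (R.obj c)) (f.app c) (g.app c)

instance : (curriedTensor (PMod R)).Additive where
instance (X : PMod R) : ((curriedTensor (PMod R)).obj X).Additive where

instance (X : PMod R) : PreservesColimitsOfSize.{u,u} ((curriedTensor (PMod R)).obj X) := 
  inferInstanceAs (PreservesColimitsOfSize.{u,u} (tensorLeft X))
instance (X : PMod R) : PreservesColimitsOfSize.{u,u} ((curriedTensor (PMod R)).flip.obj X) :=
  inferInstanceAs (PreservesColimitsOfSize.{u,u} (tensorRight X))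
instance (X : PMod R) : PreservesColimitsOfSize.{0,0} ((curriedTensor (PMod R)).obj X) := 
  preservesColimitsOfSize_shrink.{0, u, 0, u} _
instance (X : PMod R) : PreservesColimitsOfSize.{0,0} ((curriedTensor (PMod R)).flip.obj X) :=
  preservesColimitsOfSize_shrink.{0, u, 0, u} _

/-- The tensor product of chain complexes of presheaves of modules. -/
instance chMonoidal : MonoidalCategory (PCh R) := HomologicalComplex.monoidalCategory _ _

open HomologicalComplex in
lemma mapBifunctorDesc_ext' {X Y : PCh R} {n : ℤ} {A : PMod R} {f g : (X ⊗ Y).X n ⟶ A}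
    (h : ∀ (p q : ℤ) (hpq : p + q = n), ιTensorObj X Y p q n hpq ≫ f = ιTensorObj X Y p q n hpq ≫ g) : f = g :=
  HomologicalComplex.mapBifunctor.hom_ext h

open HomologicalComplex in
instance (X : PCh R) : PreservesColimitsOfSize.{u, u} (tensorLeft X) where
  preservesColimitsOfShape {J} _ := by
    refine HomologicalComplex.preservesColimitsOfShape_of_eval _ (fun n ↦ ⟨fun {F} ↦ ⟨fun {c} hc ↦ ⟨?_⟩⟩⟩)
    have H (p q : ℤ) : IsColimit ((eval _ _ q ⋙ tensorLeft (X.X p)).mapCocone c) :=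
      isColimitOfPreserves _ hc
    have hι (j : J) (p q : ℤ) (hpq : p + q = n) :
      ιTensorObj X (F.obj j) p q n hpq ≫ (X ◁ c.ι.app j).f n =
        X.X p ◁ (c.ι.app j).f q ≫ ιTensorObj X c.pt p q n hpq := by
      refine (ι_mapBifunctorMap (𝟙 X) (c.ι.app j) (curriedTensor (PMod R))
        (ComplexShape.down ℤ) p q n hpq).trans ?_
      simp
    have hF {i j : J} (f : i ⟶ j) (p q : ℤ) (hpq : p + q = n) :
      ιTensorObj X (F.obj i) p q n hpq ≫ (X ◁ F.map f).f n =
        X.X p ◁ (F.map f).f q ≫ ιTensorObj X (F.obj j) p q n hpq := by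
      refine (ι_mapBifunctorMap (𝟙 X) (F.map f) (curriedTensor (PMod R))
        (ComplexShape.down ℤ) p q n hpq).trans ?_
      simp
    let t (s : Cocone (F ⋙ tensorLeft X ⋙ eval _ _ n)) (p q : ℤ) (hpq : p + q = n) :
        Cocone (F ⋙ eval _ _ q ⋙ tensorLeft (X.X p)) :=
      { pt := s.pt
        ι := { app j := ιTensorObj X (F.obj j) p q n hpq ≫ s.ι.app j
               naturality i j f := by
                have := s.w f
                dsimp at this ⊢
                rw [← this, Category.comp_id]
                exact ((reassoc_of% (hF f p q hpq)) (s.ι.app j)).symm } }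
    let D (s : Cocone (F ⋙ tensorLeft X ⋙ eval _ _ n)) : (X ⊗ c.pt).X n ⟶ s.pt :=
      mapBifunctorDesc (fun p q hpq ↦ (H p q).desc (t s p q hpq))
    have hD (s) (p q : ℤ) (hpq : p + q = n) : ιTensorObj X c.pt p q n hpq ≫ D s =
        (H p q).desc (t s p q hpq) := ι_mapBifunctorDesc _ p q hpq
    exact
      { desc s := D s
        fac s j := mapBifunctorDesc_ext' R (fun p q hpq ↦ by
          refine ((reassoc_of% (hι j p q hpq)) (D s)).trans ?_
          rw [hD]
          exact (H p q).fac (t s p q hpq) j)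
        uniq s m hm := mapBifunctorDesc_ext' R (fun p q hpq ↦ by
          refine Eq.trans ?_ (hD s p q hpq).symm
          refine (H p q).hom_ext (fun j ↦ ?_)
          rw [(H p q).fac]
          refine ((reassoc_of% (hι j p q hpq)) m).symm.trans ?_
          dsimp [t]
          rw [← hm j]
          rfl) }

instance (J : Type u) [SmallCategory J] [IsFiltered J] : HasExactColimitsOfShape J (PMod R) := by
  have := reflectsFiniteLimits_of_reflectsIsomorphisms (F := PresheafOfModules.toPresheaf.{u} (R ⋙ forget₂ CommRingCat RingCat))
  exact HasExactColimitsOfShape.domain_of_functor J (PresheafOfModules.toPresheaf.{u} (R ⋙ forget₂ CommRingCat RingCat))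
instance : AB5OfSize.{u,u} (PMod R) where
  ofShape _ _ _ := inferInstance


end Tensor

section

variable [EssentiallySmall.{u} C] (R : Cᵒᵖ ⥤ CommRingCat.{u})

/-- The restriction of a presheaf of modules to a small model of the site, as a presheaf of abelian
groups. -/
abbrev toSmallPresheaf : PMod R ⥤ (SmallModel.{u} C)ᵒᵖ ⥤ AddCommGrpCat.{u} :=
  PresheafOfModules.toPresheaf.{u} (R ⋙ forget₂ CommRingCat RingCat) ⋙
    (Functor.whiskeringLeft _ _ _).obj (equivSmallModel.{u} C).inverse.op

instance : LocallySmall.{u} (PMod R) := locallySmall_of_faithful.{u} (toSmallPresheaf R)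

/-- The free presheaf of `R`-modules `R_c` generated by an object `c`, so that
`Hom (R_c, M) ≃ M (c)`. -/
def freeR (c : C) : PMod R :=
  (PresheafOfModules.free (R ⋙ forget₂ CommRingCat RingCat)).obj (shrinkYoneda.{u}.obj c)

/-- The bijection `Hom (R_c, M) ≃ M (c)`. -/
def freeREquiv (c : C) (M : PMod R) : (freeR R c ⟶ M) ≃ M.obj (op c) :=
  PresheafOfModules.freeHomEquiv.trans shrinkYonedaEquiv

lemma freeREquiv_comp (c : C) {M N : PMod R} (f : freeR R c ⟶ M) (g : M ⟶ N) :
    freeREquiv R c N (f ≫ g) = g.app _ (freeREquiv R c M f) := rfl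

instance : HasSeparator (PMod R) := by
  let P : SmallModel.{u} C → PMod R :=
    fun c ↦ freeR R ((equivSmallModel C).inverse.obj c)
  have hP : ObjectProperty.IsSeparating (.ofObj P) := by
    intro M N f g h
    apply (toSmallPresheaf R).map_injective
    ext ⟨c⟩ x
    let y := (freeREquiv R ((equivSmallModel C).inverse.obj c) M).symm x
    have hy : freeREquiv R ((equivSmallModel C).inverse.obj c) M y = x :=
      Equiv.apply_symm_apply _ _
    have h1 := congr_arg (freeREquiv R _ N) (h _ ⟨c⟩ y)
    rw [freeREquiv_comp, freeREquiv_comp, hy] at h1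
    exact h1
  exact ⟨_, ObjectProperty.IsSeparating.isSeparator_coproduct hP⟩

instance : IsGrothendieckAbelian.{u} (PMod R) where
instance : IsGrothendieckAbelian.{u} (PCh R) := by unfold PCh ChainComplex; infer_instance

instance (X : PCh R) : (tensorLeft X).IsLeftAdjoint := by
  let e := ShrinkHoms.equivalence.{u} (PCh R)
  let G := e.inverse ⋙ tensorLeft X ⋙ e.functor
  have := isSeparator_separator (ShrinkHoms (PCh R))
  have : PreservesColimitsOfSize.{u,u} G := inferInstance
  have : G.IsLeftAdjoint := isLeftAdjoint_of_preservesColimits_of_isSeparating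
    (isSeparator_separator (ShrinkHoms (PCh R))) _
  have h2 : (e.functor ⋙ G ⋙ e.inverse).IsLeftAdjoint := inferInstance
  let i : e.functor ⋙ G ⋙ e.inverse ≅ tensorLeft X :=
    Functor.isoWhiskerRight e.unitIso.symm (tensorLeft X ⋙ e.functor ⋙ e.inverse) ≪≫
      Functor.isoWhiskerLeft (tensorLeft X) e.unitIso.symm
  exact Functor.isLeftAdjoint_of_iso i

/-- The inner hom of chain complexes of presheaves of modules: for a complex `X`, the functor
`(ihom X).obj` is the right adjoint of `X ⊗ -`. -/
instance : MonoidalClosed (PCh R) where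
  closed X := 
   { rightAdj := (tensorLeft X).rightAdjoint
     adj := Adjunction.ofIsLeftAdjoint (tensorLeft X) }

/-! ### The projective model structure -/

/-- The complex with the identity of `R_c` from degree `n + 1` to degree `n`, zero elsewhere. -/
def diskR (c : C) (n : ℤ) : PCh R :=
  HomologicalComplex.double (𝟙 (freeR R c)) (c := ComplexShape.down ℤ)
    (show (ComplexShape.down ℤ).Rel (n + 1) n from rfl)

/-- The inclusion of the complex `R_c` concentrated in degree `n` in the complex `diskR R c n`. -/
def genI (c : C) (n : ℤ) :
    (HomologicalComplex.single (PMod R) (ComplexShape.down ℤ) n).obj (freeR R c) ⟶ diskR R c n :=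
  HomologicalComplex.mkHomFromSingle
    (HomologicalComplex.doubleXIso₁ (𝟙 (freeR R c)) (c := ComplexShape.down ℤ)
      (show (ComplexShape.down ℤ).Rel (n + 1) n from rfl) (by simp)).inv
    (fun k _ ↦ by
      have h : (diskR R c n).d n k = 0 :=
        HomologicalComplex.double_d_eq_zero₀ _ _ _ _ (by lia)
      exact (congr_arg (CategoryStruct.comp _) h).trans comp_zero)

/-- The generating cofibrations. -/
def genCofibrations : MorphismProperty (PCh R) :=
  .ofHoms (fun (x : C × ℤ) ↦ genI R x.1 x.2)

/-- The relative `I`-cell complexes, for `I` the class of generating cofibrations: transfinite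
compositions of pushouts of coproducts of maps in `I`. -/
def relativeCellComplexes : MorphismProperty (PCh R) :=
  MorphismProperty.transfiniteCompositions.{u}
    (MorphismProperty.coproducts.{u} (genCofibrations R)).pushouts

/-- A model structure on chain complexes of presheaves of `R`-modules is the projective one if
the weak equivalences are the maps inducing isomorphisms on all presheaf homology groups, the
fibrations are the levelwise surjective maps, and the cofibrations are the retracts of relative
`I`-cell complexes. We also include that the category has all small limits and
colimits and that the factorizations may be chosen functorially. -/
structure IsProjectiveModelStructure (M : ModelCategory (PCh R)) : Prop where
  weakEquivalences_iff {X Y : PCh R} (f : X ⟶ Y) :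
    weakEquivalences (PCh R) f ↔ ∀ n : ℤ, IsIso (HomologicalComplex.homologyMap f n)
  fibrations_iff {X Y : PCh R} (f : X ⟶ Y) :
    fibrations (PCh R) f ↔ ∀ (n : ℤ) (c : C), Function.Surjective ((f.f n).app (op c))
  cofibrations_eq : cofibrations (PCh R) = (relativeCellComplexes R).retracts
  hasLimits : HasLimitsOfSize.{u, u} (PCh R)
  hasColimits : HasColimitsOfSize.{u, u} (PCh R)
  functorial₁ : MorphismProperty.HasFunctorialFactorization
    (trivialCofibrations (PCh R)) (fibrations (PCh R))
  functorial₂ : MorphismProperty.HasFunctorialFactorization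
    (cofibrations (PCh R)) (trivialFibrations (PCh R))

end

/-! ### Tensor, cotensor and mapping spaces -/

/-- The inclusion `n ↦ n` of the shape of nonnegative chain complexes in the shape of unbounded
chain complexes. -/
def nonnegEmbedding : ComplexShape.Embedding (ComplexShape.down ℕ) (ComplexShape.down ℤ) :=
  ComplexShape.Embedding.mk' _ _ (fun n ↦ (n : ℤ)) (fun _ _ h ↦ by simpa using h)
    (by intro i j; simp only [ComplexShape.down_Rel]; lia)

instance : nonnegEmbedding.IsRelIff := by
  constructor
  intro i j h
  have h' : (j : ℤ) + 1 = i := h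
  show j + 1 = i
  lia

instance : nonnegEmbedding.IsTruncLE where
  mem_prev {i j} h := ⟨j + 1, by
    have h' : (j : ℤ) + 1 = i := h
    show ((j + 1 : ℕ) : ℤ) = i
    lia⟩

section Truncation

variable (A : Type u₂) [Category.{v₂} A] [Abelian A]

/-- The inclusion `k` of nonnegative chain complexes in unbounded chain complexes. -/
abbrev includeNonneg : ChainComplex A ℕ ⥤ ChainComplex A ℤ :=
  nonnegEmbedding.extendFunctor A

/-- The truncation functor `τ_{≥ 0}`, which sends `X` to
`⋯ ⟶ X₂ ⟶ X₁ ⟶ ker (X₀ ⟶ X₋₁)`. -/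
abbrev truncNonneg : ChainComplex A ℤ ⥤ ChainComplex A ℕ :=
  nonnegEmbedding.truncLE'Functor A

end Truncation

section

variable (R : Cᵒᵖ ⥤ CommRingCat.{u})

/-- The free simplicial `R`-module `R[S]` on a simplicial set `S`: in degree `n`, it is the free
presheaf of `R`-modules on the constant presheaf of sets with value `S_n`. -/
def freeSimplicialModule : SSet.{u} ⥤ SimplicialObject (PMod R) :=
  (SimplicialObject.whiskering _ _).obj
    (Functor.const Cᵒᵖ ⋙ PresheafOfModules.free (R ⋙ forget₂ CommRingCat RingCat))

/-- The functor `S ↦ k N R[S]`, where `N` is the normalized chain complex functor. -/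
def simplicialChains : SSet.{u} ⥤ PCh R :=
  freeSimplicialModule R ⋙ Abelian.DoldKan.N ⋙ includeNonneg (PMod R)

variable [EssentiallySmall.{u} C]

instance : HasLimitsOfShape Cᵒᵖ AddCommGrpCat.{u} :=
  hasLimitsOfShape_of_essentiallySmall.{u} _ _

/-- The global sections `Γ(M)`, the limit of the groups `M (c)`, as an abelian
group. If there is a terminal object `t`, this is `M (t)`. -/
def globalSections : PMod R ⥤ AddCommGrpCat.{u} :=
  PresheafOfModules.toPresheaf.{u} (R ⋙ forget₂ CommRingCat RingCat) ⋙ lim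

instance : (globalSections R).Additive := by
  have : (lim : (Cᵒᵖ ⥤ AddCommGrpCat.{u}) ⥤ AddCommGrpCat.{u}).Additive :=
    constLimAdj.right_adjoint_additive
  unfold globalSections
  infer_instance

/-- The functor `X ↦ D τ_{≥ 0} Γ X` to simplicial sets, where `D` is the inverse of the
normalized chain complex functor in the Dold-Kan correspondence. -/
def simplicialSections : PCh R ⥤ SSet.{u} :=
  (globalSections R).mapHomologicalComplex (ComplexShape.down ℤ) ⋙
    truncNonneg AddCommGrpCat.{u} ⋙ Abelian.DoldKan.equivalence.inverse ⋙
      (SimplicialObject.whiskering _ _).obj (forget AddCommGrpCat.{u})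

/-- The mapping space bifunctor `(X, Y) ↦ D τ_{≥ 0} Γ (F (X, Y))`, for `F` the inner hom. -/
def mappingSpace : (PCh R)ᵒᵖ ⥤ PCh R ⥤ SSet.{u} :=
  MonoidalClosed.internalHom ⋙ (Functor.whiskeringRight _ _ _).obj (simplicialSections R)

/-- The tensor `X ⊗ k N R[S]`. -/
def simplicialTensor : PCh R ⥤ SSet.{u} ⥤ PCh R :=
  curriedTensor (PCh R) ⋙ (Functor.whiskeringLeft _ _ _).obj (simplicialChains R)

/-- The cotensor `F (k N R[S], X)`. -/
def simplicialCotensor : SSet.{u}ᵒᵖ ⥤ PCh R ⥤ PCh R :=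
  (simplicialChains R).op ⋙ MonoidalClosed.internalHom

end

end

-- Model structure. All lifting problems are solved on generalized elements. A square from a
-- sphere-to-disk inclusion on `P` to `f` is a cycle `z` and an element `y` with `f z = d y`, and a
-- lift is an element `x` with `d x = z` and `f x = y`. The objects `R_c` are projective and
-- generate, so having such lifts for all `R_c` amounts to being a surjective quasi-isomorphism
-- (`smallGenCofibrations_rlp`); in the same way lifting against the maps `0 ⟶ disk` amounts to
-- surjectivity. The small object argument applies because the generators are monomorphisms in a
-- Grothendieck abelian category. It remains to identify the maps with the left lifting property
-- against all surjections with the cofibrations that are weak equivalences. Every complex receives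
-- a surjection from an acyclic one, which makes such maps quasi-isomorphisms (`quasiIso_of_llp`);
-- the converse is the retract argument (`degreewiseEpi_llp`).
--
-- Enrichment. The functor `S ↦ kNR[S]` is left adjoint to `X ↦ D τ Γ X`, because maps on either
-- side amount to families of maps from the unit to the `X_m`, indexed by the simplices of `S`,
-- which vanish on degenerate simplices and turn alternating sums of faces into differentials
-- (`chainsAdjunction`). The Alexander-Whitney map makes the left adjoint oplax monoidal, so the
-- right adjoint is lax monoidal, and the enrichment of complexes over themselves is transported
-- along it to a simplicial one. The underlying category is unchanged because `kNR[pt]` is the unit.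
-- The isomorphism in (weakM6) is `F(X ⊗ A, Y) ≅ F(X, F(A, Y))`, and the bijection of sets composes
-- the two adjunctions.
--
-- Axiom (M7). A map `B ⊗ kNR[T] ⟶ X` is a family of graded maps `B ⟶ X` indexed by the simplices of
-- `T`. Lifting a subcomplex inclusion `U ⊆ T` against the map of (M7) therefore means extending a
-- family from `U` to `T` with prescribed composites with `i` and `f`. For a boundary only the top
-- simplex is missing: a graded map is needed with prescribed restriction, image and differential
-- (`exists_lift_gradedHom_of_D`). For a horn the value on the top simplex may have any differential
-- (`exists_lift_gradedHom`), and this differential then determines the value on the missing face.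
-- Both statements become ordinary lifting properties of `i`, because a graded map together with its
-- differential is a chain map to a shifted cone. The first uses `cone(id_X) ⟶ cone(f)`, a fibration
-- which is trivial when `f` is. The second uses `cone(id_X) ⟶ cone(id_Y)`, a trivial fibration for
-- every fibration `f`, the cones being contractible. Finally, a map of simplicial sets with the
-- right lifting property against boundary inclusions has a section that is inverse to it up to
-- homotopy, so it is a weak equivalence.

universe w v₃ u₃

/-! ### Lifting against spheres and disks in an abelian category -/

noncomputable section

open scoped ZeroObject Simplicial

namespace ChainComplexLifting

section

variable {A : Type u₂} [Category.{v₂} A] [Abelian A]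

/-- The inclusion of `P`, concentrated in degree `n`, in the disk on `P` in degrees
`n + 1` and `n`. -/
def sphereToDisk (P : A) (n : ℤ) :
    (HomologicalComplex.single A (ComplexShape.down ℤ) n).obj P ⟶
      HomologicalComplex.double (𝟙 P) (c := ComplexShape.down ℤ)
        (show (ComplexShape.down ℤ).Rel (n + 1) n from rfl) :=
  HomologicalComplex.mkHomFromSingle
    (HomologicalComplex.doubleXIso₁ (𝟙 P) (c := ComplexShape.down ℤ)
      (show (ComplexShape.down ℤ).Rel (n + 1) n from rfl) (by simp)).inv
    (fun k _ ↦ by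
      rw [HomologicalComplex.double_d_eq_zero₀ _ _ _ _ (by lia), comp_zero])

/-- Cycles of `X` whose image in `Y` is a given boundary can be lifted, over the object `P`. -/
def LiftsDisks (P : A) {X Y : ChainComplex A ℤ} (f : X ⟶ Y) : Prop :=
  ∀ (n : ℤ) (z : P ⟶ X.X n) (y : P ⟶ Y.X (n + 1)),
    (∀ k, z ≫ X.d n k = 0) → z ≫ f.f n = y ≫ Y.d (n + 1) n →
      ∃ x : P ⟶ X.X (n + 1), x ≫ X.d (n + 1) n = z ∧ x ≫ f.f (n + 1) = y

variable {X Y : ChainComplex A ℤ} (f : X ⟶ Y)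

/-- Maps from a disk. -/
def diskDesc {P : A} {K : ChainComplex A ℤ} {n : ℤ} (x : P ⟶ K.X (n + 1)) :
    HomologicalComplex.double (𝟙 P) (c := ComplexShape.down ℤ)
        (show (ComplexShape.down ℤ).Rel (n + 1) n from rfl) ⟶ K :=
  HomologicalComplex.mkHomFromDouble _ (by simp) x (x ≫ K.d (n + 1) n) (by simp) (by simp)

/-- Maps from the sphere are cycles of degree `n`; a map from the disk is freely determined by its
component of degree `n + 1`, whose boundary is the other component. -/
lemma hasLiftingProperty_sphereToDisk_iff (P : A) (n : ℤ) :
    HasLiftingProperty (sphereToDisk P n) f ↔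
      ∀ (z : P ⟶ X.X n) (y : P ⟶ Y.X (n + 1)),
      (∀ k, z ≫ X.d n k = 0) → z ≫ f.f n = y ≫ Y.d (n + 1) n →
      ∃ x : P ⟶ X.X (n + 1), x ≫ X.d (n + 1) n = z ∧ x ≫ f.f (n + 1) = y := by
  have hn : n + 1 ≠ n := by simp
  constructor
  · intro h z y hz hzy
    let a : (HomologicalComplex.single A (ComplexShape.down ℤ) n).obj P ⟶ X :=
      HomologicalComplex.mkHomFromSingle z (fun k _ ↦ hz k)
    have sq : CommSq a (sphereToDisk P n) f (diskDesc y) := ⟨by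
      apply HomologicalComplex.from_single_hom_ext
      simp [a, sphereToDisk, diskDesc, hzy]⟩
    refine ⟨(HomologicalComplex.doubleXIso₀ (𝟙 P) _).inv ≫ sq.lift.f (n + 1), ?_, ?_⟩
    · have h1 := HomologicalComplex.congr_hom sq.fac_left n
      simp only [HomologicalComplex.comp_f, sphereToDisk,
        HomologicalComplex.mkHomFromSingle_f, a, Category.assoc] at h1
      rw [Category.assoc, sq.lift.comm, HomologicalComplex.double_d _ _ hn]
      simp only [Category.assoc, Iso.inv_hom_id_assoc, Category.id_comp] at h1 ⊢
      rw [← cancel_epi (HomologicalComplex.singleObjXSelf (ComplexShape.down ℤ) n P).hom]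
      exact h1
    · have h2 := HomologicalComplex.congr_hom sq.fac_right (n + 1)
      simp only [HomologicalComplex.comp_f] at h2
      rw [Category.assoc, h2]
      simp [diskDesc]
  · intro H
    refine ⟨fun {a b} sq ↦ ?_⟩
    let z : P ⟶ X.X n :=
      (HomologicalComplex.singleObjXSelf (ComplexShape.down ℤ) n P).inv ≫ a.f n
    let y : P ⟶ Y.X (n + 1) := (HomologicalComplex.doubleXIso₀ (𝟙 P) _).inv ≫ b.f (n + 1)
    have hb : (sphereToDisk P n).f n ≫ b.f n =
        (HomologicalComplex.singleObjXSelf (ComplexShape.down ℤ) n P).hom ≫ y ≫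
          Y.d (n + 1) n := by
      simp [y, sphereToDisk, HomologicalComplex.double_d _ _ hn]
    obtain ⟨x, hx₁, hx₂⟩ := H z y (fun k ↦ by simp [z]) (by
      have := HomologicalComplex.congr_hom sq.w n
      simp only [HomologicalComplex.comp_f] at this
      rw [hb] at this
      simp [z, this])
    refine ⟨⟨⟨diskDesc x, ?_, ?_⟩⟩⟩
    · apply HomologicalComplex.from_single_hom_ext
      simp [sphereToDisk, diskDesc, hx₁, z]
    · ext
      · simp [diskDesc, hx₂, y]
      · have : b.f n = (HomologicalComplex.doubleXIso₁ (𝟙 P) _ hn).hom ≫ y ≫ Y.d (n + 1) n := by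
          simp [y, HomologicalComplex.double_d _ _ hn]
        simp [diskDesc, this, ← hx₂]

lemma hasLiftingProperty_zero_disk_iff (P : A) (n : ℤ) :
    HasLiftingProperty (0 : (0 : ChainComplex A ℤ) ⟶
      HomologicalComplex.double (𝟙 P) (c := ComplexShape.down ℤ)
        (show (ComplexShape.down ℤ).Rel (n + 1) n from rfl)) f ↔
      ∀ (y : P ⟶ Y.X (n + 1)), ∃ x : P ⟶ X.X (n + 1), x ≫ f.f (n + 1) = y := by
  have hn : n + 1 ≠ n := by simp
  constructor
  · intro h y
    have sq : CommSq (0 : 0 ⟶ X) (0 : (0 : ChainComplex A ℤ) ⟶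
      HomologicalComplex.double (𝟙 P) (c := ComplexShape.down ℤ)
        (show (ComplexShape.down ℤ).Rel (n + 1) n from rfl)) f (diskDesc y) := ⟨by simp⟩
    refine ⟨(HomologicalComplex.doubleXIso₀ (𝟙 P) _).inv ≫ sq.lift.f (n + 1), ?_⟩
    have h2 := HomologicalComplex.congr_hom sq.fac_right (n + 1)
    simp only [HomologicalComplex.comp_f] at h2
    rw [Category.assoc, h2]
    simp [diskDesc]
  · intro H
    refine ⟨fun {a b} sq ↦ ?_⟩
    let y : P ⟶ Y.X (n + 1) := (HomologicalComplex.doubleXIso₀ (𝟙 P) _).inv ≫ b.f (n + 1)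
    obtain ⟨x, hx⟩ := H y
    refine ⟨⟨⟨diskDesc x, (isZero_zero _).eq_of_src _ _, ?_⟩⟩⟩
    ext
    · simp [diskDesc, hx, y]
    · have : b.f n = (HomologicalComplex.doubleXIso₁ (𝟙 P) _ hn).hom ≫ y ≫ Y.d (n + 1) n := by
        simp [y, HomologicalComplex.double_d _ _ hn]
      simp [diskDesc, this, ← hx]

variable {f}

/-- The lifts are chosen summand by summand. This passes from the generators `R_c` to coproducts of
them, of which every object is a quotient. -/
lemma LiftsDisks.sigma {J : Type w} {P : J → A} [HasCoproduct P] (h : ∀ j, LiftsDisks (P j) f) :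
    LiftsDisks (∐ P) f := by
  intro n z y hz hzy
  choose x hx₁ hx₂ using fun j ↦ h j n (Sigma.ι P j ≫ z) (Sigma.ι P j ≫ y)
    (fun k ↦ by rw [Category.assoc, hz, comp_zero]) (by rw [Category.assoc, hzy, Category.assoc])
  refine ⟨Sigma.desc x, ?_, ?_⟩
  · ext j
    simp [hx₁]
  · ext j
    simp [hx₂]

/-- The disk property is used twice: first to lift the boundary of `y` to a cycle of `X`, then to
lift `y` itself with that cycle as boundary. -/
lemma LiftsDisks.exists_lift {P : A} (h : LiftsDisks P f) (n : ℤ) (y : P ⟶ Y.X n) :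
    ∃ x : P ⟶ X.X n, x ≫ f.f n = y := by
  obtain ⟨n, rfl⟩ : ∃ m, n = m + 1 + 1 := ⟨n - 2, by lia⟩
  obtain ⟨x', hx'₁, hx'₂⟩ := h n 0 (y ≫ Y.d (n + 1 + 1) (n + 1)) (by simp) (by simp)
  obtain ⟨x, -, hx⟩ := h (n + 1) x' y (fun k ↦ by
    by_cases hk : k + 1 = n + 1
    · obtain rfl : k = n := by lia
      exact hx'₁
    · rw [X.shape _ _ hk, comp_zero]) hx'₂
  exact ⟨x, hx⟩

lemma LiftsDisks.exists_lift_cycle {P : A} (h : LiftsDisks P f) (n : ℤ) (y : P ⟶ Y.X n)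
    (hy : ∀ k, y ≫ Y.d n k = 0) :
    ∃ x : P ⟶ X.X n, x ≫ f.f n = y ∧ ∀ k, x ≫ X.d n k = 0 := by
  obtain ⟨n, rfl⟩ : ∃ m, n = m + 1 := ⟨n - 1, by lia⟩
  obtain ⟨x, hx₁, hx₂⟩ := h n 0 y (by simp) (by simp [hy])
  refine ⟨x, hx₂, fun k ↦ ?_⟩
  by_cases hk : k + 1 = n + 1
  · obtain rfl : k = n := by lia
    exact hx₁
  · rw [X.shape _ _ hk, comp_zero]

/-- Every object is a quotient of an object `P` such that `f` lifts disks over `P`. -/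
lemma epi_of_liftsDisks (h : ∀ M : A, ∃ (P : A) (g : P ⟶ M), Epi g ∧ LiftsDisks P f) (n : ℤ) :
    Epi (f.f n) := by
  obtain ⟨P, g, _, hP⟩ := h (Y.X n)
  obtain ⟨x, hx⟩ := hP.exists_lift n g
  exact epi_of_epi_fac hx

/-- Injectivity and surjectivity on homology may be tested on generalized elements after an
epimorphic refinement, and the given epimorphism `P ⟶ M` serves as the refinement. -/
lemma quasiIso_of_liftsDisks (h : ∀ M : A, ∃ (P : A) (g : P ⟶ M), Epi g ∧ LiftsDisks P f) :
    QuasiIso f := by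
  refine ⟨fun n ↦ ?_⟩
  rw [quasiIsoAt_iff_isIso_homologyMap]
  obtain ⟨n, rfl⟩ : ∃ m, n = m + 1 := ⟨n - 1, by lia⟩
  have h1 : Mono (HomologicalComplex.homologyMap f (n + 1)) := by
    rw [HomologicalComplex.mono_homologyMap_iff_up_to_refinements f (n + 1 + 1) (n + 1) n
      (by simp) (by simp)]
    intro M z hz y hy
    obtain ⟨P, g, hg, hP⟩ := h M
    obtain ⟨x, hx, -⟩ := hP (n + 1) (g ≫ z) (g ≫ y) (fun k ↦ by
      by_cases hk : k + 1 = n + 1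
      · obtain rfl : k = n := by lia
        rw [Category.assoc, hz, comp_zero]
      · rw [X.shape _ _ hk, comp_zero]) (by rw [Category.assoc, hy, Category.assoc])
    exact ⟨P, g, hg, x, hx.symm⟩
  have h2 : Epi (HomologicalComplex.homologyMap f (n + 1)) := by
    rw [HomologicalComplex.epi_homologyMap_iff_up_to_refinements f (n + 1 + 1) (n + 1) n
      (by simp) (by simp)]
    intro M y hy
    obtain ⟨P, g, hg, hP⟩ := h M
    obtain ⟨x, hx, hx'⟩ := hP.exists_lift_cycle (n + 1) (g ≫ y) (fun k ↦ by
      by_cases hk : k + 1 = n + 1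
      · obtain rfl : k = n := by lia
        rw [Category.assoc, hy, comp_zero]
      · rw [Y.shape _ _ hk, comp_zero])
    exact ⟨P, g, hg, x, hx' n, 0, by simp [hx]⟩
  exact isIso_of_mono_of_epi _

omit [Abelian A] in
lemma exists_splitting {P Q : A} [Projective P] (g : Q ⟶ P) [Epi g] : ∃ s : P ⟶ Q, s ≫ g = 𝟙 P :=
  ⟨Projective.factorThru (𝟙 P) g, by simp⟩

/-- The usual chase. Injectivity on homology makes `z` a boundary `d x`; surjectivity corrects `x`
by a cycle so that `f x` and `y` differ by a boundary; a lift of the element bounding this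
difference corrects `x` once more. Projectivity of `P` splits the refinements and provides the last
lift. -/
lemma liftsDisks_of_quasiIso [QuasiIso f] (hf : ∀ n, Epi (f.f n)) (P : A) [Projective P] :
    LiftsDisks P f := by
  intro n z y hz hzy
  have hM : Mono (HomologicalComplex.homologyMap f n) := by
    infer_instance
  have hE : Epi (HomologicalComplex.homologyMap f (n + 1)) := by
    infer_instance
  obtain ⟨m, rfl⟩ : ∃ m, n = m + 1 := ⟨n - 1, by lia⟩
  rw [HomologicalComplex.mono_homologyMap_iff_up_to_refinements f (m + 1 + 1) (m + 1) m
      (by simp) (by simp)] at hM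
  rw [HomologicalComplex.epi_homologyMap_iff_up_to_refinements f (m + 1 + 1 + 1) (m + 1 + 1) (m + 1)
      (by simp) (by simp)] at hE
  obtain ⟨Q, π, _, x₁, hx₁⟩ := hM z (hz m) y hzy
  obtain ⟨s, hs⟩ := exists_splitting π
  let x := s ≫ x₁
  have hx : x ≫ X.d _ _ = z := by
    dsimp only [x]
    rw [Category.assoc, ← hx₁, reassoc_of% hs]
  -- The error `y - f x` is a cycle since both terms have boundary `f z`.
  obtain ⟨Q, π, _, x₂, hx₂, y₁, hy₁⟩ := hE (y - x ≫ f.f _) (by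
    rw [Preadditive.sub_comp, Category.assoc, f.comm, reassoc_of% hx, hzy, sub_self])
  obtain ⟨s, hs⟩ := exists_splitting π
  have := hf (m + 1 + 1 + 1)
  refine ⟨x + s ≫ x₂ + Projective.factorThru (s ≫ y₁) (f.f (m + 1 + 1 + 1)) ≫ X.d _ _, ?_, ?_⟩
  · simp [hx, hx₂]
  · have h3 := s ≫= hy₁
    rw [reassoc_of% hs] at h3
    have h4 : (Projective.factorThru (s ≫ y₁) (f.f (m + 1 + 1 + 1)) ≫ X.d _ (m + 1 + 1)) ≫ f.f _ =
        s ≫ y₁ ≫ Y.d _ _ := by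
      rw [Category.assoc, ← f.comm, Projective.factorThru_comp_assoc, Category.assoc]
    rw [Preadditive.add_comp, Preadditive.add_comp, h4, Category.assoc s, add_assoc (x ≫ f.f _),
      ← Preadditive.comp_add, ← h3]
    abel

end

end ChainComplexLifting

end

/-! ### Smallness of the generators, and the acyclic complex over a given complex -/

noncomputable section

open scoped ZeroObject Simplicial

/-- In a Grothendieck abelian category, a small family of monomorphisms permits the small object
argument. -/
lemma hasSmallObjectArgument_ofHoms_of_mono {A : Type u₂} [Category.{v₂} A] [Abelian A]
    [IsGrothendieckAbelian.{w} A] {ι : Type w} {s t : ι → A} (j : ∀ i, s i ⟶ t i)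
    [∀ i, Mono (j i)] : MorphismProperty.HasSmallObjectArgument.{w} (.ofHoms j) := by
  -- If `s i` has fewer than `κ` subobjects, maps out of it commute with colimits of `κ`-indexed
  -- chains of monomorphisms. Cell complexes built from the `j i` are such chains.
  obtain ⟨κ, hκ', hκ⟩ := HasCardinalLT.exists_regular_cardinal_forall.{w}
    (fun i ↦ Subobject (s i))
  have : Fact κ.IsRegular := ⟨hκ'⟩
  have : Nonempty κ.ord.ToType := by simpa using hκ'.ne_zero
  have := WellFoundedLT.toOrderBot κ.ord.ToType
  have hj : MorphismProperty.ofHoms j ≤ MorphismProperty.monomorphisms A := by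
    rintro _ _ _ ⟨i⟩
    exact inferInstanceAs (Mono _)
  exact ⟨κ, inferInstance, inferInstance,
    { preservesColimit {A B X Y} i hi f hf := by
        let hf' : (MorphismProperty.monomorphisms _).TransfiniteCompositionOfShape κ.ord.ToType f :=
          { toTransfiniteCompositionOfShape := hf.toTransfiniteCompositionOfShape
            map_mem j hj' := by
              have := (hf.attachCells j hj').pushouts_coproducts
              simp only [MorphismProperty.ofHoms_homFamily] at this
              refine (?_ : _ ≤ MorphismProperty.monomorphisms _) _ this
              simp only [MorphismProperty.pushouts_le_iff, MorphismProperty.coproducts_le_iff]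
              exact hj }
        have (j j' : κ.ord.ToType) (φ : j ⟶ j') : Mono (hf'.F.map φ) := hf'.mem_map φ
        apply IsGrothendieckAbelian.preservesColimit_coyoneda_obj_of_mono (Y := hf'.F) (κ := κ)
        obtain ⟨i⟩ := hi
        exact hκ i }⟩

namespace ChainComplexLifting

section

variable {A : Type u₂} [Category.{v₂} A] [Abelian A]

/-- The cone of the identity of `B`, shifted so that it maps onto `B`. -/
def pathComplex (B : ChainComplex A ℤ) : ChainComplex A ℤ where
  X n := B.X n ⊞ B.X (n + 1)
  -- The differential is `(x, y) ↦ (0, x)`, without the differential of `B`, which appears only in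
  -- `π`. The complex is thus a sum of disks.
  d i j := if h : j + 1 = i then
    biprod.desc (biprod.lift 0 (eqToHom (by rw [h]))) 0 else 0
  shape i j h := dif_neg h
  d_comp_d' i j k hij hjk := by
    change j + 1 = i at hij
    change k + 1 = j at hjk
    rw [dif_pos hij, dif_pos hjk]
    ext <;> simp

namespace pathComplex

variable (B : ChainComplex A ℤ)

/-- The first projection. -/
def fst (n : ℤ) : (pathComplex B).X n ⟶ B.X n := biprod.fst
/-- The second projection. -/
def snd (n : ℤ) : (pathComplex B).X n ⟶ B.X (n + 1) := biprod.snd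

/-- The map with the given components. -/
def lift {M : A} {n : ℤ} (x : M ⟶ B.X n) (y : M ⟶ B.X (n + 1)) : M ⟶ (pathComplex B).X n :=
  biprod.lift x y

@[simp]
lemma lift_fst {M : A} {n : ℤ} (x : M ⟶ B.X n) (y : M ⟶ B.X (n + 1)) :
    lift B x y ≫ fst B n = x := biprod.lift_fst _ _

@[simp]
lemma lift_snd {M : A} {n : ℤ} (x : M ⟶ B.X n) (y : M ⟶ B.X (n + 1)) :
    lift B x y ≫ snd B n = y := biprod.lift_snd _ _

@[simp]
lemma lift_snd_assoc {M : A} {n : ℤ} (x : M ⟶ B.X n) (y : M ⟶ B.X (n + 1)) {Z : A}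
    (h : B.X (n + 1) ⟶ Z) : lift B x y ≫ snd B n ≫ h = y ≫ h := by
  rw [← Category.assoc, lift_snd]

variable {B} in
lemma hom_ext {M : A} {n : ℤ} {x y : M ⟶ (pathComplex B).X n} (h₁ : x ≫ fst B n = y ≫ fst B n)
    (h₂ : x ≫ snd B n = y ≫ snd B n) : x = y := biprod.hom_ext _ _ h₁ h₂

lemma d_eq (n : ℤ) : (pathComplex B).d (n + 1) n = lift B 0 (fst B (n + 1)) := by
  refine (dif_pos rfl).trans ?_
  change biprod.desc (biprod.lift 0 (𝟙 _)) 0 = biprod.lift 0 biprod.fst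
  apply biprod.hom_ext' <;> apply biprod.hom_ext <;> simp only [biprod.inl_desc, biprod.inr_desc,
    Category.assoc, biprod.lift_fst, biprod.lift_snd, zero_comp, biprod.inl_fst,
    biprod.inr_fst] <;> exact comp_zero.symm

/-- The map `(x, y) ↦ x + d y`. -/
def π : pathComplex B ⟶ B where
  f n := fst B n + snd B n ≫ B.d (n + 1) n
  comm' i j hij := by
    change j + 1 = i at hij
    subst hij
    rw [d_eq]
    simp

instance (n : ℤ) : Epi ((π B).f n) :=
  epi_of_epi_fac (f := lift B (𝟙 _) 0) (h := 𝟙 _) (by simp [π])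

/-- The source is acyclic: a cycle has the form `(0, y)` and is the boundary of `(y, 0)`. -/
lemma homologyMap_π (n : ℤ) : HomologicalComplex.homologyMap (π B) n = 0 := by
  have : Mono (HomologicalComplex.homologyMap (0 : pathComplex B ⟶ 0) n) := by
    obtain ⟨n, rfl⟩ : ∃ m, n = m + 1 := ⟨n - 1, by lia⟩
    rw [HomologicalComplex.mono_homologyMap_iff_up_to_refinements _ (n + 1 + 1) (n + 1) n
      (by simp) (by simp)]
    intro M x hx y _
    rw [d_eq] at hx
    refine ⟨M, 𝟙 M, inferInstance, lift B (x ≫ snd B _) 0, ?_⟩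
    have h1 := hx =≫ snd B n
    rw [Category.assoc, lift_snd, zero_comp] at h1
    rw [d_eq]
    apply hom_ext <;> simp [h1]
  rw [← cancel_epi (𝟙 ((pathComplex B).homology n))]
  have h0 : 𝟙 ((pathComplex B).homology n) = 0 := by
    rw [← cancel_mono (HomologicalComplex.homologyMap (0 : pathComplex B ⟶ 0) n)]
    simp
  rw [h0, zero_comp, zero_comp]

end pathComplex

/-- Maps with the left lifting property against all degreewise epimorphisms are
quasi-isomorphisms. -/
lemma quasiIso_of_llp {A' B : ChainComplex A ℤ} (i : A' ⟶ B)
    (hi : ∀ ⦃X Y : ChainComplex A ℤ⦄ (p : X ⟶ Y), (∀ n, Epi (p.f n)) → HasLiftingProperty i p) :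
    QuasiIso i := by
  -- Lifting against `A' ⟶ 0` provides a retraction `r` of `i`.
  have h0 : HasLiftingProperty i (0 : A' ⟶ 0) := hi _ (fun n ↦
    ⟨fun _ _ _ ↦ (IsZero.eq_of_src (by
      exact (HomologicalComplex.eval A (ComplexShape.down ℤ) n).map_isZero (isZero_zero _)) _ _)⟩)
  have sq : CommSq (𝟙 A') i (0 : A' ⟶ 0) (0 : B ⟶ 0) := ⟨by simp⟩
  have hr : i ≫ sq.lift = 𝟙 A' := sq.fac_left
  have := hi (pathComplex.π B) inferInstance
  -- The map `1 - i r` vanishes on `A'`, so it lifts through the acyclic complex over `B`. It is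
  -- therefore zero on homology, where `r` becomes a two-sided inverse of `i`.
  have sq' : CommSq 0 i (pathComplex.π B) (𝟙 B - sq.lift ≫ i) := ⟨by
    rw [Preadditive.comp_sub, reassoc_of% hr]; simp⟩
  have h2 := sq'.fac_right
  refine ⟨fun n ↦ ?_⟩
  rw [quasiIsoAt_iff_isIso_homologyMap]
  refine ⟨HomologicalComplex.homologyMap sq.lift n, ?_, ?_⟩
  · rw [← HomologicalComplex.homologyMap_comp, hr, HomologicalComplex.homologyMap_id]
  · have h3 := congr_arg (HomologicalComplex.homologyMap · n) h2
    simp only [HomologicalComplex.homologyMap_comp, pathComplex.homologyMap_π, comp_zero,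
      HomologicalComplex.homologyMap_sub, HomologicalComplex.homologyMap_id] at h3
    exact (sub_eq_zero.1 h3.symm).symm

instance (P : A) (n : ℤ) : Mono (sphereToDisk P n) := by
  refine HomologicalComplex.mono_of_mono_f _ (fun k ↦ ?_)
  by_cases hk : k = n
  · subst hk
    rw [sphereToDisk, HomologicalComplex.mkHomFromSingle_f]
    infer_instance
  · exact ⟨fun _ _ _ ↦ (HomologicalComplex.isZero_single_obj_X _ _ _ _ hk).eq_of_tgt _ _⟩

end

end ChainComplexLifting

end

/-! ### The projective model structure -/

noncomputable section

open scoped ZeroObject Simplicial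

variable {C : Type u₁} [Category.{v₁} C] [EssentiallySmall.{u} C] (R : Cᵒᵖ ⥤ CommRingCat.{u})

open ChainComplexLifting

instance projective_freeR (c : C) : Projective (freeR R c) where
  factors {M N} f e he := by
    obtain ⟨x, hx⟩ := PresheafOfModules.surjective_of_epi e (op c) (freeREquiv R c N f)
    refine ⟨(freeREquiv R c _).symm x, (freeREquiv R c N).injective ?_⟩
    rw [freeREquiv_comp, Equiv.apply_symm_apply, hx]

/-- One summand `R_c` is taken for each section of `M` over each object of a small model of `C`,
which keeps the index set in the universe `u`. -/
lemma exists_epi_sigma_freeR (M : PMod R) : ∃ (J : Type u) (c : J → SmallModel.{u} C)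
    (g : ∐ (fun j ↦ freeR R ((equivSmallModel C).inverse.obj (c j))) ⟶ M), Epi g := by
  refine ⟨Σ c : SmallModel.{u} C, M.obj (op ((equivSmallModel C).inverse.obj c)), fun j ↦ j.1,
    Sigma.desc (fun j ↦ (freeREquiv R _ M).symm j.2), ⟨fun {N} f g h ↦ ?_⟩⟩
  apply (toSmallPresheaf R).map_injective
  ext ⟨c⟩ x
  have h1 := congr_arg (freeREquiv R _ N)
    (Sigma.ι (fun j : Σ c : SmallModel.{u} C, M.obj (op ((equivSmallModel C).inverse.obj c)) ↦
      freeR R ((equivSmallModel C).inverse.obj j.1)) ⟨c, x⟩ ≫= h)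
  rw [Sigma.ι_desc_assoc, Sigma.ι_desc_assoc, freeREquiv_comp, freeREquiv_comp,
    Equiv.apply_symm_apply] at h1
  exact h1

/-- A small set of generating cofibrations. -/
def smallGenCofibrations : MorphismProperty (PCh R) :=
  .ofHoms (fun (x : SmallModel.{u} C × ℤ) ↦ genI R ((equivSmallModel C).inverse.obj x.1) x.2)

/-- A small set of generating trivial cofibrations. -/
def smallGenTrivialCofibrations : MorphismProperty (PCh R) :=
  .ofHoms (fun (x : SmallModel.{u} C × ℤ) ↦
    (0 : 0 ⟶ diskR R ((equivSmallModel C).inverse.obj x.1) x.2))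

instance (c : C) (n : ℤ) : Mono (genI R c n) := inferInstanceAs (Mono (sphereToDisk _ _))

instance : MorphismProperty.HasSmallObjectArgument.{u} (smallGenCofibrations R) :=
  hasSmallObjectArgument_ofHoms_of_mono _

instance : MorphismProperty.HasSmallObjectArgument.{u} (smallGenTrivialCofibrations R) :=
  hasSmallObjectArgument_ofHoms_of_mono (A := PCh R) _

/-- The degreewise epimorphisms. -/
def degreewiseEpi : MorphismProperty (PCh R) := fun _ _ f ↦ ∀ n : ℤ, Epi (f.f n)

lemma exists_epi_liftsDisks {X Y : PCh R} {f : X ⟶ Y}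
    (h : ∀ c : SmallModel.{u} C, LiftsDisks (freeR R ((equivSmallModel C).inverse.obj c)) f)
    (M : PMod R) : ∃ (P : PMod R) (g : P ⟶ M), Epi g ∧ LiftsDisks P f := by
  obtain ⟨J, c, g, hg⟩ := exists_epi_sigma_freeR R M
  exact ⟨_, g, hg, LiftsDisks.sigma (fun j ↦ h _)⟩

lemma smallGenCofibrations_le : smallGenCofibrations R ≤ genCofibrations R := by
  rintro _ _ _ ⟨x⟩
  exact ⟨((equivSmallModel C).inverse.obj x.1, x.2)⟩

lemma smallGenCofibrations_rlp :
    (smallGenCofibrations R).rlp =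
      degreewiseEpi R ⊓ HomologicalComplex.quasiIso (PMod R) (ComplexShape.down ℤ) := by
  apply le_antisymm
  · intro X Y f hf
    have h := exists_epi_liftsDisks R (f := f) (fun c n ↦
      (hasLiftingProperty_sphereToDisk_iff f _ n).1 (hf _ ⟨(c, n)⟩))
    exact ⟨fun n ↦ epi_of_liftsDisks h n, quasiIso_of_liftsDisks h⟩
  · rintro X Y f ⟨hf, hf'⟩ _ _ _ ⟨x⟩
    have : QuasiIso f := hf'
    exact (hasLiftingProperty_sphereToDisk_iff f _ x.2).2 (liftsDisks_of_quasiIso hf _ _)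

/-- Every `R_c` is projective, so the possibly large family of all generators has the same right
lifting property as the small one, and hence gives the same cofibrations. -/
lemma genCofibrations_rlp :
    (genCofibrations R).rlp =
      degreewiseEpi R ⊓ HomologicalComplex.quasiIso (PMod R) (ComplexShape.down ℤ) := by
  apply le_antisymm
  · rw [← smallGenCofibrations_rlp]
    exact MorphismProperty.antitone_rlp (smallGenCofibrations_le R)
  · rintro X Y f ⟨hf, hf'⟩ _ _ _ ⟨x⟩
    have : QuasiIso f := hf'
    exact (hasLiftingProperty_sphereToDisk_iff f _ x.2).2 (liftsDisks_of_quasiIso hf _ _)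

lemma smallGenTrivialCofibrations_rlp :
    (smallGenTrivialCofibrations R).rlp = degreewiseEpi R := by
  apply le_antisymm
  · intro X Y f hf n
    obtain ⟨n, rfl⟩ : ∃ m, n = m + 1 := ⟨n - 1, by lia⟩
    obtain ⟨J, c, g, hg⟩ := exists_epi_sigma_freeR R (Y.X (n + 1))
    choose x hx using fun j ↦ (hasLiftingProperty_zero_disk_iff f _ n).1 (hf _ ⟨(c j, n)⟩)
      (Sigma.ι (fun j ↦ freeR R ((equivSmallModel C).inverse.obj (c j))) j ≫ g)
    have : Sigma.desc x ≫ f.f (n + 1) = g := Sigma.hom_ext _ _ (fun j ↦ by simp [hx])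
    exact epi_of_epi_fac this
  · rintro X Y f hf _ _ _ ⟨x⟩
    refine (hasLiftingProperty_zero_disk_iff f _ _).2 (fun y ↦ ?_)
    have := hf (x.2 + 1)
    exact ⟨Projective.factorThru y (f.f _), by simp⟩

/-- The cofibrations of the projective model structure. -/
def projectiveCofibrations : MorphismProperty (PCh R) :=
  (smallGenCofibrations R).rlp.llp

omit [EssentiallySmall.{u} C] in
lemma degreewiseEpi_llp_le_quasiIso :
    (degreewiseEpi R).llp ≤ HomologicalComplex.quasiIso (PMod R) (ComplexShape.down ℤ) :=
  fun _ _ i hi ↦ quasiIso_of_llp i (fun _ _ p hp ↦ hi p hp)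

/-- The inclusion of the right-hand side is the retract argument: factor a cofibration that is a
quasi-isomorphism as a map lifting against surjections followed by a surjection. The second factor
is a trivial fibration by two out of three, so the map lifts against it and is a retract of the
first factor. -/
lemma degreewiseEpi_llp : (degreewiseEpi R).llp =
    projectiveCofibrations R ⊓ HomologicalComplex.quasiIso (PMod R) (ComplexShape.down ℤ) := by
  apply le_antisymm
  · refine le_inf ?_ (degreewiseEpi_llp_le_quasiIso R)
    rw [projectiveCofibrations, smallGenCofibrations_rlp]
    exact MorphismProperty.antitone_llp inf_le_left
  · rintro X Y i ⟨hi, hi'⟩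
    let h := (MorphismProperty.functorialFactorizationData
      (smallGenTrivialCofibrations R).rlp.llp (smallGenTrivialCofibrations R).rlp).factorizationData i
    have h₁ : (degreewiseEpi R).llp h.i := by
      rw [← smallGenTrivialCofibrations_rlp]; exact h.hi
    have h₂ : degreewiseEpi R h.p := by
      rw [← smallGenTrivialCofibrations_rlp]; exact h.hp
    have hW : HomologicalComplex.quasiIso (PMod R) (ComplexShape.down ℤ) h.i :=
      degreewiseEpi_llp_le_quasiIso R _ h₁
    have hW' : HomologicalComplex.quasiIso (PMod R) (ComplexShape.down ℤ) h.p :=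
      MorphismProperty.of_precomp _ h.i h.p hW (by rw [h.fac]; exact hi')
    have : HasLiftingProperty i h.p := hi _ (by
      rw [smallGenCofibrations_rlp]; exact ⟨h₂, hW'⟩)
    exact MorphismProperty.of_retract (RetractArrow.ofLeftLiftingProperty h.fac) h₁

/-- The projective model structure. -/
abbrev projectiveModelStructure : ModelCategory (PCh R) :=
  letI : CategoryWithFibrations (PCh R) := ⟨degreewiseEpi R⟩
  letI : CategoryWithCofibrations (PCh R) := ⟨projectiveCofibrations R⟩
  letI : CategoryWithWeakEquivalences (PCh R) :=
    ⟨HomologicalComplex.quasiIso (PMod R) (ComplexShape.down ℤ)⟩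
  haveI : (weakEquivalences (PCh R)).HasTwoOutOfThreeProperty :=
    inferInstanceAs (HomologicalComplex.quasiIso (PMod R)
      (ComplexShape.down ℤ)).HasTwoOutOfThreeProperty
  have h₁ : trivialFibrations (PCh R) = (smallGenCofibrations R).rlp :=
    (smallGenCofibrations_rlp R).symm
  have h₂ : trivialCofibrations (PCh R) = (smallGenTrivialCofibrations R).rlp.llp := by
    rw [smallGenTrivialCofibrations_rlp, degreewiseEpi_llp]; rfl
  haveI : MorphismProperty.IsWeakFactorizationSystem (cofibrations (PCh R))
      (trivialFibrations (PCh R)) :=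
    { llp := by rw [h₁]; rfl
      rlp := by rw [h₁]; exact MorphismProperty.rlp_llp_rlp _
      hasFactorization := by
        rw [h₁]
        exact inferInstanceAs (MorphismProperty.HasFactorization
          (smallGenCofibrations R).rlp.llp (smallGenCofibrations R).rlp) }
  haveI : MorphismProperty.IsWeakFactorizationSystem (trivialCofibrations (PCh R))
      (fibrations (PCh R)) :=
    { llp := by rw [h₂, smallGenTrivialCofibrations_rlp]; rfl
      rlp := by
        rw [h₂, MorphismProperty.rlp_llp_rlp, smallGenTrivialCofibrations_rlp]; rfl
      hasFactorization := by
        have h₃ : fibrations (PCh R) = (smallGenTrivialCofibrations R).rlp :=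
          (smallGenTrivialCofibrations_rlp R).symm
        rw [h₂, h₃]
        infer_instance }
  ModelCategory.mk' (PCh R)

/-- A class defined by a left lifting property is closed under all cell operations and retracts.
Conversely, the small object argument presents each cofibration as a retract of a cell complex,
using generators from the small set only. -/
lemma relativeCellComplexes_retracts :
    (relativeCellComplexes R).retracts = projectiveCofibrations R := by
  apply le_antisymm
  · have h : projectiveCofibrations R = (genCofibrations R).rlp.llp := by
      rw [projectiveCofibrations, smallGenCofibrations_rlp, genCofibrations_rlp]
    rw [h]
    have : genCofibrations R ≤ (genCofibrations R).rlp.llp := MorphismProperty.le_llp_rlp _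
    rw [MorphismProperty.retracts_le_iff, relativeCellComplexes,
      MorphismProperty.transfiniteCompositions_le_iff, MorphismProperty.pushouts_le_iff,
      MorphismProperty.coproducts_le_iff]
    exact this
  · rw [projectiveCofibrations, MorphismProperty.llp_rlp_of_hasSmallObjectArgument.{u}]
    apply MorphismProperty.retracts_monotone
    apply MorphismProperty.transfiniteCompositions_monotone
    apply MorphismProperty.pushouts_monotone
    apply MorphismProperty.coproducts_monotone
    exact smallGenCofibrations_le R

lemma isProjectiveModelStructure :
    IsProjectiveModelStructure R (projectiveModelStructure R) := by
  let _ := projectiveModelStructure R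
  have h₁ : trivialFibrations (PCh R) = (smallGenCofibrations R).rlp :=
    (smallGenCofibrations_rlp R).symm
  have h₂ : trivialCofibrations (PCh R) = (smallGenTrivialCofibrations R).rlp.llp := by
    rw [smallGenTrivialCofibrations_rlp, degreewiseEpi_llp]; rfl
  have h₃ : fibrations (PCh R) = (smallGenTrivialCofibrations R).rlp :=
    (smallGenTrivialCofibrations_rlp R).symm
  exact
    { weakEquivalences_iff f := by
        change QuasiIso f ↔ _
        rw [quasiIso_iff]
        exact forall_congr' (fun n ↦ quasiIsoAt_iff_isIso_homologyMap f n)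
      fibrations_iff f := by
        change (∀ n, Epi (f.f n)) ↔ _
        refine forall_congr' (fun n ↦ ?_)
        rw [PresheafOfModules.epi_iff_surjective]
        exact ⟨fun h c ↦ @h (op c), fun h c ↦ h c.unop⟩
      cofibrations_eq := (relativeCellComplexes_retracts R).symm
      hasLimits := inferInstance
      hasColimits := inferInstance
      functorial₁ := by
        rw [h₂, h₃]
        infer_instance
      functorial₂ := by
        rw [h₁]
        exact inferInstanceAs (MorphismProperty.HasFunctorialFactorization
          (smallGenCofibrations R).rlp.llp (smallGenCofibrations R).rlp) }

end

/-! ### Graded maps, the Hom complex, and shifted cones -/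

noncomputable section

open scoped ZeroObject Simplicial

namespace ChainComplexLifting

variable {A : Type u₂} [Category.{v₂} A] [Abelian A]

/-- Families of maps `B_p ⟶ X_q` for `p + n = q`. -/
abbrev GradedHom (B X : ChainComplex A ℤ) (n : ℤ) : Type v₂ :=
  ∀ t : { t : ℤ × ℤ // t.1 + n = t.2 }, (B.X t.1.1 ⟶ X.X t.1.2)

namespace GradedHom

/-- The components of a graded map. -/
abbrev v {B X : ChainComplex A ℤ} {n : ℤ} (h : GradedHom B X n) (p q : ℤ) (hpq : p + n = q) :
    B.X p ⟶ X.X q := h ⟨(p, q), hpq⟩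

/-- A graded map from its components. -/
abbrev mk {B X : ChainComplex A ℤ} {n : ℤ} (h : ∀ p q : ℤ, p + n = q → (B.X p ⟶ X.X q)) :
    GradedHom B X n := fun t ↦ h t.1.1 t.1.2 t.2

lemma ext {B X : ChainComplex A ℤ} {n : ℤ} {h h' : GradedHom B X n}
    (H : ∀ (p q : ℤ) (hpq : p + n = q), h.v p q hpq = h'.v p q hpq) : h = h' := by
  funext ⟨⟨p, q⟩, hpq⟩
  exact H p q hpq

/-- The differential of the Hom complex. -/
def D {B X : ChainComplex A ℤ} {n n' : ℤ} (hn : n' + 1 = n) (h : GradedHom B X n) :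
    GradedHom B X n' :=
  -- The sign depends on the degree `p` in the source. With the Koszul sign of `B ⊗ kNR[S]`, whose
  -- second summand carries `(-1) ^ p`, a chain map out of the tensor product then satisfies `D h_s
  -- = ∑ (-1) ^ i h_{d_i s}` with no further sign.
  mk fun p q hpq ↦ p.negOnePow • (h.v p (q + 1) (by lia) ≫ X.d (q + 1) q -
    B.d p (p - 1) ≫ h.v (p - 1) q (by lia))

/-- Postcomposition. -/
def post {B X Y : ChainComplex A ℤ} {n : ℤ} (f : X ⟶ Y) (h : GradedHom B X n) : GradedHom B Y n :=
  mk fun p q hpq ↦ h.v p q hpq ≫ f.f q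

/-- Precomposition. -/
def pre {A' B X : ChainComplex A ℤ} {n : ℤ} (i : A' ⟶ B) (h : GradedHom B X n) :
    GradedHom A' X n :=
  mk fun p q hpq ↦ i.f p ≫ h.v p q hpq

lemma D_v {B X : ChainComplex A ℤ} {n n' : ℤ} (hn : n' + 1 = n) (h : GradedHom B X n)
    {p q : ℤ} (hpq : p + n' = q) {p' q' : ℤ} (hp : p' + 1 = p) (hq : q + 1 = q') :
    (D hn h).v p q hpq = p.negOnePow • (h.v p q' (by lia) ≫ X.d q' q -
      B.d p p' ≫ h.v p' q (by lia)) := by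
  obtain rfl : p' = p - 1 := by lia
  subst hq
  rfl

lemma D_post {B X Y : ChainComplex A ℤ} {n n' : ℤ} (hn : n' + 1 = n) (f : X ⟶ Y)
    (h : GradedHom B X n) : D hn (post f h) = post f (D hn h) := by
  refine ext fun p q hpq ↦ ?_
  simp [D, post, Preadditive.sub_comp]

lemma D_pre {A' B X : ChainComplex A ℤ} {n n' : ℤ} (hn : n' + 1 = n) (i : A' ⟶ B)
    (h : GradedHom B X n) : D hn (pre i h) = pre i (D hn h) := by
  refine ext fun p q hpq ↦ ?_
  simp [D, pre, Preadditive.comp_sub]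

lemma D_D {B X : ChainComplex A ℤ} {n n' n'' : ℤ} (hn : n' + 1 = n) (hn' : n'' + 1 = n')
    (h : GradedHom B X n) : D hn' (D hn h) = 0 := by
  refine ext fun p q hpq ↦ ?_
  obtain ⟨p, rfl⟩ : ∃ r, p = r + 1 + 1 := ⟨p - 2, by lia⟩
  simp only [D, Preadditive.sub_comp, Preadditive.comp_sub, Linear.units_smul_comp,
    Linear.comp_units_smul, Category.assoc, HomologicalComplex.d_comp_d, comp_zero,
    HomologicalComplex.d_comp_d_assoc, zero_comp, zero_sub, sub_zero, smul_neg,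
    Int.negOnePow_sub, Int.negOnePow_one, Pi.zero_apply]
  simp

end GradedHom

section

variable {X Y X' Y' : ChainComplex A ℤ}

/-- The component `X_i ⟶ Y_j` of a map of complexes, for `i = j`. -/
def componentOfEq (f : X ⟶ Y) {i j : ℤ} (h : i = j) : X.X i ⟶ Y.X j :=
  f.f i ≫ (Y.XIsoOfEq h).hom

lemma componentOfEq_comp_d (f : X ⟶ Y) {i j k l : ℤ} (h : i = j) (h' : k = l) :
    componentOfEq f h ≫ Y.d j l = X.d i k ≫ componentOfEq f h' := by
  subst h h'
  simp [componentOfEq]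

lemma componentOfEq_comp (f : X ⟶ Y) (g : Y ⟶ Y') {i j : ℤ} (h : i = j) :
    componentOfEq f h ≫ g.f j = f.f i ≫ componentOfEq g h := by
  subst h
  simp [componentOfEq]

lemma comp_componentOfEq {f : X ⟶ Y} {f' : X' ⟶ Y'} {a : X ⟶ X'} {b : Y ⟶ Y'}
    (h : f ≫ b = a ≫ f') {i j : ℤ} (hij : i = j) :
    f.f i ≫ componentOfEq b hij = a.f i ≫ componentOfEq f' hij := by
  have := HomologicalComplex.congr_hom h i
  simp only [HomologicalComplex.comp_f] at this
  subst hij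
  simp [componentOfEq, this]

lemma componentOfEq_eq_XIsoOfEq_hom_comp (f : X ⟶ Y) {i j : ℤ} (h : i = j) :
    componentOfEq f h = (X.XIsoOfEq h).hom ≫ f.f j := by
  subst h
  simp [componentOfEq]

@[simp]
lemma componentOfEq_rfl (f : X ⟶ Y) (i : ℤ) : componentOfEq f (rfl : i = i) = f.f i := by
  simp [componentOfEq]

/-- The (shifted) mapping cone of `f`. Maps from `B` to it are graded maps `h` of degree `n + 1`
to `Y` and cycles `z` of degree `n` to `X` such that `f z` is the differential of `h`. -/
def shiftedCone (f : X ⟶ Y) (n : ℤ) : ChainComplex A ℤ where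
  X p := Y.X (p + n + 1) ⊞ X.X (p + n)
  d i j := if h : j + 1 = i then
      biprod.lift (biprod.fst ≫ Y.d (i + n + 1) (j + n + 1) -
        i.negOnePow • biprod.snd ≫ componentOfEq f (by lia))
        (biprod.snd ≫ X.d (i + n) (j + n)) else 0
  shape i j h := dif_neg h
  d_comp_d' i j k hij hjk := by
    change j + 1 = i at hij
    change k + 1 = j at hjk
    rw [dif_pos hij, dif_pos hjk]
    subst hij hjk
    apply biprod.hom_ext
    · simp only [Category.assoc, biprod.lift_fst, Preadditive.comp_sub, biprod.lift_fst_assoc,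
        Preadditive.sub_comp, HomologicalComplex.d_comp_d, comp_zero, zero_sub,
        Linear.comp_units_smul, Linear.units_smul_comp, biprod.lift_snd_assoc, zero_comp]
      rw [componentOfEq_comp_d f (i := k + 1 + 1 + n) (k := k + 1 + n) _ (by lia),
        Int.negOnePow_succ (k + 1), Units.neg_smul]
      simp
    · simp

namespace shiftedCone

variable (f : X ⟶ Y) (n : ℤ)

/-- The first projection. -/
def fst (p : ℤ) : (shiftedCone f n).X p ⟶ Y.X (p + n + 1) := biprod.fst
/-- The second projection. -/
def snd (p : ℤ) : (shiftedCone f n).X p ⟶ X.X (p + n) := biprod.snd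
/-- The map with the given components. -/
def lift {M : A} {p : ℤ} (x : M ⟶ Y.X (p + n + 1)) (y : M ⟶ X.X (p + n)) :
    M ⟶ (shiftedCone f n).X p := biprod.lift x y

@[simp]
lemma lift_fst {M : A} {p : ℤ} (x : M ⟶ Y.X (p + n + 1)) (y : M ⟶ X.X (p + n)) :
    lift f n x y ≫ fst f n p = x := biprod.lift_fst _ _

@[simp]
lemma lift_snd {M : A} {p : ℤ} (x : M ⟶ Y.X (p + n + 1)) (y : M ⟶ X.X (p + n)) :
    lift f n x y ≫ snd f n p = y := biprod.lift_snd _ _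

variable {f n} in
lemma hom_ext {M : A} {p : ℤ} {x y : M ⟶ (shiftedCone f n).X p}
    (h₁ : x ≫ fst f n p = y ≫ fst f n p)
    (h₂ : x ≫ snd f n p = y ≫ snd f n p) : x = y := biprod.hom_ext _ _ h₁ h₂

lemma d_fst {p q : ℤ} (h : q + 1 = p) : (shiftedCone f n).d p q ≫ fst f n q =
    fst f n p ≫ Y.d (p + n + 1) (q + n + 1) -
      p.negOnePow • snd f n p ≫ componentOfEq f (by lia) := by
  have : (shiftedCone f n).d p q = _ := dif_pos h
  rw [this]
  exact biprod.lift_fst _ _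

lemma d_snd {p q : ℤ} (h : q + 1 = p) : (shiftedCone f n).d p q ≫ snd f n q =
    snd f n p ≫ X.d (p + n) (q + n) := by
  have : (shiftedCone f n).d p q = _ := dif_pos h
  rw [this]
  exact biprod.lift_snd _ _

variable {f} {f' : X' ⟶ Y'}

/-- The functoriality of the cone. -/
def map (a : X ⟶ X') (b : Y ⟶ Y') (h : f ≫ b = a ≫ f') :
    shiftedCone f n ⟶ shiftedCone f' n where
  f p := lift f' n (fst f n p ≫ b.f _) (snd f n p ≫ a.f _)
  comm' i j hij := by
    change j + 1 = i at hij
    apply hom_ext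
    · rw [Category.assoc, Category.assoc, d_fst _ _ hij, lift_fst, Preadditive.comp_sub,
        Linear.comp_units_smul, ← Category.assoc, ← Category.assoc, lift_fst, lift_snd,
        ← Category.assoc _ (fst f n j), d_fst _ _ hij, Preadditive.sub_comp,
        Linear.units_smul_comp, Category.assoc, Category.assoc, Category.assoc, Category.assoc,
        componentOfEq_comp, b.comm]
      rw [comp_componentOfEq h]
    · rw [Category.assoc, Category.assoc, d_snd _ _ hij, lift_snd, ← Category.assoc, lift_snd,
        ← Category.assoc _ (snd f n j), d_snd _ _ hij, Category.assoc, a.comm, Category.assoc]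

@[simp]
lemma map_f_fst (a : X ⟶ X') (b : Y ⟶ Y') (h : f ≫ b = a ≫ f') (p : ℤ) :
    (map n a b h).f p ≫ fst f' n p = fst f n p ≫ b.f _ := lift_fst ..

@[simp]
lemma map_f_snd (a : X ⟶ X') (b : Y ⟶ Y') (h : f ≫ b = a ≫ f') (p : ℤ) :
    (map n a b h).f p ≫ snd f' n p = snd f n p ≫ a.f _ := lift_snd ..

variable {n}

/-- Maps to the cone from graded maps. -/
def liftGraded {B : ChainComplex A ℤ} (h : GradedHom B Y (n + 1)) (z : GradedHom B X n)
    (hz : GradedHom.D (n' := n - 1) (by lia) z = 0) (hh : h.D rfl = z.post f) :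
    B ⟶ shiftedCone f n where
  f p := lift f n (h.v p _ (by lia)) (z.v p _ rfl)
  comm' i j hij := by
    change j + 1 = i at hij
    apply hom_ext
    · rw [Category.assoc, Category.assoc, d_fst _ _ hij, lift_fst, Preadditive.comp_sub,
        Linear.comp_units_smul, ← Category.assoc, ← Category.assoc, lift_fst, lift_snd]
      have h1 := congr_fun hh ⟨(i, j + n + 1), by simp; lia⟩
      have h2 := h.D_v rfl (p := i) (q := j + n + 1) (by lia) hij (q' := i + n + 1) (by lia)
      have h3 : ∀ (k : ℤ) (hk : i + n = k), (z.post f).v i k hk = z.v i (i + n) rfl ≫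
          componentOfEq f hk := by
        rintro _ rfl
        rw [componentOfEq_rfl]; rfl
      rw [← h3]
      have h4 : (z.post f).v i (j + n + 1) (by lia) = _ := h1.symm.trans h2
      rw [h4, smul_smul, ← Int.negOnePow_add, Int.negOnePow_even _ (by simp), one_smul]
      abel
    · rw [Category.assoc, Category.assoc, d_snd _ _ hij, lift_snd, ← Category.assoc, lift_snd]
      have h1 : _ = (0 : B.X i ⟶ X.X (j + n)) := congr_fun hz ⟨(i, j + n), by simp; lia⟩
      have h2 := z.D_v (n' := n - 1) (by lia) (p := i) (q := j + n) (by lia) hij (q' := i + n)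
        (by lia)
      have h3 := h2.symm.trans h1
      rw [smul_eq_zero_iff_eq, sub_eq_zero] at h3
      exact h3

/-- The degree `n + 1` part of a map to the cone. -/
def gradedFst {B : ChainComplex A ℤ} (φ : B ⟶ shiftedCone f n) : GradedHom B Y (n + 1) :=
  .mk fun p q hpq ↦ φ.f p ≫ fst f n p ≫ (Y.XIsoOfEq (by lia)).hom

/-- The degree `n` part of a map to the cone. -/
def gradedSnd {B : ChainComplex A ℤ} (φ : B ⟶ shiftedCone f n) : GradedHom B X n :=
  .mk fun p q hpq ↦ φ.f p ≫ snd f n p ≫ (X.XIsoOfEq (by lia)).hom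

@[simp]
lemma gradedFst_v {B : ChainComplex A ℤ} (φ : B ⟶ shiftedCone f n) (p : ℤ) :
    (gradedFst φ).v p (p + n + 1) (by lia) = φ.f p ≫ fst f n p := by
  simp [gradedFst, GradedHom.mk, GradedHom.v]

@[simp]
lemma gradedSnd_v {B : ChainComplex A ℤ} (φ : B ⟶ shiftedCone f n) (p : ℤ) :
    (gradedSnd φ).v p (p + n) rfl = φ.f p ≫ snd f n p := by
  simp [gradedSnd, GradedHom.mk, GradedHom.v]

lemma D_gradedFst {B : ChainComplex A ℤ} (φ : B ⟶ shiftedCone f n) :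
    (gradedFst φ).D rfl = (gradedSnd φ).post f := by
  refine GradedHom.ext fun p q hpq ↦ ?_
  obtain ⟨p', hp⟩ : ∃ p', p' + 1 = p := ⟨p - 1, by lia⟩
  have hq : q = p' + n + 1 := by lia
  subst hq
  rw [GradedHom.D_v rfl _ _ hp (q' := p + n + 1) (by lia), gradedFst_v, gradedFst_v,
    ← Category.assoc (B.d p p'), ← φ.comm, Category.assoc, Category.assoc, d_fst _ _ hp,
    Preadditive.comp_sub, sub_sub_cancel, Linear.comp_units_smul, smul_smul, ← Int.negOnePow_add,
    Int.negOnePow_even _ (by simp), one_smul]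
  simp only [GradedHom.post, gradedSnd, GradedHom.v, GradedHom.mk, Category.assoc]
  rw [componentOfEq_eq_XIsoOfEq_hom_comp]

lemma post_gradedFst {B : ChainComplex A ℤ} (φ : B ⟶ shiftedCone f n) (a : X ⟶ X') (b : Y ⟶ Y')
    (h : f ≫ b = a ≫ f') : (gradedFst φ).post b = gradedFst (φ ≫ map n a b h) := by
  refine GradedHom.ext fun p q hpq ↦ ?_
  obtain rfl : q = p + n + 1 := by lia
  rw [gradedFst_v, HomologicalComplex.comp_f, Category.assoc, map_f_fst, ← Category.assoc,
    ← gradedFst_v]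
  rfl

lemma post_gradedSnd {B : ChainComplex A ℤ} (φ : B ⟶ shiftedCone f n) (a : X ⟶ X') (b : Y ⟶ Y')
    (h : f ≫ b = a ≫ f') : (gradedSnd φ).post a = gradedSnd (φ ≫ map n a b h) := by
  refine GradedHom.ext fun p q hpq ↦ ?_
  subst hpq
  rw [gradedSnd_v, HomologicalComplex.comp_f, Category.assoc, map_f_snd, ← Category.assoc,
    ← gradedSnd_v]
  rfl

lemma pre_gradedFst {A' B : ChainComplex A ℤ} (i : A' ⟶ B) (φ : B ⟶ shiftedCone f n) :
    (gradedFst φ).pre i = gradedFst (i ≫ φ) := by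
  refine GradedHom.ext fun p q hpq ↦ ?_
  simp [gradedFst, GradedHom.mk, GradedHom.v, GradedHom.pre]

lemma gradedFst_liftGraded {B : ChainComplex A ℤ} (h : GradedHom B Y (n + 1)) (z : GradedHom B X n)
    (hz : GradedHom.D (n' := n - 1) (by lia) z = 0) (hh : h.D rfl = z.post f) :
    gradedFst (liftGraded h z hz hh) = h := by
  refine GradedHom.ext fun p q hpq ↦ ?_
  obtain rfl : q = p + n + 1 := by lia
  rw [gradedFst_v]
  exact lift_fst ..

lemma gradedSnd_liftGraded {B : ChainComplex A ℤ} (h : GradedHom B Y (n + 1)) (z : GradedHom B X n)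
    (hz : GradedHom.D (n' := n - 1) (by lia) z = 0) (hh : h.D rfl = z.post f) :
    gradedSnd (liftGraded h z hz hh) = z := by
  refine GradedHom.ext fun p q hpq ↦ ?_
  subst hpq
  rw [gradedSnd_v]
  exact lift_snd ..

end shiftedCone

lemma LiftsDisks.of_eq {P : A} {f : X ⟶ Y} (h : LiftsDisks P f) {m n : ℤ} (hn : n + 1 = m)
    (z : P ⟶ X.X n) (y : P ⟶ Y.X m) (hz : ∀ k, z ≫ X.d n k = 0)
    (hzy : z ≫ f.f n = y ≫ Y.d m n) :
    ∃ x : P ⟶ X.X m, x ≫ X.d m n = z ∧ x ≫ f.f m = y := by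
  subst hn
  exact h n z y hz hzy

namespace shiftedCone

/-- This is the contractibility of the cone of an identity: the second component of a cycle is, up
to sign, the boundary of the first. -/
lemma snd_eq_of_cycle {P : A} {n m : ℤ} {z : P ⟶ (shiftedCone (𝟙 X) n).X m}
    (hz : ∀ k, z ≫ (shiftedCone (𝟙 X) n).d m k = 0) {k : ℤ} (hk : m + n = k):
    m.negOnePow • z ≫ fst (𝟙 X) n m ≫ X.d (m + n + 1) k =
      (z ≫ snd (𝟙 X) n m) ≫ componentOfEq (𝟙 X) hk := by
  have h1 := hz (m - 1) =≫ fst _ _ _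
  rw [zero_comp, Category.assoc, d_fst _ _ (by lia), Preadditive.comp_sub, Linear.comp_units_smul,
    sub_eq_zero] at h1
  obtain rfl : k = m - 1 + n + 1 := by lia
  rw [h1, smul_smul, ← Int.negOnePow_add, Int.negOnePow_even _ (by simp), one_smul, Category.assoc]

end shiftedCone

end

end ChainComplexLifting

end

/-! ### Lifting graded maps through maps of shifted cones -/

noncomputable section

open scoped ZeroObject Simplicial

namespace ChainComplexLifting

variable {A : Type u₂} [Category.{v₂} A] [Abelian A] {X Y X' Y' : ChainComplex A ℤ}

namespace shiftedCone

lemma negOnePow_smul_smul {M : Type*} [AddCommGroup M] (m : ℤ) (x : M) :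
    m.negOnePow • m.negOnePow • x = x := by
  rw [smul_smul, ← Int.negOnePow_add, Int.negOnePow_even _ (by simp), one_smul]

lemma componentOfEq_id_comp {i j k : ℤ} (h : i = j) (f : X ⟶ Y) (h' : j = k) :
    componentOfEq (𝟙 X) h ≫ componentOfEq f h' = componentOfEq f (h.trans h') := by
  subst h h'
  simp

/-- The first component of the cone differential contains `f` applied to the second coordinate, and
the equation can be solved for that term. -/
lemma fst_eq_of_comm {P : A} {n m : ℤ} {f : X ⟶ Y} {z : P ⟶ (shiftedCone f n).X m}
    {y : P ⟶ (shiftedCone f n).X (m + 1)} (h : z = y ≫ (shiftedCone f n).d (m + 1) m) :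
    (y ≫ snd f n (m + 1)) ≫ componentOfEq f (by lia) =
      (m + 1).negOnePow • ((y ≫ fst f n (m + 1)) ≫ Y.d (m + 1 + n + 1) (m + n + 1)
        - z ≫ fst f n m) := by
  subst h
  rw [Category.assoc _ _ (fst f n m), d_fst _ _ rfl, Preadditive.comp_sub, Category.assoc,
    Category.assoc, sub_sub_cancel, Linear.comp_units_smul, negOnePow_smul_smul]

/-- The map of cones is the identity on the second summand, so the second component of the lift is
that of `y`. Finding the first component is a disk lifting problem for `f` itself. -/
lemma liftsDisks_map_id {P : A} {f : X ⟶ Y} (hf : LiftsDisks P f) (n : ℤ) :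
    LiftsDisks P (map n (f := 𝟙 X) (f' := f) (𝟙 X) f rfl) := by
  intro m z y hz hzy
  have F1 := fst_eq_of_comm hzy
  have F2 := hzy =≫ snd f n m
  simp only [Category.assoc, map_f_fst, d_snd f n (p := m + 1) rfl, map_f_snd,
    HomologicalComplex.id_f, Category.comp_id] at F1 F2
  have F3 := snd_eq_of_cycle hz rfl
  rw [componentOfEq_rfl, HomologicalComplex.id_f, Category.comp_id] at F3
  -- The boundary prescribed for `a` is what the first component of `d (a, snd y) = z` requires.
  obtain ⟨a, ha, ha'⟩ := hf.of_eq (m := m + 1 + n + 1) (n := m + n + 1) (by lia)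
    (z ≫ fst _ _ _ + (m + 1).negOnePow • (y ≫ snd _ _ _) ≫ componentOfEq (𝟙 X) (by lia))
    (y ≫ fst _ _ _) (fun k ↦ by
      by_cases hk : k = m + n
      · subst hk
        rw [Preadditive.add_comp, Linear.units_smul_comp, Category.assoc, Category.assoc,
          componentOfEq_comp_d (𝟙 X) (k := m + n) _ rfl, componentOfEq_rfl,
          HomologicalComplex.id_f, Category.comp_id, Category.assoc, ← F2, ← F3,
          Int.negOnePow_succ, Units.neg_smul, negOnePow_smul_smul, add_neg_cancel]
      · rw [X.shape _ _ (by simp; lia), comp_zero]) (by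
      rw [Preadditive.add_comp, Linear.units_smul_comp, Category.assoc, Category.assoc,
        componentOfEq_comp, HomologicalComplex.id_f, Category.id_comp, Category.assoc, F1,
        negOnePow_smul_smul, Category.assoc, add_sub_cancel])
  refine ⟨lift _ _ a (y ≫ snd _ _ _), ?_, ?_⟩
  · apply hom_ext
    · rw [Category.assoc, d_fst _ _ rfl, Preadditive.comp_sub, Linear.comp_units_smul,
        ← Category.assoc, ← Category.assoc, lift_fst, lift_snd, ha, add_sub_cancel_right]
    · rw [Category.assoc, d_snd _ _ rfl, ← Category.assoc, lift_snd, Category.assoc, F2]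
  · apply hom_ext
    · rw [Category.assoc, map_f_fst, ← Category.assoc, lift_fst, ha']
    · rw [Category.assoc, map_f_snd, ← Category.assoc, lift_snd, HomologicalComplex.id_f,
        Category.comp_id]

/-- Both cones are contractible, so surjectivity of `f` suffices: any lift `a` of the first
component of `y` works, and the second component is then forced. -/
lemma liftsDisks_map {P : A} [Projective P] {f : X ⟶ Y} (hf : ∀ p, Epi (f.f p)) (n : ℤ) :
    LiftsDisks P (map n (f := 𝟙 X) (f' := 𝟙 Y) f f (by simp)) := by
  intro m z y hz hzy
  have F1 := fst_eq_of_comm hzy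
  have F2 := hzy =≫ snd (𝟙 Y) n m
  simp only [Category.assoc, map_f_fst, d_snd (𝟙 Y) n (p := m + 1) rfl, map_f_snd] at F1 F2
  have F3 := snd_eq_of_cycle hz rfl
  rw [componentOfEq_rfl, HomologicalComplex.id_f, Category.comp_id] at F3
  have := hf (m + 1 + n + 1)
  let a := Projective.factorThru (y ≫ fst _ _ _) (f.f (m + 1 + n + 1))
  have ha : a ≫ f.f _ = y ≫ fst _ _ _ := Projective.factorThru_comp _ _
  -- This is the solution in `b` of the first component of `d (a, b) = z`. The second component of
  -- that equation follows because `z` is a cycle.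
  let b := ((m + 1).negOnePow • (a ≫ X.d (m + 1 + n + 1) (m + n + 1) - z ≫ fst _ _ _)) ≫
    componentOfEq (𝟙 X) (show m + n + 1 = m + 1 + n by lia)
  have hb₁ : b ≫ f.f _ = y ≫ snd _ _ _ := by
    have h1 : y ≫ snd _ n (m + 1) = (y ≫ snd _ n (m + 1) ≫ componentOfEq (𝟙 Y)
        (show m + 1 + n = m + n + 1 by lia)) ≫ componentOfEq (𝟙 Y) (by lia) := by
      rw [Category.assoc, Category.assoc, componentOfEq_id_comp, componentOfEq_rfl,
        HomologicalComplex.id_f, Category.comp_id]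
    rw [h1, F1]
    dsimp only [b]
    rw [Category.assoc, componentOfEq_comp, HomologicalComplex.id_f, Category.id_comp,
      Linear.units_smul_comp, Linear.units_smul_comp, ← reassoc_of% ha, f.comm]
    rw [show z ≫ fst (𝟙 X) n m ≫ f.f (m + n + 1) = (z ≫ fst (𝟙 X) n m) ≫ f.f (m + n + 1) by simp,
      ← Category.assoc, ← Preadditive.sub_comp, Category.assoc]
    congr 2
    rw [comp_componentOfEq (f := f) (f' := f) (a := 𝟙 X) (b := 𝟙 Y) (by simp)]
    simp
  have hb₂ : b ≫ X.d (m + 1 + n) (m + n) = z ≫ snd _ _ _ := by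
    dsimp only [b]
    rw [Category.assoc, componentOfEq_comp_d (𝟙 X) (k := m + n) _ rfl, componentOfEq_rfl,
      HomologicalComplex.id_f, Category.comp_id, Linear.units_smul_comp, Preadditive.sub_comp,
      Category.assoc, X.d_comp_d, comp_zero, zero_sub, Category.assoc, smul_neg, ← Units.neg_smul,
      Int.negOnePow_succ, neg_neg, F3]
  refine ⟨lift _ _ a b, ?_, ?_⟩
  · apply hom_ext
    · rw [Category.assoc, d_fst _ _ rfl, Preadditive.comp_sub, Linear.comp_units_smul,
        ← Category.assoc, ← Category.assoc, lift_fst, lift_snd]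
      dsimp only [b]
      rw [Category.assoc, componentOfEq_id_comp, componentOfEq_rfl, HomologicalComplex.id_f,
        Category.comp_id, negOnePow_smul_smul, sub_sub_cancel]
    · rw [Category.assoc, d_snd _ _ rfl, ← Category.assoc, lift_snd, hb₂]
  · apply hom_ext
    · rw [Category.assoc, map_f_fst, ← Category.assoc, lift_fst, ha]
    · rw [Category.assoc, map_f_snd, ← Category.assoc, lift_snd, hb₁]

end shiftedCone

section

variable {A' B : ChainComplex A ℤ} {i : A' ⟶ B} {f : X ⟶ Y}

lemma GradedHom.post_id {n : ℤ} (h : GradedHom A' X n) : h.post (𝟙 X) = h :=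
  ext fun p q hpq ↦ by simp [post]

lemma shiftedCone.hom_ext' {n : ℤ} {φ ψ : B ⟶ shiftedCone f n} (h₁ : gradedFst φ = gradedFst ψ)
    (h₂ : gradedSnd φ = gradedSnd ψ) : φ = ψ := by
  ext p
  apply hom_ext
  · simpa using congr_fun h₁ ⟨(p, p + n + 1), by simp; lia⟩
  · simpa using congr_fun h₂ ⟨(p, p + n), rfl⟩

lemma shiftedCone.pre_gradedSnd {n : ℤ} (φ : B ⟶ shiftedCone f n) :
    (gradedSnd φ).pre i = gradedSnd (i ≫ φ) := by
  refine GradedHom.ext fun p q hpq ↦ ?_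
  simp [gradedSnd, GradedHom.mk, GradedHom.v, GradedHom.pre]

end

section

variable [EnoughProjectives A]

lemma epi_and_quasiIso_of_liftsDisks {f : X ⟶ Y}
    (h : ∀ (P : A) [Projective P], LiftsDisks P f) : (∀ n, Epi (f.f n)) ∧ QuasiIso f := by
  have h' (M : A) : ∃ (P : A) (g : P ⟶ M), Epi g ∧ LiftsDisks P f :=
    ⟨_, Projective.π M, inferInstance, h _⟩
  exact ⟨fun n ↦ epi_of_liftsDisks h' n, quasiIso_of_liftsDisks h'⟩

variable {A' B : ChainComplex A ℤ} {i : A' ⟶ B} {f : X ⟶ Y}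

/-- In each degree the map of cones is `f ⊕ id`, hence epi. If moreover `f` is a quasi-isomorphism,
so is the map of cones, by the disk criterion. -/
lemma shiftedCone.hasLiftingProperty_map_id
    (hi : ∀ ⦃X Y : ChainComplex A ℤ⦄ (p : X ⟶ Y), (∀ n, Epi (p.f n)) → QuasiIso p →
      HasLiftingProperty i p) (hf : ∀ n, Epi (f.f n))
    (hif : (∀ ⦃X Y : ChainComplex A ℤ⦄ (p : X ⟶ Y), (∀ n, Epi (p.f n)) →
      HasLiftingProperty i p) ∨ QuasiIso f) (n : ℤ) :
    HasLiftingProperty i (shiftedCone.map n (f := 𝟙 X) (f' := f) (𝟙 X) f rfl) := by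
  obtain hi' | _ := hif
  · refine hi' _ (fun p ↦ ?_)
    have := hf (p + n + 1)
    have (Z W : A) (g : Z ⟶ W) [Epi g] (Z' : A) : Epi (biprod.map g (𝟙 Z')) := inferInstance
    have h1 : (shiftedCone.map n (f := 𝟙 X) (f' := f) (𝟙 X) f rfl).f p =
        biprod.map (f.f (p + n + 1)) (𝟙 _) := by
      apply shiftedCone.hom_ext
      · rw [shiftedCone.map_f_fst]; exact (biprod.map_fst _ _).symm
      · rw [shiftedCone.map_f_snd]; exact (biprod.map_snd _ _).symm
    rw [h1]
    exact this _ _ _ _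
  · obtain ⟨h1, h2⟩ := epi_and_quasiIso_of_liftsDisks (fun P _ ↦
      shiftedCone.liftsDisks_map_id (liftsDisks_of_quasiIso hf P) n)
    exact hi _ h1 h2

/-- Lifting of graded maps, given a prescribed differential. -/
lemma exists_lift_gradedHom_of_D
    (hi : ∀ ⦃X Y : ChainComplex A ℤ⦄ (p : X ⟶ Y), (∀ n, Epi (p.f n)) → QuasiIso p →
      HasLiftingProperty i p) (hf : ∀ n, Epi (f.f n))
    (hif : (∀ ⦃X Y : ChainComplex A ℤ⦄ (p : X ⟶ Y), (∀ n, Epi (p.f n)) →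
      HasLiftingProperty i p) ∨ QuasiIso f) {n n' : ℤ} (hn : n' + 1 = n)
    (hY : GradedHom B Y n) (hA : GradedHom A' X n) (z : GradedHom B X n')
    (hz : GradedHom.D (n' := n' - 1) (by lia) z = 0) (w : hA.post f = hY.pre i)
    (wA : z.pre i = hA.D hn) (wY : z.post f = hY.D hn) :
    ∃ h : GradedHom B X n, h.pre i = hA ∧ h.post f = hY ∧ h.D hn = z := by
  subst hn
  have := shiftedCone.hasLiftingProperty_map_id hi hf hif n'
  -- On `A'` the second component is both the restriction of `z` and the differential of `hA`, by
  -- `wA`. On `B` the pair `(hY, z)` is a map to `cone(f)` by `wY`.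
  have sq : CommSq (shiftedCone.liftGraded (f := 𝟙 X) hA (z.pre i)
      (by rw [GradedHom.D_pre, hz]; ext; simp [GradedHom.pre]) (by rw [GradedHom.post_id, wA])) i
    (shiftedCone.map n' (f := 𝟙 X) (f' := f) (𝟙 X) f rfl)
    (shiftedCone.liftGraded hY z hz wY.symm) := ⟨by
      apply shiftedCone.hom_ext'
      · rw [← shiftedCone.post_gradedFst, shiftedCone.gradedFst_liftGraded,
          ← shiftedCone.pre_gradedFst, shiftedCone.gradedFst_liftGraded, w]
      · rw [← shiftedCone.post_gradedSnd, shiftedCone.gradedSnd_liftGraded,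
          ← shiftedCone.pre_gradedSnd, shiftedCone.gradedSnd_liftGraded, GradedHom.post_id]⟩
  refine ⟨shiftedCone.gradedFst sq.lift, ?_, ?_, ?_⟩
  · rw [shiftedCone.pre_gradedFst, sq.fac_left, shiftedCone.gradedFst_liftGraded]
  · rw [shiftedCone.post_gradedFst _ (𝟙 X) _ rfl, sq.fac_right, shiftedCone.gradedFst_liftGraded]
  -- The second component of the lift is `z`, the map of cones being the identity there; for a map
  -- to `cone(id)` it is also the differential of the first component.
  · rw [shiftedCone.D_gradedFst, shiftedCone.post_gradedSnd _ _ f rfl, sq.fac_right,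
      shiftedCone.gradedSnd_liftGraded]

/-- Lifting of graded maps. -/
lemma exists_lift_gradedHom
    (hi : ∀ ⦃X Y : ChainComplex A ℤ⦄ (p : X ⟶ Y), (∀ n, Epi (p.f n)) → QuasiIso p →
      HasLiftingProperty i p) (hf : ∀ n, Epi (f.f n)) {n : ℤ}
    (hY : GradedHom B Y n) (hA : GradedHom A' X n) (w : hA.post f = hY.pre i) :
    ∃ h : GradedHom B X n, h.pre i = hA ∧ h.post f = hY := by
  obtain ⟨n, rfl⟩ : ∃ m, n = m + 1 := ⟨n - 1, by lia⟩
  obtain ⟨h1, h2⟩ := epi_and_quasiIso_of_liftsDisks (fun P _ ↦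
      shiftedCone.liftsDisks_map (P := P) hf n)
  have := hi _ h1 h2
  -- Into the cone of an identity every graded map `h` gives the chain map `(h, D h)`.
  have sq : CommSq (shiftedCone.liftGraded (f := 𝟙 X) hA (hA.D rfl)
      (GradedHom.D_D _ _ _) (by rw [GradedHom.post_id])) i
    (shiftedCone.map n (f := 𝟙 X) (f' := 𝟙 Y) f f (by simp))
    (shiftedCone.liftGraded (f := 𝟙 Y) hY (hY.D rfl)
      (GradedHom.D_D _ _ _) (by rw [GradedHom.post_id])) := ⟨by
      apply shiftedCone.hom_ext'
      · rw [← shiftedCone.post_gradedFst, shiftedCone.gradedFst_liftGraded,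
          ← shiftedCone.pre_gradedFst, shiftedCone.gradedFst_liftGraded, w]
      · rw [← shiftedCone.post_gradedSnd, shiftedCone.gradedSnd_liftGraded,
          ← shiftedCone.pre_gradedSnd, shiftedCone.gradedSnd_liftGraded, ← GradedHom.D_post,
          ← GradedHom.D_pre, w]⟩
  refine ⟨shiftedCone.gradedFst sq.lift, ?_, ?_⟩
  · rw [shiftedCone.pre_gradedFst, sq.fac_left, shiftedCone.gradedFst_liftGraded]
  · rw [shiftedCone.post_gradedFst (f' := 𝟙 Y) _ f f (by simp), sq.fac_right,
      shiftedCone.gradedFst_liftGraded]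

end

end ChainComplexLifting

end

noncomputable section

open scoped ZeroObject Simplicial

/-! ### Normalized chains on a simplicial set -/

/-- The coproduct of copies of the one point set indexed by `T` is `T`. -/
def punitCofanIsColimit (T : Type u) :
    IsColimit (Cofan.mk T (fun t : T ↦ (↾(fun _ : PUnit.{u + 1} ↦ t)))) :=
  Cofan.IsColimit.mk _ (fun s ↦ ↾(fun t ↦ s.inj t PUnit.unit))
    (fun s t ↦ by ext; rfl)
    (fun s m hm ↦ by
      ext t
      exact congr_arg (fun f ↦ f PUnit.unit) (hm t))

section

variable {A' : Type u₃} [Category.{v₃} A'] (F : Type u ⥤ A')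

/-- The map `F(pt) ⟶ F(T)` corresponding to `t : T`. -/
abbrev pointMap {T : Type u} (t : T) : F.obj PUnit ⟶ F.obj T := F.map (↾(fun _ ↦ t))

lemma pointMap_map {T T' : Type u} (t : T) (f : T ⟶ T') :
    pointMap F t ≫ F.map f = pointMap F (f t) := by
  rw [← F.map_comp]; rfl

variable [PreservesColimitsOfSize.{u, u} F]

/-- A functor which preserves colimits sends `T` to a coproduct of copies of the value at the
point. -/
def pointMapIsColimit (T : Type u) : IsColimit (Cofan.mk (F.obj T) (pointMap F (T := T))) :=
  isColimitCofanMkObjOfIsColimit F _ _ (punitCofanIsColimit T)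

variable {F} in
lemma pointMap_hom_ext {T : Type u} {M : A'} {f g : F.obj T ⟶ M}
    (h : ∀ t, pointMap F t ≫ f = pointMap F t ≫ g) : f = g :=
  Cofan.IsColimit.hom_ext (pointMapIsColimit F T) _ _ h

/-- The map with given components. -/
def pointDesc {T : Type u} {M : A'} (x : T → (F.obj PUnit ⟶ M)) : F.obj T ⟶ M :=
  Cofan.IsColimit.desc (pointMapIsColimit F T) x

@[simp]
lemma pointMap_pointDesc {T : Type u} {M : A'} (x : T → (F.obj PUnit ⟶ M)) (t : T) :
    pointMap F t ≫ pointDesc F x = x t :=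
  Cofan.IsColimit.fac (pointMapIsColimit F T) x t

end

section

open AlgebraicTopology AlgebraicTopology.DoldKan

variable {A : Type u₂} [Category.{v₂} A] [Abelian A]

/-- The projection onto the normalized complex. -/
def toNormalized (X : SimplicialObject A) (m : ℕ) : X _⦋m⦌ ⟶ (Abelian.DoldKan.N.obj X).X m :=
  (PInftyToNormalizedMooreComplex X).f m

/-- The inclusion of the normalized complex. -/
def ofNormalized (X : SimplicialObject A) (m : ℕ) : (Abelian.DoldKan.N.obj X).X m ⟶ X _⦋m⦌ :=
  (inclusionOfMooreComplexMap X).f m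

lemma toNormalized_ofNormalized (X : SimplicialObject A) (m : ℕ) :
    toNormalized X m ≫ ofNormalized X m = PInfty.f m :=
  HomologicalComplex.congr_hom (PInftyToNormalizedMooreComplex_comp_inclusionOfMooreComplexMap X) m

instance (X : SimplicialObject A) (m : ℕ) : Mono (ofNormalized X m) :=
  inferInstanceAs (Mono (NormalizedMooreComplex.objX X m).arrow)

lemma ofNormalized_toNormalized (X : SimplicialObject A) (m : ℕ) :
    ofNormalized X m ≫ toNormalized X m = 𝟙 _ := by
  rw [← cancel_mono (ofNormalized X m), Category.assoc, toNormalized_ofNormalized,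
    Category.id_comp]
  exact HomologicalComplex.congr_hom (inclusionOfMooreComplexMap_comp_PInfty X) m

lemma σ_toNormalized (X : SimplicialObject A) {m : ℕ} (i : Fin (m + 1)) :
    X.σ i ≫ toNormalized X (m + 1) = 0 := by
  rw [← cancel_mono (ofNormalized X _), Category.assoc, toNormalized_ofNormalized, zero_comp]
  exact σ_comp_PInfty X i

lemma toNormalized_d (X : SimplicialObject A) (m : ℕ) :
    toNormalized X (m + 1) ≫ (Abelian.DoldKan.N.obj X).d (m + 1) m =
      (∑ i : Fin (m + 2), (-1 : ℤ) ^ (i : ℕ) • X.δ i) ≫ toNormalized X m :=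
  ((PInftyToNormalizedMooreComplex X).comm (m + 1) m).trans
    (congr_arg (fun φ : X _⦋m + 1⦌ ⟶ X _⦋m⦌ ↦ φ ≫ toNormalized X m)
      (AlternatingFaceMapComplex.obj_d_eq X m))

lemma toNormalized_map {X Y : SimplicialObject A} (f : X ⟶ Y) (m : ℕ) :
    toNormalized X m ≫ (Abelian.DoldKan.N.map f).f m = f.app (op ⦋m⦌) ≫ toNormalized Y m :=
  (HomologicalComplex.congr_hom (PInftyToNormalizedMooreComplex_naturality f) m).symm

variable {A' : Type u₃} [Category.{v₃} A'] [Preadditive A'] (T : A ⥤ A') [T.Additive]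

/-- The complementary projector `QInfty` is a sum of maps factoring through degeneracies, so it
contributes nothing to `ψ`. The additive functor `T` allows the same argument after applying `B_p ⊗
-`. -/
lemma map_PInfty_comp (X : SimplicialObject A) {m : ℕ} {M : A'} (ψ : T.obj (X _⦋m + 1⦌) ⟶ M)
    (h : ∀ i, T.map (X.σ i) ≫ ψ = 0) : T.map (PInfty.f (m + 1)) ≫ ψ = ψ := by
  have h1 := PInfty_f_add_QInfty_f (X := X) (m + 1)
  have h2 : T.map (QInfty.f (m + 1) : X _⦋m + 1⦌ ⟶ _) ≫ ψ = 0 := by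
    rw [QInfty_f, decomposition_Q, Functor.map_sum, Preadditive.sum_comp]
    refine Finset.sum_eq_zero (fun i _ ↦ ?_)
    rw [T.map_comp, T.map_comp, Category.assoc, Category.assoc, h, comp_zero, comp_zero]
  have h3 := T.congr_map h1 =≫ ψ
  rw [T.map_add, Preadditive.add_comp, h2, add_zero, T.map_id, Category.id_comp] at h3
  exact h3

omit [Preadditive A'] [T.Additive] in
lemma normalized_hom_ext (X : SimplicialObject A) {m : ℕ} {M : A'}
    {φ ψ : T.obj ((Abelian.DoldKan.N.obj X).X m) ⟶ M}
    (h : T.map (toNormalized X m) ≫ φ = T.map (toNormalized X m) ≫ ψ) : φ = ψ := by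
  have h3 := T.map (ofNormalized X m) ≫= h
  rw [← T.map_comp_assoc, ← T.map_comp_assoc, ofNormalized_toNormalized, T.map_id,
    Category.id_comp, Category.id_comp] at h3
  exact h3

/-- The normalized complex, defined as a subobject, is also the quotient by the degeneracies. As
this quotient is split, the property persists under any additive `T`. -/
lemma exists_normalized_desc (X : SimplicialObject A) {m : ℕ} {M : A'}
    (ψ : T.obj (X _⦋m⦌) ⟶ M)
    (h : ∀ (n : ℕ) (hn : n + 1 = m) (i : Fin (n + 1)), T.map (X.σ i ≫ eqToHom (by rw [hn])) ≫ ψ = 0) :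
    ∃ φ : T.obj ((Abelian.DoldKan.N.obj X).X m) ⟶ M, T.map (toNormalized X m) ≫ φ = ψ := by
  refine ⟨T.map (ofNormalized X m) ≫ ψ, ?_⟩
  rw [← T.map_comp_assoc, toNormalized_ofNormalized]
  obtain _ | n := m
  · exact (T.map_id _ =≫ ψ).trans (Category.id_comp ψ)
  · refine map_PInfty_comp T X ψ (fun i ↦ ?_)
    have := h n rfl i
    rwa [eqToHom_refl, Category.comp_id] at this

variable (L : Type u ⥤ A)

/-- The simplicial object freely generated by `S`. -/
abbrev freeSimplicial (S : SSet.{u}) : SimplicialObject A :=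
  ((SimplicialObject.whiskering _ _).obj L).obj S

/-- The normalized chain complex of the simplicial object freely generated by `S`. -/
abbrev normalizedChains (S : SSet.{u}) : ChainComplex A ℕ :=
  Abelian.DoldKan.N.obj (freeSimplicial L S)

/-- The projection onto the normalized chains. -/
def toChains (S : SSet.{u}) (m : ℕ) : L.obj (S _⦋m⦌) ⟶ (normalizedChains L S).X m :=
  toNormalized (freeSimplicial L S) m

/-- The element of the normalized chains given by a simplex. -/
def cell (S : SSet.{u}) {m : ℕ} (s : S _⦋m⦌) : L.obj PUnit ⟶ (normalizedChains L S).X m :=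
  pointMap L s ≫ toChains L S m

lemma cell_σ (S : SSet.{u}) {m : ℕ} (i : Fin (m + 1)) (s : S _⦋m⦌) :
    cell L S (S.σ i s) = 0 := by
  have h2 : L.map (S.σ i) ≫ toChains L S (m + 1) = 0 := σ_toNormalized (freeSimplicial L S) i
  rw [cell, ← pointMap_map L s (S.σ i), Category.assoc, h2, comp_zero]

lemma cell_d (S : SSet.{u}) {m : ℕ} (s : S _⦋m + 1⦌) :
    cell L S s ≫ (normalizedChains L S).d (m + 1) m =
      ∑ i : Fin (m + 2), (-1 : ℤ) ^ (i : ℕ) • cell L S (S.δ i s) := by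
  have h : toChains L S (m + 1) ≫ (normalizedChains L S).d (m + 1) m =
    (∑ i : Fin (m + 2), (-1 : ℤ) ^ (i : ℕ) • L.map (S.δ i)) ≫ toChains L S m :=
      toNormalized_d (freeSimplicial L S) m
  rw [cell, Category.assoc, h, Preadditive.sum_comp, Preadditive.comp_sum]
  refine Finset.sum_congr rfl (fun i _ ↦ ?_)
  rw [Preadditive.zsmul_comp, Preadditive.comp_zsmul, cell, ← pointMap_map L s (S.δ i),
    Category.assoc]

lemma cell_map {S S' : SSet.{u}} (f : S ⟶ S') {m : ℕ} (s : S _⦋m⦌) :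
    cell L S s ≫ (Abelian.DoldKan.N.map
      (((SimplicialObject.whiskering _ _).obj L).map f)).f m = cell L S' (f.app _ s) := by
  have h : toChains L S m ≫ (Abelian.DoldKan.N.map
      (((SimplicialObject.whiskering _ _).obj L).map f)).f m =
      L.map (f.app _) ≫ toChains L S' m :=
    toNormalized_map (((SimplicialObject.whiskering _ _).obj L).map f) m
  rw [cell, Category.assoc, h, cell, ← pointMap_map L s (f.app _), Category.assoc]

variable {T L}

variable [PreservesColimitsOfSize.{u, u} (L ⋙ T)]

omit [Preadditive A'] [T.Additive] in
lemma cell_hom_ext {S : SSet.{u}} {m : ℕ} {M : A'}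
    {φ ψ : T.obj ((normalizedChains L S).X m) ⟶ M}
    (h : ∀ s : S _⦋m⦌, T.map (cell L S s) ≫ φ = T.map (cell L S s) ≫ ψ) : φ = ψ := by
  refine normalized_hom_ext T (freeSimplicial L S) ?_
  have h1 : T.map (toChains L S m) ≫ φ = T.map (toChains L S m) ≫ ψ := by
    refine pointMap_hom_ext (F := L ⋙ T) (fun s ↦ ?_)
    have := h s
    rw [cell, T.map_comp, Category.assoc, Category.assoc] at this
    exact this
  exact h1

/-- `L ⋙ T` preserves coproducts, so before normalization a map amounts to its values on all
simplices; normalization imposes vanishing on the degenerate ones. -/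
lemma exists_cell_desc {S : SSet.{u}} {m : ℕ} {M : A'} (x : S _⦋m⦌ → (T.obj (L.obj PUnit) ⟶ M))
    (hx : ∀ s, s ∈ S.degenerate m → x s = 0) :
    ∃ φ : T.obj ((normalizedChains L S).X m) ⟶ M,
      ∀ s, T.map (cell L S s) ≫ φ = x s := by
  obtain ⟨φ, hφ⟩ := exists_normalized_desc T (freeSimplicial L S)
    (pointDesc (L ⋙ T) x) (fun n hn i ↦ by
      subst hn
      refine pointMap_hom_ext (F := L ⋙ T) (fun s ↦ ?_)
      have h1 := pointMap_map (L ⋙ T) s (S.σ i)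
      have h2 := hx _ (S.σ_mem_degenerate i s)
      rw [← pointMap_pointDesc (L ⋙ T) x, ← h1, Category.assoc] at h2
      rw [eqToHom_refl, Category.comp_id]
      exact h2.trans comp_zero.symm)
  refine ⟨φ, fun s ↦ ?_⟩
  have h1 : T.map (toChains L S m) ≫ φ = pointDesc (L ⋙ T) x := hφ
  rw [cell, T.map_comp, Category.assoc, h1]
  exact (pointMap_pointDesc (L ⋙ T) x s)

end

end

/-! ### Normalized chains with coefficients in `R`, and global sections as maps from the unit -/

noncomputable section

open scoped ZeroObject Simplicial

variable {C : Type u₁} [Category.{v₁} C] (R : Cᵒᵖ ⥤ CommRingCat.{u})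

/-- The free presheaf of modules on a constant presheaf of sets. -/
abbrev freeConst : Type u ⥤ PMod R :=
  Functor.const Cᵒᵖ ⋙ PresheafOfModules.free (R ⋙ forget₂ CommRingCat RingCat)

/-- Natural transformations from the constant presheaf with value a point are sections. -/
def constPUnitHomEquiv (P : Cᵒᵖ ⥤ Type u) :
    ((Functor.const Cᵒᵖ).obj PUnit.{u + 1} ⟶ P) ≃ P.sections where
  toFun φ := ⟨fun c ↦ φ.app c PUnit.unit, fun {c d} f ↦
    (congr_arg (fun g ↦ g PUnit.unit) (φ.naturality f)).symm⟩
  invFun s := { app c := ↾(fun _ ↦ s.1 c), naturality c d f := by ext; exact (s.2 f).symm }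
  left_inv φ := rfl
  right_inv s := rfl

/-- Maps from the free presheaf of modules on a point are maps from the unit. -/
def freeConstPUnitHomEquiv (M : PMod R) : ((freeConst R).obj PUnit ⟶ M) ≃ (𝟙_ (PMod R) ⟶ M) :=
  PresheafOfModules.freeHomEquiv.trans ((constPUnitHomEquiv _).trans
    (PresheafOfModules.unitHomEquiv M).symm)

lemma freeConstPUnitHomEquiv_comp {M N : PMod R} (f : (freeConst R).obj PUnit ⟶ M) (g : M ⟶ N) :
    freeConstPUnitHomEquiv R N (f ≫ g) = freeConstPUnitHomEquiv R M f ≫ g := by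
  apply (PresheafOfModules.unitHomEquiv N).injective
  refine (Equiv.apply_symm_apply _ _).trans ?_
  have h := Equiv.apply_symm_apply (PresheafOfModules.unitHomEquiv M)
    (constPUnitHomEquiv _ (PresheafOfModules.freeHomEquiv f))
  refine Eq.trans ?_ (congr_arg (PresheafOfModules.sectionsMap g) h).symm
  rfl

/-- The free presheaf of modules on a point is the unit. -/
def freeConstPUnitIso : (freeConst R).obj PUnit ≅ 𝟙_ (PMod R) where
  hom := (freeConstPUnitHomEquiv R _).symm (𝟙 _)
  inv := freeConstPUnitHomEquiv R _ (𝟙 _)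
  hom_inv_id := (freeConstPUnitHomEquiv R _).injective (by
    rw [freeConstPUnitHomEquiv_comp, Equiv.apply_symm_apply, Category.id_comp])
  inv_hom_id := by
    rw [← freeConstPUnitHomEquiv_comp, Category.id_comp, Equiv.apply_symm_apply]

instance : PreservesColimitsOfSize.{u, u} (freeConst R) := by
  have := (PresheafOfModules.freeAdjunction.{u} (R ⋙ forget₂ CommRingCat RingCat)).leftAdjoint_preservesColimits
  have : PreservesColimitsOfSize.{u, u} (Functor.const Cᵒᵖ : Type u ⥤ _) := inferInstance
  exact comp_preservesColimits _ _

/-- The isomorphism of the degree `m` part of the normalized chains. -/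
def chainsXIso (S : SSet.{u}) (m : ℕ) :
    ((simplicialChains R).obj S).X (m : ℤ) ≅ (normalizedChains (freeConst R) S).X m :=
  (normalizedChains (freeConst R) S).extendXIso nonnegEmbedding (i := m) rfl

lemma isZero_chains_X (S : SSet.{u}) (q : ℤ) (hq : q < 0) :
    IsZero (((simplicialChains R).obj S).X q) :=
  HomologicalComplex.isZero_extend_X _ _ _ (fun i hi ↦ by
    have h : (i : ℤ) = q := hi
    lia)

/-- The element of the normalized chains given by a simplex. -/
def chainCell {S : SSet.{u}} {m : ℕ} (s : S _⦋m⦌) :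
    𝟙_ (PMod R) ⟶ ((simplicialChains R).obj S).X (m : ℤ) :=
  (freeConstPUnitIso R).inv ≫ cell (freeConst R) S s ≫ (chainsXIso R S m).inv

variable {R}

lemma chainCell_eq_zero {S : SSet.{u}} {m : ℕ} (s : S _⦋m⦌) (hs : s ∈ S.degenerate m) :
    chainCell R s = 0 := by
  obtain _ | m := m
  · simp at hs
  · rw [S.degenerate_eq_iUnion_range_σ, Set.mem_iUnion] at hs
    obtain ⟨i, s, rfl⟩ := hs
    rw [chainCell, cell_σ, zero_comp, comp_zero]

lemma chainCell_d {S : SSet.{u}} {m : ℕ} (s : S _⦋m + 1⦌) :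
    chainCell R s ≫ ((simplicialChains R).obj S).d ((m + 1 : ℕ) : ℤ) (m : ℤ) =
      ∑ i : Fin (m + 2), (-1 : ℤ) ^ (i : ℕ) • chainCell R (S.δ i s) := by
  have h : ((simplicialChains R).obj S).d ((m + 1 : ℕ) : ℤ) (m : ℤ) =
    (chainsXIso R S (m + 1)).hom ≫ (normalizedChains (freeConst R) S).d (m + 1) m ≫
      (chainsXIso R S m).inv := HomologicalComplex.extend_d_eq _ _ _ _
  rw [h, chainCell, Category.assoc, Category.assoc, Iso.inv_hom_id_assoc,
    ← Category.assoc (cell _ _ _), cell_d, Preadditive.sum_comp, Preadditive.comp_sum]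
  refine Finset.sum_congr rfl (fun i _ ↦ ?_)
  rw [Preadditive.zsmul_comp, Preadditive.comp_zsmul, chainCell]

lemma chainCell_map {S S' : SSet.{u}} (f : S ⟶ S') {m : ℕ} (s : S _⦋m⦌) :
    chainCell R s ≫ ((simplicialChains R).map f).f (m : ℤ) = chainCell R (f.app _ s) := by
  have h : ((simplicialChains R).map f).f (m : ℤ) =
    (chainsXIso R S m).hom ≫ (Abelian.DoldKan.N.map
      (((SimplicialObject.whiskering _ _).obj (freeConst R)).map f)).f m ≫
      (chainsXIso R S' m).inv := HomologicalComplex.extendMap_f _ _ _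
  rw [h, chainCell, Category.assoc, Category.assoc, Iso.inv_hom_id_assoc,
    ← Category.assoc (cell _ _ _), cell_map, chainCell]

section

variable {A' : Type u₃} [Category.{v₃} A'] {T : PMod R ⥤ A'} [PreservesColimitsOfSize.{u, u} T]

lemma chainCell_hom_ext {S : SSet.{u}} {m : ℕ} {M : A'}
    {φ ψ : T.obj (((simplicialChains R).obj S).X (m : ℤ)) ⟶ M}
    (h : ∀ s : S _⦋m⦌, T.map (chainCell R s) ≫ φ = T.map (chainCell R s) ≫ ψ) : φ = ψ := by
  rw [← cancel_epi (T.map (chainsXIso R S m).inv)]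
  refine cell_hom_ext (T := T) (L := freeConst R) (fun s ↦ ?_)
  rw [← cancel_epi (T.map (freeConstPUnitIso R).inv)]
  simpa only [chainCell, T.map_comp, Category.assoc] using h s

variable [Preadditive A'] [T.Additive]

lemma exists_chainCell_desc {S : SSet.{u}} {m : ℕ} {M : A'}
    (x : S _⦋m⦌ → (T.obj (𝟙_ (PMod R)) ⟶ M)) (hx : ∀ s, s ∈ S.degenerate m → x s = 0) :
    ∃ φ : T.obj (((simplicialChains R).obj S).X (m : ℤ)) ⟶ M,
      ∀ s, T.map (chainCell R s) ≫ φ = x s := by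
  obtain ⟨φ, hφ⟩ := exists_cell_desc (T := T) (L := freeConst R) (S := S)
    (fun s ↦ T.map (freeConstPUnitIso R).hom ≫ x s) (fun s hs ↦ by rw [hx s hs, comp_zero])
  refine ⟨T.map (chainsXIso R S m).hom ≫ φ, fun s ↦ ?_⟩
  rw [chainCell, ← T.map_comp_assoc, Category.assoc, Category.assoc, Iso.inv_hom_id,
    Category.comp_id, T.map_comp, Category.assoc, hφ, ← T.map_comp_assoc, Iso.inv_hom_id, T.map_id,
    Category.id_comp]

end

/-! ### Global sections -/

section

variable [EssentiallySmall.{u} C]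

variable (R) in
/-- Global sections are maps from the unit. -/
def globalSectionsEquiv (M : PMod R) : (globalSections R).obj M ≃ (𝟙_ (PMod R) ⟶ M) :=
  (Types.isLimitEquivSections (isLimitOfPreserves (forget AddCommGrpCat.{u})
    (limit.isLimit ((PresheafOfModules.toPresheaf.{u}
      (R ⋙ forget₂ CommRingCat RingCat)).obj M)))).trans (PresheafOfModules.unitHomEquiv M).symm

lemma unitHomEquiv_globalSectionsEquiv (M : PMod R) (x : (globalSections R).obj M) (c : Cᵒᵖ) :
    (PresheafOfModules.unitHomEquiv M (globalSectionsEquiv R M x)).1 c =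
      limit.π ((PresheafOfModules.toPresheaf.{u}
        (R ⋙ forget₂ CommRingCat RingCat)).obj M) c x := by
  have h := Equiv.apply_symm_apply (PresheafOfModules.unitHomEquiv M)
    (Types.isLimitEquivSections (isLimitOfPreserves (forget AddCommGrpCat.{u})
    (limit.isLimit ((PresheafOfModules.toPresheaf.{u}
      (R ⋙ forget₂ CommRingCat RingCat)).obj M))) x)
  exact congr_fun (congr_arg Subtype.val h) c

lemma globalSectionsEquiv_add (M : PMod R) (x y : (globalSections R).obj M) :
    globalSectionsEquiv R M (x + y) = globalSectionsEquiv R M x + globalSectionsEquiv R M y := by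
  apply (PresheafOfModules.unitHomEquiv M).injective
  refine PresheafOfModules.sections_ext _ _ (fun c ↦ ?_)
  refine (unitHomEquiv_globalSectionsEquiv _ _ _).trans ((map_add _ _ _).trans ?_)
  exact (congr_arg₂ (fun a b : M.obj c ↦ a + b) (unitHomEquiv_globalSectionsEquiv M x c)
    (unitHomEquiv_globalSectionsEquiv M y c)).symm

lemma globalSectionsEquiv_map {M N : PMod R} (f : M ⟶ N) (x : (globalSections R).obj M) :
    globalSectionsEquiv R N ((globalSections R).map f x) = globalSectionsEquiv R M x ≫ f := by
  apply (PresheafOfModules.unitHomEquiv N).injective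
  refine PresheafOfModules.sections_ext _ _ (fun c ↦ ?_)
  refine (unitHomEquiv_globalSectionsEquiv _ _ _).trans ?_
  refine Eq.trans ?_ (congr_arg (f.app c) (unitHomEquiv_globalSectionsEquiv M x c)).symm
  exact ConcreteCategory.congr_hom (limMap_π _ c) x

end

end

noncomputable section

open scoped ZeroObject Simplicial

/-! ### Maps to truncations and from extensions by zero -/

section

variable {A : Type u₂} [Category.{v₂} A] [Abelian A]

/-- The degree `m` part of the extension by zero. -/
def extendNonnegIso (P : ChainComplex A ℕ) (m : ℕ) :
    (P.extend nonnegEmbedding).X (m : ℤ) ≅ P.X m :=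
  P.extendXIso nonnegEmbedding (i := m) rfl

lemma extend_d_nonneg (P : ChainComplex A ℕ) (m : ℕ) :
    (P.extend nonnegEmbedding).d ((m + 1 : ℕ) : ℤ) (m : ℤ) =
      (extendNonnegIso P (m + 1)).hom ≫ P.d (m + 1) m ≫ (extendNonnegIso P m).inv :=
  HomologicalComplex.extend_d_eq _ _ _ _

/-- A chain map from the extension by zero of a nonnegative complex. -/
lemma exists_extend_desc (P : ChainComplex A ℕ) (K : ChainComplex A ℤ)
    (φ : ∀ m : ℕ, P.X m ⟶ K.X (m : ℤ))
    (comm : ∀ m : ℕ, φ (m + 1) ≫ K.d ((m + 1 : ℕ) : ℤ) (m : ℤ) = P.d (m + 1) m ≫ φ m)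
    (zero : φ 0 ≫ K.d ((0 : ℕ) : ℤ) (-1) = 0) :
    ∃ Φ : P.extend nonnegEmbedding ⟶ K, ∀ m : ℕ,
      Φ.f (m : ℤ) = (extendNonnegIso P m).hom ≫ φ m := by
  let f : ∀ n : ℤ, (P.extend nonnegEmbedding).X n ⟶ K.X n := fun n ↦
    match n with
    | Int.ofNat m => (extendNonnegIso P m).hom ≫ φ m
    | Int.negSucc m => 0
  have hf (m : ℕ) : f (m : ℤ) = (extendNonnegIso P m).hom ≫ φ m := rfl
  have hP (q : ℤ) (hq : q < 0) : IsZero ((P.extend nonnegEmbedding).X q) :=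
    HomologicalComplex.isZero_extend_X _ _ _ (fun i hi ↦ by
      have h : (i : ℤ) = q := hi
      lia)
  refine ⟨{ f := f, comm' := ?_ }, hf⟩
  intro i j hij
  obtain rfl : j + 1 = i := hij
  -- The square from degree `0` to degree `-1` is the only one with nonzero source that `comm` does
  -- not cover; it is where `zero` enters.
  obtain hj | rfl | ⟨m, rfl⟩ : j < -1 ∨ j = -1 ∨ ∃ m : ℕ, j = m := by
    by_cases h : 0 ≤ j
    · exact Or.inr (Or.inr ⟨j.toNat, by lia⟩)
    · lia
  · exact (hP _ (by lia)).eq_of_src _ _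
  · rw [(hP (-1) (by lia)).eq_of_tgt ((P.extend nonnegEmbedding).d _ _) 0, zero_comp]
    have h : f ((0 : ℕ) : ℤ) ≫ K.d ((0 : ℕ) : ℤ) (-1) = 0 := by
      rw [hf, Category.assoc, zero, comp_zero]
    exact h
  · have h : f ((m + 1 : ℕ) : ℤ) ≫ K.d ((m + 1 : ℕ) : ℤ) (m : ℤ) =
      (P.extend nonnegEmbedding).d ((m + 1 : ℕ) : ℤ) (m : ℤ) ≫ f (m : ℤ) := by
      rw [hf, hf, extend_d_nonneg, Category.assoc, Category.assoc, Category.assoc, Iso.inv_hom_id_assoc, comm]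
    exact h

/-- The inclusion of the truncation. -/
def truncι (K : ChainComplex A ℤ) (m : ℕ) : ((truncNonneg A).obj K).X m ⟶ K.X (m : ℤ) :=
  (K.truncLE'ToRestriction nonnegEmbedding).f m

instance (K : ChainComplex A ℤ) (m : ℕ) : Mono (truncι K m) :=
  inferInstanceAs (Mono ((K.truncLE'ToRestriction nonnegEmbedding).f m))

lemma truncι_d (K : ChainComplex A ℤ) (m : ℕ) :
    truncι K (m + 1) ≫ K.d ((m + 1 : ℕ) : ℤ) (m : ℤ) =
      ((truncNonneg A).obj K).d (m + 1) m ≫ truncι K m :=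
  (K.truncLE'ToRestriction nonnegEmbedding).comm (m + 1) m

lemma truncι_zero_d (K : ChainComplex A ℤ) : truncι K 0 ≫ K.d ((0 : ℕ) : ℤ) (-1) = 0 := by
  -- `truncLE'` is obtained from `truncGE'` of the opposite complex. Degree `0` is a boundary degree
  -- because `-1` is not in the image of the embedding.
  have h := K.op.restrictionToTruncGE'_hasLift nonnegEmbedding.op 0
    ((ComplexShape.Embedding.op_boundaryGE_iff _).2
      (nonnegEmbedding.boundaryLE (j := 0) (k' := -1) (show (-1 : ℤ) + 1 = ((0 : ℕ) : ℤ) by simp) (fun i hi ↦ by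
        have h : (i : ℤ) = -1 := hi
        lia))) (-1) (show (-1 : ℤ) + 1 = ((0 : ℕ) : ℤ) by simp)
  exact Quiver.Hom.op_inj h

lemma truncι_map {K L : ChainComplex A ℤ} (f : K ⟶ L) (m : ℕ) :
    ((truncNonneg A).map f).f m ≫ truncι L m = truncι K m ≫ f.f (m : ℤ) :=
  HomologicalComplex.congr_hom
    (HomologicalComplex.truncLE'ToRestriction_naturality f nonnegEmbedding) m

/-- Truncation is right adjoint to extension by zero: the data define a chain map from the extension
of `P`, and truncating that map gives the lift. -/
lemma exists_trunc_lift (P : ChainComplex A ℕ) (K : ChainComplex A ℤ)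
    (φ : ∀ m : ℕ, P.X m ⟶ K.X (m : ℤ))
    (comm : ∀ m : ℕ, φ (m + 1) ≫ K.d ((m + 1 : ℕ) : ℤ) (m : ℤ) = P.d (m + 1) m ≫ φ m)
    (zero : φ 0 ≫ K.d ((0 : ℕ) : ℤ) (-1) = 0) :
    ∃ ψ : P ⟶ (truncNonneg A).obj K, ∀ m, ψ.f m ≫ truncι K m = φ m := by
  obtain ⟨Φ, hΦ⟩ := exists_extend_desc P K φ comm zero
  let E := P.extend nonnegEmbedding
  -- `E` vanishes in negative degrees, so its truncation is simply its restriction.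
  have : IsIso (E.truncLE'ToRestriction nonnegEmbedding) :=
    HomologicalComplex.Hom.isIso_of_components _
  let θ : P ⟶ E.restriction nonnegEmbedding :=
    { f m := (P.extendXIso nonnegEmbedding (i := m) rfl).inv
      comm' i j hij := by
        have h2 : E.d (nonnegEmbedding.f i) (nonnegEmbedding.f j) =
          (P.extendXIso nonnegEmbedding (i := i) rfl).hom ≫ P.d i j ≫
          (P.extendXIso nonnegEmbedding (i := j) rfl).inv :=
          HomologicalComplex.extend_d_eq _ _ _ _
        refine (congr_arg (fun g ↦ (P.extendXIso nonnegEmbedding (i := i) rfl).inv ≫ g) h2).trans ?_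
        exact Iso.inv_hom_id_assoc _ _ }
  refine ⟨θ ≫ inv (E.truncLE'ToRestriction nonnegEmbedding) ≫ HomologicalComplex.truncLE'Map Φ nonnegEmbedding, fun m ↦ ?_⟩
  have h : (θ ≫ inv (E.truncLE'ToRestriction nonnegEmbedding) ≫ HomologicalComplex.truncLE'Map Φ nonnegEmbedding) ≫
      K.truncLE'ToRestriction nonnegEmbedding = θ ≫ HomologicalComplex.restrictionMap Φ _ := by
    rw [Category.assoc, Category.assoc]
    refine congr_arg (fun g ↦ θ ≫ g) ((IsIso.inv_comp_eq _).2 ?_)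
    exact HomologicalComplex.truncLE'ToRestriction_naturality Φ nonnegEmbedding
  refine (HomologicalComplex.congr_hom h m).trans ?_
  refine (congr_arg (fun g ↦ (P.extendXIso nonnegEmbedding (i := m) rfl).inv ≫ g) (hΦ m)).trans ?_
  exact Iso.inv_hom_id_assoc _ _

end

end

noncomputable section

open scoped ZeroObject Simplicial

/-! ### Families of elements indexed by the simplices of a simplicial set -/

/-- A family of elements of a complex `K` indexed by the simplices of `S` which defines a chain
map from the normalized chains on `S` to the part `⋯ ⟶ K₁ ⟶ {z : K₀ // Z z}` of `K`. -/
structure SSet.IsChainFamily (S : SSet.{u}) {K : ℕ → Type w} [∀ m, AddCommGroup (K m)]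
    (d : ∀ m, K (m + 1) → K m) (Z : K 0 → Prop) (x : ∀ m, S _⦋m⦌ → K m) : Prop where
  degenerate (m : ℕ) (s : S _⦋m⦌) (hs : s ∈ S.degenerate m) : x m s = 0
  d_eq (m : ℕ) (s : S _⦋m + 1⦌) :
    d m (x (m + 1) s) = ∑ i : Fin (m + 2), (-1 : ℤ) ^ (i : ℕ) • x m (S.δ i s)
  zero (s : S _⦋0⦌) : Z (x 0 s)

lemma SSet.IsChainFamily.comp {S T : SSet.{u}} {K : ℕ → Type w} [∀ m, AddCommGroup (K m)]
    {d : ∀ m, K (m + 1) → K m} {Z : K 0 → Prop} {x : ∀ m, T _⦋m⦌ → K m}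
    (hx : T.IsChainFamily d Z x) (f : S ⟶ T) :
    S.IsChainFamily d Z (fun m s ↦ x m (f.app _ s)) where
  degenerate m s hs := hx.degenerate m _ (SSet.degenerate_app_apply hs f)
  d_eq m s := by
    refine (hx.d_eq m _).trans (Finset.sum_congr rfl (fun i _ ↦ ?_))
    have h : f.app _ (S.δ i s) = T.δ i (f.app _ s) :=
      congr_arg (fun g ↦ g s) (f.naturality (SimplexCategory.δ i).op)
    rw [h]
  zero s := hx.zero _

/-- The families of elements of a complex of abelian groups. -/
abbrev SSet.IsChainFamilyIn (S : SSet.{u}) (L : ChainComplex AddCommGrpCat.{w} ℤ)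
    (x : ∀ m : ℕ, S _⦋m⦌ → L.X (m : ℤ)) : Prop :=
  S.IsChainFamily (K := fun m ↦ L.X (m : ℤ))
    (fun m ↦ L.d ((m + 1 : ℕ) : ℤ) (m : ℤ)) (fun z ↦ L.d ((0 : ℕ) : ℤ) (-1) z = 0) x

lemma AddCommGrpCat.sum_zsmul_apply {ι : Type*} (t : Finset ι) {A B : AddCommGrpCat.{w}}
    (c : ι → ℤ) (f : ι → (A ⟶ B)) (x : A) :
    (∑ i ∈ t, c i • f i) x = ∑ i ∈ t, c i • f i x := by
  classical
  induction t using Finset.induction_on with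
  | empty => rfl
  | insert a t ha ih => rw [Finset.sum_insert ha, Finset.sum_insert ha, ← ih]; rfl

lemma free_hom_ext {M : AddCommGrpCat.{u}} {f g : AddCommGrpCat.free.obj PUnit ⟶ M}
    (h : f (FreeAbelianGroup.of PUnit.unit) = g (FreeAbelianGroup.of PUnit.unit)) : f = g :=
  AddCommGrpCat.hom_ext (FreeAbelianGroup.lift_ext _ _ (by rintro ⟨⟩; exact h))

section

variable (G : SimplicialObject AddCommGrpCat.{u})

/-- The underlying simplicial set of a simplicial abelian group. -/
abbrev underlyingSet : SSet.{u} :=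
  ((SimplicialObject.whiskering _ _).obj (forget AddCommGrpCat.{u})).obj G

variable {G} in
lemma isChainFamilyIn_of_hom {L : ChainComplex AddCommGrpCat.{u} ℤ}
    (φ : ∀ m : ℕ, G _⦋m⦌ ⟶ L.X (m : ℤ)) (hσ : ∀ m i, G.σ i ≫ φ (m + 1) = 0)
    (hd : ∀ m, φ (m + 1) ≫ L.d ((m + 1 : ℕ) : ℤ) (m : ℤ) =
      (∑ i : Fin (m + 2), (-1 : ℤ) ^ (i : ℕ) • G.δ i) ≫ φ m)
    (hz : φ 0 ≫ L.d ((0 : ℕ) : ℤ) (-1) = 0) :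
    (underlyingSet G).IsChainFamilyIn L (fun m y ↦ φ m y) where
  degenerate m s hs := by
    obtain _ | m := m
    · simp at hs
    · rw [SSet.degenerate_eq_iUnion_range_σ, Set.mem_iUnion] at hs
      obtain ⟨i, s, rfl⟩ := hs
      exact ConcreteCategory.congr_hom (hσ m i) s
  d_eq m s := by
    have h := hd m
    rw [Preadditive.sum_comp] at h
    simp only [Preadditive.zsmul_comp] at h
    refine (ConcreteCategory.congr_hom h s).trans ?_
    exact AddCommGrpCat.sum_zsmul_apply _ _ _ _
  zero s := ConcreteCategory.congr_hom hz s

variable {G}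

/-- Morphisms from a free simplicial abelian group. -/
def freeSimplicialEquiv {S : SSet.{u}} :
    (freeSimplicial AddCommGrpCat.free S ⟶ G) ≃ (S ⟶ underlyingSet G) :=
  (AddCommGrpCat.adj.whiskerRight SimplexCategoryᵒᵖ).homEquiv S G

lemma freeSimplicialEquiv_app {S : SSet.{u}}
    (g : freeSimplicial AddCommGrpCat.free S ⟶ G) {m : ℕ} (s : S _⦋m⦌) :
    (freeSimplicialEquiv g).app _ s =
      (pointMap AddCommGrpCat.free s ≫ g.app (op ⦋m⦌)) (FreeAbelianGroup.of PUnit.unit) :=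
  rfl

lemma cell_map_apply {S : SSet.{u}} {M : AddCommGrpCat.{u}}
    (g : freeSimplicial AddCommGrpCat.free S ⟶ G) {m : ℕ} (s : S _⦋m⦌)
    (θ : (Abelian.DoldKan.N.obj G).X m ⟶ M) :
    (cell AddCommGrpCat.free S s ≫ (Abelian.DoldKan.N.map g).f m ≫ θ)
      (FreeAbelianGroup.of PUnit.unit) =
    (toNormalized G m ≫ θ) ((freeSimplicialEquiv g).app _ s) := by
  have h := toNormalized_map g m
  have h2 : cell AddCommGrpCat.free S s ≫ (Abelian.DoldKan.N.map g).f m =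
    pointMap AddCommGrpCat.free s ≫ g.app _ ≫ toNormalized G m := by
    rw [cell, Category.assoc]
    exact congr_arg (fun g ↦ pointMap AddCommGrpCat.free s ≫ g) h
  rw [reassoc_of% h2, freeSimplicialEquiv_app]
  exact ConcreteCategory.congr_hom ((congr_arg (fun f ↦ pointMap AddCommGrpCat.free s ≫ f)
    (Category.assoc (g.app (op ⦋m⦌)) _ _)).trans (Category.assoc _ _ _).symm) _

lemma underlyingSet_map_apply {G' : SimplicialObject AddCommGrpCat.{u}} (u : G ⟶ G') {m : ℕ}
    {M M' : AddCommGrpCat.{u}} (φ : G _⦋m⦌ ⟶ M) (φ' : G' _⦋m⦌ ⟶ M') (f : M ⟶ M')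
    (h : u.app (op ⦋m⦌) ≫ φ' = φ ≫ f) (y : (underlyingSet G) _⦋m⦌) :
    φ' ((((SimplicialObject.whiskering _ _).obj (forget AddCommGrpCat.{u})).map u).app _ y) =
      f (φ y) :=
  ConcreteCategory.congr_hom h y

end

section

variable (L : ChainComplex AddCommGrpCat.{u} ℤ)

/-- The simplicial abelian group corresponding to the truncation of a complex. -/
abbrev doldKanGroup : SimplicialObject AddCommGrpCat.{u} :=
  Abelian.DoldKan.equivalence.inverse.obj ((truncNonneg _).obj L)

/-- The underlying simplicial set of the simplicial abelian group `doldKanGroup L`. -/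
abbrev doldKanSet : SSet.{u} :=
  underlyingSet (doldKanGroup L)

/-- The isomorphism between the normalized complex of the simplicial group given by the Dold-Kan
correspondence and the given complex. -/
def doldKanCounit :
    Abelian.DoldKan.N.obj (doldKanGroup L) ≅ (truncNonneg _).obj L :=
  Abelian.DoldKan.equivalence.counitIso.app ((truncNonneg _).obj L)

/-- The additive map from the `m`-simplices. -/
def doldKanEval (m : ℕ) : (doldKanGroup L) _⦋m⦌ ⟶ L.X (m : ℤ) :=
  toNormalized (doldKanGroup L) m ≫ (doldKanCounit L).hom.f m ≫ truncι L m

/-- The tautological family. -/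
def doldKanFamily (m : ℕ) (y : (doldKanSet L) _⦋m⦌) : L.X (m : ℤ) := doldKanEval L m y

lemma σ_doldKanEval (m : ℕ) (i : Fin (m + 1)) :
    (doldKanGroup L).σ i ≫ doldKanEval L (m + 1) = 0 := by
  rw [doldKanEval, reassoc_of% (σ_toNormalized (doldKanGroup L) i), zero_comp]

lemma doldKanEval_d (m : ℕ) :
    doldKanEval L (m + 1) ≫ L.d ((m + 1 : ℕ) : ℤ) (m : ℤ) =
      (∑ i : Fin (m + 2), (-1 : ℤ) ^ (i : ℕ) • (doldKanGroup L).δ i) ≫ doldKanEval L m := by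
  rw [doldKanEval, Category.assoc, Category.assoc, truncι_d, (doldKanCounit L).hom.comm_assoc,
    reassoc_of% (toNormalized_d (doldKanGroup L) m), doldKanEval]

lemma doldKanEval_zero_d : doldKanEval L 0 ≫ L.d ((0 : ℕ) : ℤ) (-1) = 0 := by
  rw [doldKanEval, Category.assoc, Category.assoc, truncι_zero_d, comp_zero, comp_zero]

lemma isChainFamily_doldKanFamily : (doldKanSet L).IsChainFamilyIn L (doldKanFamily L) :=
  isChainFamilyIn_of_hom (doldKanEval L) (σ_doldKanEval L) (doldKanEval_d L)
    (doldKanEval_zero_d L)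

variable {L}

lemma cell_map_doldKanCounit {S : SSet.{u}}
    (g : freeSimplicial AddCommGrpCat.free S ⟶ doldKanGroup L) {m : ℕ} (s : S _⦋m⦌) :
    (cell AddCommGrpCat.free S s ≫ (Abelian.DoldKan.N.map g).f m ≫
      (doldKanCounit L).hom.f m ≫ truncι L m) (FreeAbelianGroup.of PUnit.unit) =
    doldKanFamily L m ((freeSimplicialEquiv g).app _ s) :=
  cell_map_apply g s _

/-- By the free-forgetful adjunction and the Dold-Kan equivalence, a map from `S` is a chain map
from the normalized integral chains of `S` to the truncation of `L`, and the family records its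
values on cells. -/
lemma doldKanFamily_ext {S : SSet.{u}} {f g : S ⟶ doldKanSet L}
    (h : ∀ m (s : S _⦋m⦌), doldKanFamily L m (f.app _ s) = doldKanFamily L m (g.app _ s)) :
    f = g := by
  obtain ⟨f, rfl⟩ := freeSimplicialEquiv.surjective f
  obtain ⟨g, rfl⟩ := freeSimplicialEquiv.surjective g
  refine congr_arg _ (Abelian.DoldKan.equivalence.functor.map_injective ?_)
  have h1 : Abelian.DoldKan.N.map f ≫ (doldKanCounit L).hom =
      Abelian.DoldKan.N.map g ≫ (doldKanCounit L).hom := by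
    ext m : 1
    rw [← cancel_mono (truncι L m)]
    refine cell_hom_ext (T := 𝟭 _) (L := AddCommGrpCat.free) (fun s ↦ free_hom_ext ?_)
    exact (cell_map_doldKanCounit f s).trans ((h m s).trans (cell_map_doldKanCounit g s).symm)
  exact (cancel_mono (doldKanCounit L).hom).1 h1

/-- Vanishing on degenerate simplices gives additive maps on normalized chains, the face formula
makes them a chain map, and the condition on vertices makes it land in the truncation. -/
lemma exists_doldKanFamily_eq {S : SSet.{u}} (x : ∀ m : ℕ, S _⦋m⦌ → L.X (m : ℤ))
    (hx : S.IsChainFamilyIn L x) :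
    ∃ f : S ⟶ doldKanSet L, ∀ m (s : S _⦋m⦌), doldKanFamily L m (f.app _ s) = x m s := by
  have H (m : ℕ) := exists_cell_desc (T := 𝟭 _) (L := AddCommGrpCat.free) (S := S) (m := m)
    (M := L.X (m : ℤ)) (fun s ↦ AddCommGrpCat.ofHom (FreeAbelianGroup.lift (fun _ ↦ x m s)))
    (fun s hs ↦ free_hom_ext (by
      refine (FreeAbelianGroup.lift_apply_of _ _).trans (hx.degenerate m s hs)))
  choose φ hφ using H
  have hφ' (m : ℕ) (s : S _⦋m⦌) :
    (cell AddCommGrpCat.free S s ≫ φ m) (FreeAbelianGroup.of PUnit.unit) = x m s :=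
    (ConcreteCategory.congr_hom (hφ m s) _).trans (FreeAbelianGroup.lift_apply_of _ _)
  obtain ⟨ψ, hψ⟩ := exists_trunc_lift (normalizedChains AddCommGrpCat.free S) L φ (fun m ↦ by
    refine cell_hom_ext (T := 𝟭 _) (L := AddCommGrpCat.free) (fun s ↦ free_hom_ext ?_)
    refine (congr_arg (L.d ((m + 1 : ℕ) : ℤ) (m : ℤ)) (hφ' (m + 1) s)).trans
      ((hx.d_eq m s).trans ?_)
    have h := cell_d AddCommGrpCat.free S s =≫ φ m
    rw [Preadditive.sum_comp] at h
    simp only [Preadditive.zsmul_comp] at h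
    refine Eq.trans ?_ (ConcreteCategory.congr_hom h (FreeAbelianGroup.of PUnit.unit)).symm
    refine Eq.trans ?_ (AddCommGrpCat.sum_zsmul_apply _ _ _ _).symm
    exact Finset.sum_congr rfl (fun i _ ↦ congr_arg _ (hφ' m _).symm)) (by
    refine cell_hom_ext (T := 𝟭 _) (L := AddCommGrpCat.free) (fun s ↦ free_hom_ext ?_)
    exact (congr_arg (L.d ((0 : ℕ) : ℤ) (-1)) (hφ' 0 s)).trans (hx.zero s))
  obtain ⟨g, hg⟩ := Abelian.DoldKan.equivalence.functor.map_surjective (ψ ≫ (doldKanCounit L).inv)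
  have hg' : Abelian.DoldKan.N.map g ≫ (doldKanCounit L).hom = ψ := (Iso.eq_comp_inv _).1 hg
  refine ⟨freeSimplicialEquiv g, fun m s ↦ ?_⟩
  rw [← cell_map_doldKanCounit, ← HomologicalComplex.comp_f_assoc, hg', hψ]
  exact hφ' m s

lemma doldKanFamily_map {L' : ChainComplex AddCommGrpCat.{u} ℤ} (f : L ⟶ L') (m : ℕ)
    (y : (doldKanSet L) _⦋m⦌) :
    doldKanFamily L' m ((((SimplicialObject.whiskering _ _).obj (forget AddCommGrpCat.{u})).map
      (Abelian.DoldKan.equivalence.inverse.map ((truncNonneg _).map f))).app _ y) =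
    f.f (m : ℤ) (doldKanFamily L m y) := by
  have h1 := toNormalized_map (Abelian.DoldKan.equivalence.inverse.map ((truncNonneg _).map f)) m
  have h2 : Abelian.DoldKan.N.map (Abelian.DoldKan.equivalence.inverse.map
      ((truncNonneg _).map f)) ≫ (doldKanCounit L').hom =
      (doldKanCounit L).hom ≫ (truncNonneg _).map f :=
    Abelian.DoldKan.equivalence.counitIso.hom.naturality ((truncNonneg _).map f)
  have h3 : (Abelian.DoldKan.equivalence.inverse.map ((truncNonneg _).map f)).app (op ⦋m⦌) ≫
      doldKanEval L' m = doldKanEval L m ≫ f.f (m : ℤ) := by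
    rw [doldKanEval, doldKanEval, Category.assoc, Category.assoc, ← truncι_map,
      ← HomologicalComplex.comp_f_assoc (doldKanCounit L).hom, ← h2, HomologicalComplex.comp_f,
      Category.assoc]
    rw [← Category.assoc, ← Category.assoc (toNormalized _ m)]
    exact (congr_arg (fun g ↦ g ≫ (doldKanCounit L').hom.f m ≫ truncι L' m) h1).symm
  exact underlyingSet_map_apply _ _ _ _ h3 y

end

end

noncomputable section

open scoped ZeroObject Simplicial

/-! ### The adjunction between normalized chains and simplicial sections -/

variable {C : Type u₁} [Category.{v₁} C] (R : Cᵒᵖ ⥤ CommRingCat.{u})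

/-- The families of maps from the unit to a complex of presheaves of modules. -/
abbrev SSet.IsChainFamilyTo {R : Cᵒᵖ ⥤ CommRingCat.{u}} (S : SSet.{u}) (X : PCh R)
    (x : ∀ m : ℕ, S _⦋m⦌ → (𝟙_ (PMod R) ⟶ X.X (m : ℤ))) : Prop :=
  S.IsChainFamily (K := fun m : ℕ ↦ 𝟙_ (PMod R) ⟶ X.X (m : ℤ))
    (fun m f ↦ f ≫ X.d ((m + 1 : ℕ) : ℤ) (m : ℤ)) (fun f ↦ f ≫ X.d ((0 : ℕ) : ℤ) (-1) = 0) x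

variable {R}

section

variable {S : SSet.{u}} {X : PCh R}

lemma isChainFamilyTo_hom (φ : (simplicialChains R).obj S ⟶ X) :
    S.IsChainFamilyTo X (fun m s ↦ chainCell R s ≫ φ.f (m : ℤ)) where
  degenerate m s hs := by rw [chainCell_eq_zero s hs, zero_comp]
  d_eq m s := by
    rw [Category.assoc, φ.comm, reassoc_of% (chainCell_d (R := R) s), Preadditive.sum_comp]
    exact Finset.sum_congr rfl (fun i _ ↦ Preadditive.zsmul_comp _ _ _)
  zero s := by
    rw [Category.assoc, φ.comm, (isZero_chains_X R S (-1) (by lia)).eq_of_src (φ.f (-1)) 0,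
      comp_zero, comp_zero]

lemma simplicialChains_hom_ext {φ ψ : (simplicialChains R).obj S ⟶ X}
    (h : ∀ (m : ℕ) (s : S _⦋m⦌), chainCell R s ≫ φ.f (m : ℤ) = chainCell R s ≫ ψ.f (m : ℤ)) :
    φ = ψ := by
  ext n : 1
  obtain ⟨m, rfl⟩ | hn : (∃ m : ℕ, n = m) ∨ n < 0 := by
    by_cases h : 0 ≤ n
    · exact Or.inl ⟨n.toNat, by lia⟩
    · lia
  · exact chainCell_hom_ext (T := 𝟭 _) (h m)
  · exact (isZero_chains_X R S n hn).eq_of_src _ _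

/-- With `simplicialChains_hom_ext`, this identifies maps out of `kNR[S]` with chain families; the
Alexander-Whitney map and the counit are constructed in this way. -/
lemma exists_simplicialChains_hom (x : ∀ m : ℕ, S _⦋m⦌ → (𝟙_ (PMod R) ⟶ X.X (m : ℤ)))
    (hx : S.IsChainFamilyTo X x) :
    ∃ φ : (simplicialChains R).obj S ⟶ X,
      ∀ (m : ℕ) (s : S _⦋m⦌), chainCell R s ≫ φ.f (m : ℤ) = x m s := by
  have H (m : ℕ) := exists_chainCell_desc (T := 𝟭 (PMod R)) (S := S) (m := m) (x m)
    (hx.degenerate m)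
  choose φ hφ using H
  have hφ' (m : ℕ) (s : S _⦋m⦌) : chainCell R s ≫ φ m = x m s := hφ m s
  have hcomm (m : ℕ) : φ (m + 1) ≫ X.d ((m + 1 : ℕ) : ℤ) (m : ℤ) =
      ((simplicialChains R).obj S).d ((m + 1 : ℕ) : ℤ) (m : ℤ) ≫ φ m := by
    refine chainCell_hom_ext (T := 𝟭 _) (fun s ↦ ?_)
    refine ((reassoc_of% (hφ' (m + 1) s)) (X.d ((m + 1 : ℕ) : ℤ) (m : ℤ))).trans ?_
    refine (hx.d_eq m s).trans (Eq.trans ?_ ((reassoc_of% (chainCell_d (R := R) s)) (φ m)).symm)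
    rw [Preadditive.sum_comp]
    exact Finset.sum_congr rfl (fun i _ ↦ by rw [Preadditive.zsmul_comp, hφ'])
  have hzero : φ 0 ≫ X.d ((0 : ℕ) : ℤ) (-1) = 0 :=
    chainCell_hom_ext (T := 𝟭 _) (fun s ↦
      (((reassoc_of% (hφ' 0 s)) (X.d ((0 : ℕ) : ℤ) (-1))).trans (hx.zero s)).trans comp_zero.symm)
  obtain ⟨Φ, hΦ⟩ := exists_extend_desc (normalizedChains (freeConst R) S) X
    (fun m ↦ (chainsXIso R S m).inv ≫ φ m) (fun m ↦ by
      rw [Category.assoc, hcomm, ← Category.assoc, ← Category.assoc]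
      congr 1
      rw [Iso.inv_comp_eq, ← Category.assoc, Iso.eq_comp_inv]
      have h : ((simplicialChains R).obj S).d ((m + 1 : ℕ) : ℤ) (m : ℤ) =
        (chainsXIso R S (m + 1)).hom ≫ (normalizedChains (freeConst R) S).d (m + 1) m ≫
          (chainsXIso R S m).inv := HomologicalComplex.extend_d_eq _ _ _ _
      rw [h, Category.assoc, Category.assoc, Iso.inv_hom_id, Category.comp_id])
    (by rw [Category.assoc, hzero, comp_zero])
  refine ⟨Φ, fun m s ↦ ?_⟩
  rw [← hφ']
  refine congr_arg (fun g ↦ chainCell R s ≫ g) ((hΦ m).trans ?_)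
  exact (chainsXIso R S m).hom_inv_id_assoc _

end

variable [EssentiallySmall.{u} C]

variable (R) in
/-- The complex of global sections. -/
abbrev sectionsComplex (X : PCh R) : ChainComplex AddCommGrpCat.{u} ℤ :=
  ((globalSections R).mapHomologicalComplex (ComplexShape.down ℤ)).obj X

/-- The map from the unit given by a simplex of the simplicial sections. -/
def sectionHom {X : PCh R} {m : ℕ} (y : ((simplicialSections R).obj X) _⦋m⦌) :
    𝟙_ (PMod R) ⟶ X.X (m : ℤ) :=
  globalSectionsEquiv R _ (doldKanFamily (sectionsComplex R X) m y)

/-- `globalSectionsEquiv` as an additive equivalence. -/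
def globalSectionsAddEquiv (M : PMod R) : (globalSections R).obj M ≃+ (𝟙_ (PMod R) ⟶ M) where
  toEquiv := globalSectionsEquiv R M
  map_add' := globalSectionsEquiv_add M

lemma isChainFamilyTo_iff {S : SSet.{u}} {X : PCh R}
    (x : ∀ m : ℕ, S _⦋m⦌ → (sectionsComplex R X).X (m : ℤ)) :
    S.IsChainFamilyTo X (fun m s ↦ globalSectionsAddEquiv _ (x m s)) ↔
      S.IsChainFamilyIn (sectionsComplex R X) x := by
  have hd (i j : ℤ) (z : (sectionsComplex R X).X i) :
    globalSectionsAddEquiv _ ((sectionsComplex R X).d i j z) =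
      globalSectionsAddEquiv _ z ≫ X.d i j := globalSectionsEquiv_map _ _
  refine ⟨fun h ↦ ⟨fun m s hs ↦ ?_, fun m s ↦ ?_, fun s ↦ ?_⟩,
    fun h ↦ ⟨fun m s hs ↦ ?_, fun m s ↦ ?_, fun s ↦ ?_⟩⟩
  · exact (map_eq_zero_iff _ (globalSectionsAddEquiv _).injective).1 (h.degenerate m s hs)
  · apply (globalSectionsAddEquiv (R := R) _).injective
    refine (hd _ _ _).trans ((h.d_eq m s).trans (Eq.trans ?_ (map_sum _ _ _).symm))
    exact Finset.sum_congr rfl (fun i _ ↦ (map_zsmul _ _ _).symm)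
  · exact (map_eq_zero_iff _ (globalSectionsAddEquiv _).injective).1
      ((hd _ _ _).trans (h.zero s))
  · exact (map_eq_zero_iff _ (globalSectionsAddEquiv _).injective).2 (h.degenerate m s hs)
  · refine (hd _ _ _).symm.trans ((congr_arg _ (h.d_eq m s)).trans ((map_sum _ _ _).trans ?_))
    exact Finset.sum_congr rfl (fun i _ ↦ map_zsmul _ _ _)
  · exact (hd _ _ _).symm.trans ((map_eq_zero_iff _ (globalSectionsAddEquiv _).injective).2
      (h.zero s))

lemma isChainFamilyTo_sectionHom (X : PCh R) :
    ((simplicialSections R).obj X).IsChainFamilyTo X (fun _ y ↦ sectionHom y) :=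
  (isChainFamilyTo_iff _).2 (isChainFamily_doldKanFamily _)

lemma sectionHom_ext {S : SSet.{u}} {X : PCh R} {f g : S ⟶ (simplicialSections R).obj X}
    (h : ∀ m (s : S _⦋m⦌), sectionHom (f.app _ s) = sectionHom (g.app _ s)) : f = g :=
  doldKanFamily_ext (fun m s ↦ (globalSectionsEquiv R _).injective (h m s))

lemma exists_sectionHom_eq {S : SSet.{u}} {X : PCh R}
    (x : ∀ m : ℕ, S _⦋m⦌ → (𝟙_ (PMod R) ⟶ X.X (m : ℤ))) (hx : S.IsChainFamilyTo X x) :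
    ∃ f : S ⟶ (simplicialSections R).obj X, ∀ m (s : S _⦋m⦌), sectionHom (f.app _ s) = x m s := by
  obtain ⟨f, hf⟩ := exists_doldKanFamily_eq (L := sectionsComplex R X)
    (fun m s ↦ (globalSectionsAddEquiv _).symm (x m s)) (by
      refine (isChainFamilyTo_iff _).1 ?_
      simpa using hx)
  exact ⟨f, fun m s ↦ (congr_arg (globalSectionsEquiv R _) (hf m s)).trans
    ((globalSectionsEquiv R _).apply_symm_apply _)⟩

lemma sectionHom_map {X Y : PCh R} (f : X ⟶ Y) {m : ℕ}
    (y : ((simplicialSections R).obj X) _⦋m⦌) :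
    sectionHom (((simplicialSections R).map f).app _ y) = sectionHom y ≫ f.f (m : ℤ) := by
  refine Eq.trans ?_ (globalSectionsEquiv_map (f.f (m : ℤ)) _)
  exact congr_arg _ (doldKanFamily_map
    (((globalSections R).mapHomologicalComplex (ComplexShape.down ℤ)).map f) m y)

/-- The adjunction bijection. -/
def chainsHomEquiv (S : SSet.{u}) (X : PCh R) :
    ((simplicialChains R).obj S ⟶ X) ≃ (S ⟶ (simplicialSections R).obj X) :=
  -- A chain map is sent to the simplicial map with the same family. Both kinds of map are
  -- determined by their families, and each chain family arises from both, whence the bijectivity.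
  Equiv.ofBijective
    (fun φ ↦ (exists_sectionHom_eq _ (isChainFamilyTo_hom φ)).choose) (by
      have H (φ : (simplicialChains R).obj S ⟶ X) :=
        (exists_sectionHom_eq _ (isChainFamilyTo_hom φ)).choose_spec
      constructor
      · intro φ ψ h
        refine simplicialChains_hom_ext (fun m s ↦ ?_)
        exact (H φ m s).symm.trans
          ((congr_arg (fun f : S ⟶ _ ↦ sectionHom (f.app _ s)) h).trans (H ψ m s))
      · intro f
        obtain ⟨φ, hφ⟩ := exists_simplicialChains_hom _ ((isChainFamilyTo_sectionHom X).comp f)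
        exact ⟨φ, sectionHom_ext (fun m s ↦ (H φ m s).trans (hφ m s))⟩)

lemma sectionHom_chainsHomEquiv {S : SSet.{u}} {X : PCh R}
    (φ : (simplicialChains R).obj S ⟶ X) {m : ℕ} (s : S _⦋m⦌) :
    sectionHom ((chainsHomEquiv S X φ).app _ s) = chainCell R s ≫ φ.f (m : ℤ) :=
  (exists_sectionHom_eq _ (isChainFamilyTo_hom φ)).choose_spec m s

variable (R) in
/-- The normalized chains functor is left adjoint to the simplicial sections functor. -/
def chainsAdjunction : simplicialChains R ⊣ simplicialSections R :=
  Adjunction.mkOfHomEquiv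
    { homEquiv := chainsHomEquiv
      homEquiv_naturality_left_symm := fun {S S' X} f g ↦ by
        obtain ⟨φ, rfl⟩ := (chainsHomEquiv _ _).surjective g
        rw [Equiv.symm_apply_apply, Equiv.symm_apply_eq]
        refine sectionHom_ext (fun m s ↦ ?_)
        rw [sectionHom_chainsHomEquiv, HomologicalComplex.comp_f,
          reassoc_of% (chainCell_map (R := R) f s)]
        exact sectionHom_chainsHomEquiv φ (f.app _ s)
      homEquiv_naturality_right := fun {S X Y} φ g ↦ by
        refine sectionHom_ext (fun m s ↦ ?_)
        rw [sectionHom_chainsHomEquiv, HomologicalComplex.comp_f, ← Category.assoc,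
          ← sectionHom_chainsHomEquiv]
        exact (sectionHom_map g _).symm }

end

noncomputable section

open scoped ZeroObject Simplicial

/-! ### The summands of the tensor product of complexes -/

variable {C : Type u₁} [Category.{v₁} C] {R : Cᵒᵖ ⥤ CommRingCat.{u}}

/-- The inclusion of a summand in the tensor product. -/
def tensorι (X Y : PCh R) (p q n : ℤ) (h : p + q = n) : X.X p ⊗ Y.X q ⟶ (X ⊗ Y).X n :=
  HomologicalComplex.ιTensorObj X Y p q n h

lemma tensorι_hom_ext {X Y : PCh R} {n : ℤ} {M : PMod R} {f g : (X ⊗ Y).X n ⟶ M}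
    (h : ∀ p q hpq, tensorι X Y p q n hpq ≫ f = tensorι X Y p q n hpq ≫ g) : f = g :=
  mapBifunctorDesc_ext' R h

/-- The morphism from the tensor product given by its restrictions to the summands. -/
def tensorDesc {X Y : PCh R} {n : ℤ} {M : PMod R}
    (x : ∀ (p q : ℤ), p + q = n → (X.X p ⊗ Y.X q ⟶ M)) : (X ⊗ Y).X n ⟶ M :=
  HomologicalComplex.mapBifunctorDesc (K₁ := X) (K₂ := Y) (F := curriedTensor (PMod R))
    (c := ComplexShape.down ℤ) x

@[simp]
lemma tensorι_desc {X Y : PCh R} {n : ℤ} {M : PMod R}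
    (x : ∀ (p q : ℤ), p + q = n → (X.X p ⊗ Y.X q ⟶ M)) (p q : ℤ) (h : p + q = n) :
    tensorι X Y p q n h ≫ tensorDesc x = x p q h :=
  HomologicalComplex.ι_mapBifunctorDesc (K₁ := X) (K₂ := Y) (F := curriedTensor (PMod R))
    (c := ComplexShape.down ℤ) x p q h

lemma tensorι_whiskerLeft (X : PCh R) {Y Y' : PCh R} (g : Y ⟶ Y') (p q n : ℤ) (h : p + q = n) :
    tensorι X Y p q n h ≫ (X ◁ g).f n = X.X p ◁ g.f q ≫ tensorι X Y' p q n h := by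
  refine (HomologicalComplex.ι_mapBifunctorMap (𝟙 X) g (curriedTensor (PMod R))
    (ComplexShape.down ℤ) p q n h).trans ?_
  simp
  rfl

lemma tensorι_whiskerRight {X X' : PCh R} (f : X ⟶ X') (Y : PCh R) (p q n : ℤ) (h : p + q = n) :
    tensorι X Y p q n h ≫ (f ▷ Y).f n = f.f p ▷ Y.X q ≫ tensorι X' Y p q n h := by
  refine (HomologicalComplex.ι_mapBifunctorMap f (𝟙 Y) (curriedTensor (PMod R))
    (ComplexShape.down ℤ) p q n h).trans ?_
  simp
  rfl

lemma tensorι_d (X Y : PCh R) {p p' q q' n n' : ℤ} (h : p + q = n) (hp : p' + 1 = p)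
    (hq : q' + 1 = q) (hn : n' + 1 = n) :
    tensorι X Y p q n h ≫ (X ⊗ Y).d n n' =
      X.d p p' ▷ Y.X q ≫ tensorι X Y p' q n' (by lia) +
        p.negOnePow • (X.X p ◁ Y.d q q' ≫ tensorι X Y p q' n' (by lia)) := by
  have h1 := HomologicalComplex.mapBifunctor.ι_D₁ X Y (curriedTensor (PMod R))
    (ComplexShape.down ℤ) n n' p q h
  have h2 := HomologicalComplex.mapBifunctor.ι_D₂ X Y (curriedTensor (PMod R))
    (ComplexShape.down ℤ) n n' p q h
  rw [HomologicalComplex.mapBifunctor.d₁_eq X Y _ _ (i₁ := p) (i₁' := p') hp q n'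
    (show p' + q = n' by lia)] at h1
  rw [HomologicalComplex.mapBifunctor.d₂_eq X Y _ _ p (i₂ := q) (i₂' := q') hq n'
    (show p + q' = n' by lia)] at h2
  refine (Preadditive.comp_add _ _ _ _ _ _).trans (congr_arg₂ (· + ·) (h1.trans ?_) (h2.trans ?_))
  · exact one_smul _ _
  · rfl

lemma tensorι_associator (X Y Z : PCh R) (p q r pq qr n : ℤ) (h₁ : p + q = pq) (h₂ : q + r = qr)
    (h : pq + r = n) (h' : p + qr = n) :
    tensorι X Y p q pq h₁ ▷ Z.X r ≫ tensorι (X ⊗ Y) Z pq r n h ≫ (α_ X Y Z).hom.f n =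
      (α_ (X.X p) (Y.X q) (Z.X r)).hom ≫ X.X p ◁ tensorι Y Z q r qr h₂ ≫
        tensorι X (Y ⊗ Z) p qr n h' := by
  have h3 := HomologicalComplex.ι_mapBifunctorAssociatorX_hom
    (curriedAssociatorNatIso (PMod R)) X Y Z (ComplexShape.down ℤ) (ComplexShape.down ℤ)
    (ComplexShape.down ℤ) p q r n (show p + q + r = n by lia)
  rw [HomologicalComplex.mapBifunctor₁₂.ι_eq _ _ X Y Z _ _ p q r pq n h₁ h,
    HomologicalComplex.mapBifunctor₂₃.ι_eq _ _ X Y Z (ComplexShape.down ℤ) _ _ p q r qr n h₂ h'] at h3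
  exact (Category.assoc _ _ _).symm.trans h3

lemma tensorι_leftUnitor_inv (X : PCh R) (n : ℤ) :
    (λ_ X).inv.f n = (λ_ (X.X n)).inv ≫
      (HomologicalComplex.singleObjXSelf (ComplexShape.down ℤ) 0 (𝟙_ (PMod R))).inv ▷ X.X n ≫
      tensorι (𝟙_ (PCh R)) X 0 n n (zero_add n) :=
  HomologicalComplex.leftUnitor'_inv X n

lemma tensorι_rightUnitor_inv (X : PCh R) (n : ℤ) :
    (ρ_ X).inv.f n = (ρ_ (X.X n)).inv ≫
      X.X n ◁ (HomologicalComplex.singleObjXSelf (ComplexShape.down ℤ) 0 (𝟙_ (PMod R))).inv ≫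
      tensorι X (𝟙_ (PCh R)) n 0 n (add_zero n) :=
  HomologicalComplex.rightUnitor'_inv X n

end

noncomputable section

open scoped ZeroObject Simplicial

/-! ### Maps from the tensor product with normalized chains -/

variable {C : Type u₁} [Category.{v₁} C] {R : Cᵒᵖ ⥤ CommRingCat.{u}}

open ChainComplexLifting

/-- The restriction of the inclusion of a summand in `B ⊗ C(S)` to a simplex of `S`. -/
def tensorCell (B : PCh R) {S : SSet.{u}} {m : ℕ} (s : S _⦋m⦌) (p n : ℤ) (h : p + m = n) :
    B.X p ⟶ (B ⊗ (simplicialChains R).obj S).X n :=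
  (ρ_ _).inv ≫ B.X p ◁ chainCell R s ≫ tensorι B ((simplicialChains R).obj S) p m n h

section

variable {B : PCh R} {S : SSet.{u}}

lemma tensorCell_eq_zero {m : ℕ} (s : S _⦋m⦌) (hs : s ∈ S.degenerate m) (p n : ℤ) (h : p + m = n) :
    tensorCell B s p n h = 0 := by
  rw [tensorCell, chainCell_eq_zero s hs, MonoidalPreadditive.whiskerLeft_zero, zero_comp,
    comp_zero]

lemma tensorCell_whiskerRight {B' : PCh R} (i : B ⟶ B') {m : ℕ} (s : S _⦋m⦌) (p n : ℤ)
    (h : p + m = n) :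
    tensorCell B s p n h ≫ (i ▷ (simplicialChains R).obj S).f n =
      i.f p ≫ tensorCell B' s p n h := by
  rw [tensorCell, tensorCell, Category.assoc, Category.assoc, tensorι_whiskerRight,
    whisker_exchange_assoc, rightUnitor_inv_naturality_assoc]

lemma tensorCell_whiskerLeft {S' : SSet.{u}} (f : S ⟶ S') {m : ℕ} (s : S _⦋m⦌) (p n : ℤ)
    (h : p + m = n) :
    tensorCell B s p n h ≫ (B ◁ (simplicialChains R).map f).f n =
      tensorCell B (f.app _ s) p n h := by
  rw [tensorCell, tensorCell, Category.assoc, Category.assoc, tensorι_whiskerLeft,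
    ← MonoidalCategory.whiskerLeft_comp_assoc, chainCell_map]

lemma whiskerLeft_zsmul' {X Y Z : PMod R} (c : ℤ) (f : Y ⟶ Z) : X ◁ (c • f) = c • X ◁ f :=
  (tensorLeft X).map_zsmul

lemma whiskerLeft_sum' {X Y Z : PMod R} {ι : Type*} (t : Finset ι) (f : ι → (Y ⟶ Z)) :
    X ◁ (∑ i ∈ t, f i) = ∑ i ∈ t, X ◁ f i :=
  (tensorLeft X).map_sum _ _

lemma tensorCell_d {m : ℕ} (s : S _⦋m + 1⦌) {p p' n n' : ℤ} (h : p + (m + 1 : ℕ) = n)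
    (hp : p' + 1 = p) (hn : n' + 1 = n) :
    tensorCell B s p n h ≫ (B ⊗ (simplicialChains R).obj S).d n n' =
      B.d p p' ≫ tensorCell B s p' n' (by lia) + p.negOnePow •
        ∑ i : Fin (m + 2), (-1 : ℤ) ^ (i : ℕ) • tensorCell B (S.δ i s) p n' (by lia) := by
  rw [tensorCell, Category.assoc, Category.assoc,
    tensorι_d _ _ h hp (q' := (m : ℤ)) (by lia) hn, Preadditive.comp_add, Preadditive.comp_add,
    whisker_exchange_assoc, ← rightUnitor_inv_naturality_assoc, Linear.comp_units_smul,
    Linear.comp_units_smul, ← MonoidalCategory.whiskerLeft_comp_assoc, chainCell_d, whiskerLeft_sum',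
    Preadditive.sum_comp, Preadditive.comp_sum]
  congr 2
  refine Finset.sum_congr rfl (fun i _ ↦ ?_)
  rw [whiskerLeft_zsmul', Preadditive.zsmul_comp, Preadditive.comp_zsmul, tensorCell]

lemma tensorCell_d_zero (s : S _⦋0⦌) {p p' n n' : ℤ} (h : p + (0 : ℕ) = n)
    (hp : p' + 1 = p) (hn : n' + 1 = n) :
    tensorCell B s p n h ≫ (B ⊗ (simplicialChains R).obj S).d n n' =
      B.d p p' ≫ tensorCell B s p' n' (by lia) := by
  rw [tensorCell, Category.assoc, Category.assoc,
    tensorι_d _ _ h hp (q' := -1) (by lia) hn, Preadditive.comp_add, Preadditive.comp_add,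
    whisker_exchange_assoc, ← rightUnitor_inv_naturality_assoc, Linear.comp_units_smul,
    Linear.comp_units_smul,
    (isZero_chains_X R S (-1) (by lia)).eq_of_tgt (((simplicialChains R).obj S).d _ _) 0,
    MonoidalPreadditive.whiskerLeft_zero, zero_comp, comp_zero, comp_zero, smul_zero, add_zero,
    tensorCell]

instance (X : PMod R) : (tensorLeft X).Additive where

lemma isZero_tensor_chains (X : PMod R) (q : ℤ) (hq : q < 0) :
    IsZero (X ⊗ ((simplicialChains R).obj S).X q) :=
  (tensorLeft X).map_isZero (isZero_chains_X R S q hq)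

lemma tensorCell_hom_ext_X {n : ℤ} {M : PMod R}
    {f g : (B ⊗ (simplicialChains R).obj S).X n ⟶ M}
    (h : ∀ (m : ℕ) (s : S _⦋m⦌) (p : ℤ) (hp : p + m = n),
      tensorCell B s p n hp ≫ f = tensorCell B s p n hp ≫ g) : f = g := by
  refine tensorι_hom_ext (fun p q hpq ↦ ?_)
  obtain ⟨m, rfl⟩ | hq : (∃ m : ℕ, q = m) ∨ q < 0 := by
    by_cases h : 0 ≤ q
    · exact Or.inl ⟨q.toNat, by lia⟩
    · lia
  · refine chainCell_hom_ext (T := tensorLeft (B.X p)) (fun s ↦ ?_)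
    have := h m s p hpq
    simp only [tensorCell, Category.assoc, Iso.cancel_iso_inv_left] at this
    exact this
  · exact (isZero_tensor_chains (B.X p) q hq).eq_of_src _ _

lemma tensorCell_hom_ext {X : PCh R} {φ ψ : B ⊗ (simplicialChains R).obj S ⟶ X}
    (h : ∀ (m : ℕ) (s : S _⦋m⦌) (p n : ℤ) (hp : p + m = n),
      tensorCell B s p n hp ≫ φ.f n = tensorCell B s p n hp ≫ ψ.f n) : φ = ψ := by
  ext n : 1
  exact tensorCell_hom_ext_X (fun m s p hp ↦ h m s p n hp)

/-- The families of graded maps which correspond to maps from `B ⊗ C(S)` to `X`. -/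
abbrev SSet.IsChainFamilyGraded (S : SSet.{u}) (B X : PCh R)
    (x : ∀ m : ℕ, S _⦋m⦌ → GradedHom B X (m : ℤ)) : Prop :=
  S.IsChainFamily (K := fun m : ℕ ↦ GradedHom B X (m : ℤ))
    (fun m h ↦ h.D (n := ((m + 1 : ℕ) : ℤ)) (n' := (m : ℤ)) (by lia))
    (fun h ↦ h.D (n := ((0 : ℕ) : ℤ)) (n' := -1) (by lia) = 0) x

/-- The graded map corresponding to a simplex. -/
def gradedCell {X : PCh R} (φ : B ⊗ (simplicialChains R).obj S ⟶ X) {m : ℕ} (s : S _⦋m⦌) :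
    GradedHom B X (m : ℤ) :=
  GradedHom.mk (fun p q h ↦ tensorCell B s p q h ≫ φ.f q)

lemma gradedCell_v {X : PCh R} (φ : B ⊗ (simplicialChains R).obj S ⟶ X) {m : ℕ} (s : S _⦋m⦌)
    (p q : ℤ) (h : p + m = q) : (gradedCell φ s).v p q h = tensorCell B s p q h ≫ φ.f q := rfl

lemma gradedHom_sum_v {B X : PCh R} {n : ℤ} {ι : Type*} (t : Finset ι) (c : ι → ℤ)
    (h : ι → GradedHom B X n) (p q : ℤ) (hpq : p + n = q) :
    GradedHom.v (∑ i ∈ t, c i • h i) p q hpq = ∑ i ∈ t, c i • (h i).v p q hpq :=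
  Finset.sum_apply _ _ _

lemma negOnePow_smul_eq_iff {M : Type*} [AddCommGroup M] (p : ℤ) (x y : M) :
    p.negOnePow • x = y ↔ x = p.negOnePow • y := by
  constructor
  · rintro rfl
    rw [shiftedCone.negOnePow_smul_smul]
  · rintro rfl
    rw [shiftedCone.negOnePow_smul_smul]

/-- The condition on a graded map `h` to correspond to a chain map in positive degrees. -/
lemma gradedHom_D_eq_iff {X : PCh R} {m n : ℤ} (hmn : m + 1 = n) (h : GradedHom B X n)
    (h' : GradedHom B X m) :
    h.D hmn = h' ↔ ∀ (p p' q q' : ℤ) (hp : p' + 1 = p) (hq : q' + 1 = q) (hpq : p + n = q),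
      h.v p q hpq ≫ X.d q q' =
        B.d p p' ≫ h.v p' q' (by lia) + p.negOnePow • h'.v p q' (by lia) := by
  constructor
  · rintro rfl p p' q q' hp hq hpq
    rw [GradedHom.D_v hmn h _ hp hq, shiftedCone.negOnePow_smul_smul]
    abel
  · intro H
    refine GradedHom.ext (fun p q hpq ↦ ?_)
    rw [GradedHom.D_v hmn h hpq (p' := p - 1) (by lia) rfl, negOnePow_smul_eq_iff,
      H p (p - 1) (q + 1) q (by lia) rfl]
    abel

lemma isChainFamilyGraded_gradedCell {X : PCh R} (φ : B ⊗ (simplicialChains R).obj S ⟶ X) :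
    S.IsChainFamilyGraded B X (fun _ s ↦ gradedCell φ s) where
  degenerate m s hs := GradedHom.ext (fun p q hpq ↦ by
    rw [gradedCell_v, tensorCell_eq_zero s hs, zero_comp]; rfl)
  d_eq m s := by
    rw [gradedHom_D_eq_iff]
    intro p p' q q' hp hq hpq
    rw [gradedHom_sum_v]
    simp only [gradedCell_v]
    rw [Category.assoc, φ.comm, reassoc_of% (tensorCell_d (B := B) s hpq hp hq),
      Preadditive.add_comp, Category.assoc, Linear.units_smul_comp, Preadditive.sum_comp]
    simp only [Preadditive.zsmul_comp]
  zero s := by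
    rw [gradedHom_D_eq_iff]
    intro p p' q q' hp hq hpq
    simp only [gradedCell_v]
    rw [Category.assoc, φ.comm, reassoc_of% (tensorCell_d_zero (B := B) s hpq hp hq)]
    exact (add_zero _).symm.trans (congr_arg _ (smul_zero _).symm)

/-- Since `B_p ⊗ -` is additive and preserves colimits, a map from `B_p ⊗ C(S)_m` is a family of
maps from `B_p` that vanishes on degenerate simplices. Compatibility with the differentials is the
chain family condition. -/
lemma exists_gradedCell_eq {X : PCh R} (x : ∀ m : ℕ, S _⦋m⦌ → GradedHom B X (m : ℤ))
    (hx : S.IsChainFamilyGraded B X x) :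
    ∃ φ : B ⊗ (simplicialChains R).obj S ⟶ X, ∀ m (s : S _⦋m⦌), gradedCell φ s = x m s := by
  have H (m : ℕ) (p n : ℤ) (h : p + m = n) := exists_chainCell_desc (T := tensorLeft (B.X p))
    (S := S) (m := m) (M := X.X n) (fun s ↦ (ρ_ _).hom ≫ (x m s).v p n h) (fun s hs ↦ by
      rw [hx.degenerate m s hs]; exact comp_zero)
  choose ψ hψ using H
  -- In negative degrees the chains of `S` vanish, so the value `0` is the only choice.
  let g (n p q : ℤ) : p + q = n → (B.X p ⊗ ((simplicialChains R).obj S).X q ⟶ X.X n) :=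
    match q with
    | Int.ofNat m => fun h ↦ ψ m p n h
    | Int.negSucc m => fun _ ↦ 0
  let F (n : ℤ) : (B ⊗ (simplicialChains R).obj S).X n ⟶ X.X n := tensorDesc (g n)
  have hF (m : ℕ) (s : S _⦋m⦌) (p n : ℤ) (h : p + m = n) :
      tensorCell B s p n h ≫ F n = (x m s).v p n h := by
    rw [tensorCell, Category.assoc, Category.assoc, tensorι_desc, Iso.inv_comp_eq]
    exact hψ m p n h s
  have comm (n n' : ℤ) (hn : n' + 1 = n) :
      F n ≫ X.d n n' = (B ⊗ (simplicialChains R).obj S).d n n' ≫ F n' := by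
    refine tensorCell_hom_ext_X (fun m s p hp ↦ ?_)
    obtain ⟨p, rfl⟩ : ∃ p', p = p' + 1 := ⟨p - 1, by lia⟩
    obtain _ | m := m
    · have h := (gradedHom_D_eq_iff (n := ((0 : ℕ) : ℤ)) (by lia) _ _).1 (hx.zero s) (p + 1) p n n'
        rfl hn hp
      rw [reassoc_of% (hF 0 s (p + 1) n hp), reassoc_of% (tensorCell_d_zero s hp rfl hn), hF, h]
      exact (congr_arg _ (smul_zero _)).trans (add_zero _)
    · have h := (gradedHom_D_eq_iff (n := ((m + 1 : ℕ) : ℤ)) (by lia) _ _).1 (hx.d_eq m s)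
        (p + 1) p n n' rfl hn hp
      rw [gradedHom_sum_v] at h
      rw [reassoc_of% (hF (m + 1) s (p + 1) n hp), reassoc_of% (tensorCell_d s hp rfl hn), h,
        Preadditive.add_comp, Category.assoc, Linear.units_smul_comp, Preadditive.sum_comp, hF]
      simp only [Preadditive.zsmul_comp, hF]
  refine ⟨{ f := F, comm' := fun n n' hn ↦ comm n n' hn }, fun m s ↦ ?_⟩
  exact GradedHom.ext (fun p q hpq ↦ hF m s p q hpq)

lemma hom_ext_of_gradedCell {X : PCh R} {φ ψ : B ⊗ (simplicialChains R).obj S ⟶ X}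
    (h : ∀ (m : ℕ) (s : S _⦋m⦌), gradedCell φ s = gradedCell ψ s) : φ = ψ :=
  tensorCell_hom_ext (fun m s p n hp ↦ congr_fun (h m s) ⟨(p, n), hp⟩)

lemma gradedCell_comp {X Y : PCh R} (φ : B ⊗ (simplicialChains R).obj S ⟶ X) (f : X ⟶ Y) {m : ℕ}
    (s : S _⦋m⦌) : gradedCell (φ ≫ f) s = (gradedCell φ s).post f :=
  GradedHom.ext (fun p q hpq ↦ by simp [gradedCell, GradedHom.post])

lemma gradedCell_whiskerRight {B' X : PCh R} (i : B' ⟶ B)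
    (φ : B ⊗ (simplicialChains R).obj S ⟶ X) {m : ℕ} (s : S _⦋m⦌) :
    gradedCell (i ▷ _ ≫ φ) s = (gradedCell φ s).pre i :=
  GradedHom.ext (fun p q hpq ↦ by
    rw [gradedCell_v, HomologicalComplex.comp_f, reassoc_of% (tensorCell_whiskerRight i s p q hpq)]
    rfl)

lemma gradedCell_whiskerLeft {X : PCh R} {S' : SSet.{u}} (f : S' ⟶ S)
    (φ : B ⊗ (simplicialChains R).obj S ⟶ X) {m : ℕ} (s : S' _⦋m⦌) :
    gradedCell (B ◁ (simplicialChains R).map f ≫ φ) s = gradedCell φ (f.app _ s) :=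
  GradedHom.ext (fun p q hpq ↦ by
    rw [gradedCell_v, HomologicalComplex.comp_f, reassoc_of% (tensorCell_whiskerLeft f s p q hpq)]
    rfl)

end

end

noncomputable section

open scoped ZeroObject Simplicial

/-! ### Extension of families of elements -/

namespace SSet

lemma map_mem_degenerate_of_not_injective (T : SSet.{u}) {a n : ℕ} (f : ⦋a⦌ ⟶ ⦋n⦌) (t : T _⦋n⦌)
    (hf : ¬ Function.Injective f.toOrderHom) : T.map f.op t ∈ T.degenerate a := by
  obtain _ | a := a
  · exact (hf (fun x y _ ↦ Subsingleton.elim (α := Fin 1) x y)).elim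
  · obtain ⟨i, θ, rfl⟩ := SimplexCategory.eq_σ_comp_of_not_injective f hf
    have h : T.map (SimplexCategory.σ i ≫ θ).op t = T.σ i (T.map θ.op t) :=
      congr_arg (fun g ↦ g t) (T.map_comp θ.op (SimplexCategory.σ i).op)
    rw [h]
    exact σ_mem_degenerate _ _ _

/-- `σ j` identifies the vertices `j` and `j + 1`, and the coface `δ i` hits both of them unless it
omits one. -/
lemma δ_σ_mem_degenerate (T : SSet.{u}) {m : ℕ} (i : Fin (m + 2)) (j : Fin (m + 1)) (t : T _⦋m⦌)
    (h₁ : i ≠ j.castSucc) (h₂ : i ≠ j.succ) : T.δ i (T.σ j t) ∈ T.degenerate m := by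
  have h : T.δ i (T.σ j t) = T.map (SimplexCategory.δ i ≫ SimplexCategory.σ j).op t :=
    (congr_arg (fun g ↦ g t) (T.map_comp (SimplexCategory.σ j).op (SimplexCategory.δ i).op)).symm
  rw [h]
  refine map_mem_degenerate_of_not_injective _ _ _ (fun hi ↦ ?_)
  obtain ⟨a, ha⟩ := Fin.exists_succAbove_eq h₁.symm
  obtain ⟨b, hb⟩ := Fin.exists_succAbove_eq h₂.symm
  have hab : a = b := hi (by
    change j.predAbove (i.succAbove a) = j.predAbove (i.succAbove b)
    rw [ha, hb]
    simp)
  subst hab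
  exact (Fin.castSucc_lt_succ (i := j)).ne (ha.symm.trans hb)

/-- Only the faces `j` and `j + 1` can be nondegenerate; both equal `t` and carry opposite signs. -/
lemma sum_δ_σ_eq_zero (T : SSet.{u}) {K : Type w} [AddCommGroup K] {m : ℕ} (x : T _⦋m⦌ → K)
    (hx : ∀ t ∈ T.degenerate m, x t = 0) (j : Fin (m + 1)) (t : T _⦋m⦌) :
    ∑ i : Fin (m + 2), (-1 : ℤ) ^ (i : ℕ) • x (T.δ i (T.σ j t)) = 0 := by
  rw [Finset.sum_eq_add j.castSucc j.succ (Fin.castSucc_lt_succ).ne (fun i _ hi ↦ by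
    rw [hx _ (δ_σ_mem_degenerate T i j t hi.1 hi.2), smul_zero]) (by simp) (by simp),
    δ_comp_σ_self_apply, δ_comp_σ_succ_apply]
  simp [pow_succ]

/-- The universal case is `d² = 0` in the alternating face map complex of the free abelian groups on
the simplices of `T`; the additive extension of `x` carries it to `K`. -/
lemma sum_δ_δ_eq_zero (T : SSet.{u}) {K : Type w} [AddCommGroup K] {m : ℕ} (x : T _⦋m⦌ → K)
    (t : T _⦋m + 2⦌) :
    ∑ i : Fin (m + 3), (-1 : ℤ) ^ (i : ℕ) • ∑ j : Fin (m + 2), (-1 : ℤ) ^ (j : ℕ) •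
      x (T.δ j (T.δ i t)) = 0 := by
  have h (n : ℕ) (t : T _⦋n + 1⦌) :
      AlgebraicTopology.AlternatingFaceMapComplex.objD (freeSimplicial AddCommGrpCat.free T) n
        (FreeAbelianGroup.of t) =
      ∑ i : Fin (n + 2), (-1 : ℤ) ^ (i : ℕ) • FreeAbelianGroup.of (T.δ i t) :=
    AddCommGrpCat.sum_zsmul_apply _ _ _ _
  have h1 := ConcreteCategory.congr_hom (AlgebraicTopology.AlternatingFaceMapComplex.d_squared
    (freeSimplicial AddCommGrpCat.free T) m) (FreeAbelianGroup.of t)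
  have h2 := congr_arg
    (AlgebraicTopology.AlternatingFaceMapComplex.objD (freeSimplicial AddCommGrpCat.free T) m)
    (h (m + 1) t)
  have h3 := h2.symm.trans h1
  have h4 := congr_arg (FreeAbelianGroup.lift x) h3
  refine Eq.trans ?_ (h4.trans (map_zero _))
  refine Eq.symm ((congr_arg _ (map_sum
    (AlgebraicTopology.AlternatingFaceMapComplex.objD (freeSimplicial AddCommGrpCat.free T) m).hom
    _ _)).trans ?_)
  refine (map_sum (FreeAbelianGroup.lift x) _ _).trans (Finset.sum_congr rfl (fun i _ ↦ ?_))
  refine (congr_arg _ (map_zsmul _ _ _)).trans ((map_zsmul (FreeAbelianGroup.lift x) _ _).trans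
    (congr_arg _ ?_))
  refine (congr_arg _ (h m (T.δ i t))).trans ((map_sum (FreeAbelianGroup.lift x) _ _).trans
    (Finset.sum_congr rfl (fun j _ ↦ ?_)))
  exact (map_zsmul (FreeAbelianGroup.lift x) _ _).trans
    (congr_arg _ (FreeAbelianGroup.lift_apply_of _ _))

section

variable {T : SSet.{u}} (U : T.Subcomplex) {K : ℕ → Type w} [∀ m, AddCommGroup (K m)]
  (b : ∀ m, (U : SSet.{u}) _⦋m⦌ → K m) (k : ∀ m, K m)

open Classical in
/-- The extension of a family on a subcomplex which takes given values on the nondegenerate simplices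
which do not belong to the subcomplex. -/
def extendFamily (m : ℕ) (t : T _⦋m⦌) : K m :=
  -- One value `k m` per degree suffices: a boundary or a horn misses at most one nondegenerate
  -- simplex in each dimension.
  if h : t ∈ U.obj (op ⦋m⦌) then b m ⟨t, h⟩ else if t ∈ T.degenerate m then 0 else k m

lemma extendFamily_of_mem {m : ℕ} (t : (U : SSet.{u}) _⦋m⦌) : extendFamily U b k m t.1 = b m t :=
  dif_pos t.2

lemma extendFamily_of_notMem {m : ℕ} (t : T _⦋m⦌) (h : t ∉ U.obj (op ⦋m⦌))
    (h' : t ∉ T.degenerate m) : extendFamily U b k m t = k m := by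
  rw [extendFamily, dif_neg h, if_neg h']

variable {U b} {d : ∀ m, K (m + 1) → K m} {Z : K 0 → Prop}

lemma extendFamily_of_mem_degenerate (hb : (U : SSet.{u}).IsChainFamily d Z b) {m : ℕ} (t : T _⦋m⦌)
    (h' : t ∈ T.degenerate m) : extendFamily U b k m t = 0 := by
  by_cases h : t ∈ U.obj (op ⦋m⦌)
  · refine (extendFamily_of_mem U b k ⟨t, h⟩).trans (hb.degenerate m _ ?_)
    exact (degenerate_iff_of_mono U.ι (⟨t, h⟩ : (U : SSet.{u}) _⦋m⦌)).1 h'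
  · rw [extendFamily, dif_neg h, if_pos h']

/-- Only nondegenerate simplices outside `U` impose a condition: on `U` it is inherited from `b`,
and on degenerate simplices both sides vanish. -/
lemma isChainFamily_extendFamily (hb : (U : SSet.{u}).IsChainFamily d Z b) (hd : ∀ m, d m 0 = 0)
    (h₁ : ∀ (m : ℕ) (t : T _⦋m + 1⦌), t ∉ U.obj _ → t ∉ T.degenerate _ → d m (k (m + 1)) =
      ∑ i : Fin (m + 2), (-1 : ℤ) ^ (i : ℕ) • extendFamily U b k m (T.δ i t))
    (h₂ : ∀ t : T _⦋0⦌, t ∉ U.obj _ → Z (k 0)) :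
    T.IsChainFamily d Z (extendFamily U b k) where
  degenerate m t ht := extendFamily_of_mem_degenerate k hb t ht
  d_eq m t := by
    by_cases h : t ∈ U.obj (op ⦋m + 1⦌)
    · refine (congr_arg (d m) (extendFamily_of_mem U b k ⟨t, h⟩)).trans ((hb.d_eq m ⟨t, h⟩).trans ?_)
      exact Finset.sum_congr rfl (fun i _ ↦ congr_arg _
        (extendFamily_of_mem U b k ((U : SSet.{u}).δ i ⟨t, h⟩)).symm)
    · by_cases h' : t ∈ T.degenerate (m + 1)
      · rw [extendFamily_of_mem_degenerate k hb t h', hd]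
        rw [degenerate_eq_iUnion_range_σ, Set.mem_iUnion] at h'
        obtain ⟨j, t, rfl⟩ := h'
        exact (sum_δ_σ_eq_zero T _ (fun t ht ↦ extendFamily_of_mem_degenerate k hb t ht) j t).symm
      · rw [extendFamily_of_notMem _ _ _ _ h h', h₁ m t h h']
  zero t := by
    by_cases h : t ∈ U.obj (op ⦋0⦌)
    · exact (extendFamily_of_mem U b k ⟨t, h⟩) ▸ hb.zero ⟨t, h⟩
    · rw [extendFamily_of_notMem _ _ _ _ h (by simp)]
      exact h₂ t h

end

/-- The nondegenerate simplex of maximal dimension. -/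
def topSimplex (n : ℕ) : (Δ[n] : SSet.{u}) _⦋n⦌ := stdSimplex.objEquiv.symm (𝟙 _)

lemma δ_topSimplex {n : ℕ} (i : Fin (n + 2)) :
    (Δ[n + 1] : SSet.{u}).δ i (topSimplex (n + 1)) =
      (stdSimplex.objEquiv (m := op ⦋n⦌)).symm (SimplexCategory.δ i) := rfl

lemma eq_topSimplex {n : ℕ} (t : (Δ[n] : SSet.{u}) _⦋n⦌) (ht : t ∉ (Δ[n] : SSet.{u}).degenerate n) :
    t = topSimplex n := by
  have h := (stdSimplex.mem_nonDegenerate_iff_mono t).1 ht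
  refine (stdSimplex.objEquiv (m := op ⦋n⦌)).injective ?_
  exact (SimplexCategory.eq_id_of_mono (stdSimplex.objEquiv t)).trans
    (Equiv.apply_symm_apply _ _).symm

lemma le_of_notMem_degenerate {n m : ℕ} (t : (Δ[n] : SSet.{u}) _⦋m⦌)
    (ht : t ∉ (Δ[n] : SSet.{u}).degenerate m) : m ≤ n := by
  have h := (stdSimplex.mem_nonDegenerate_iff_mono t).1 ht
  exact SimplexCategory.le_of_mono (stdSimplex.objEquiv t)

lemma eq_δ_topSimplex {n : ℕ} (k : Fin (n + 2)) (t : (Δ[n + 1] : SSet.{u}) _⦋n⦌)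
    (ht : t ∉ (Δ[n + 1] : SSet.{u}).degenerate n) (ht' : t ∉ (horn.{u} (n + 1) k).obj _) :
    t = (Δ[n + 1] : SSet.{u}).δ k (topSimplex (n + 1)) := by
  have h := (stdSimplex.mem_nonDegenerate_iff_mono t).1 ht
  obtain ⟨i, hi⟩ := SimplexCategory.eq_δ_of_mono (stdSimplex.objEquiv t)
  obtain rfl : t = (stdSimplex.objEquiv (m := op ⦋n⦌)).symm (SimplexCategory.δ i) := by
    rw [← hi, Equiv.symm_apply_apply]
  rw [objEquiv_symm_δ_notMem_horn_iff] at ht'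
  rw [ht']
  rfl

end SSet

end

noncomputable section

open scoped ZeroObject Simplicial

/-! ### Lifting of families of graded maps -/

namespace ChainComplexLifting

section

variable {A : Type u₂} [Category.{v₂} A] [Abelian A]

/-- The differential of graded maps as an additive map. -/
def GradedHom.DHom (B X : ChainComplex A ℤ) {n n' : ℤ} (hn : n' + 1 = n) :
    GradedHom B X n →+ GradedHom B X n' :=
  AddMonoidHom.mk' (GradedHom.D hn) (fun x y ↦ GradedHom.ext (fun p q hpq ↦ by
    have hp : p - 1 + 1 = p := by lia
    refine (GradedHom.D_v hn (x + y) hpq hp rfl).trans (Eq.trans ?_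
      (congr_arg₂ (fun u v ↦ u + v) (GradedHom.D_v hn x hpq hp rfl)
        (GradedHom.D_v hn y hpq hp rfl)).symm)
    rw [← smul_add]
    congr 1
    change (x.v _ _ _ + y.v _ _ _) ≫ _ - _ ≫ (x.v _ _ _ + y.v _ _ _) = _
    rw [Preadditive.add_comp, Preadditive.comp_add]
    abel))

/-- Precomposition as an additive map. -/
def GradedHom.preHom {A' B : ChainComplex A ℤ} (i : A' ⟶ B) (X : ChainComplex A ℤ) (n : ℤ) :
    GradedHom B X n →+ GradedHom A' X n :=
  AddMonoidHom.mk' (GradedHom.pre i) (fun x y ↦ GradedHom.ext (fun p q hpq ↦ by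
    simp [GradedHom.pre]))

/-- Postcomposition as an additive map. -/
def GradedHom.postHom (B : ChainComplex A ℤ) {X Y : ChainComplex A ℤ} (f : X ⟶ Y) (n : ℤ) :
    GradedHom B X n →+ GradedHom B Y n :=
  AddMonoidHom.mk' (GradedHom.post f) (fun x y ↦ GradedHom.ext (fun p q hpq ↦ by
    simp [GradedHom.post]))

end

lemma neg_one_pow_smul_smul {M : Type*} [AddCommGroup M] (k : ℕ) (x : M) :
    (-1 : ℤ) ^ k • (-1 : ℤ) ^ k • x = x := by
  rw [smul_smul, ← mul_pow]
  simp

end ChainComplexLifting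

open ChainComplexLifting

variable {C : Type u₁} [Category.{v₁} C] {R : Cᵒᵖ ⥤ CommRingCat.{u}}

namespace SSet

variable {A' B X Y : PCh R} {i : A' ⟶ B} {f : X ⟶ Y}

variable (i f) in
/-- Compatible families of graded maps on a simplicial set and on a subcomplex. -/
structure FamilyLiftingProblem {T : SSet.{u}} (U : T.Subcomplex)
    (a : ∀ m : ℕ, T _⦋m⦌ → GradedHom A' X (m : ℤ)) (c : ∀ m : ℕ, T _⦋m⦌ → GradedHom B Y (m : ℤ))
    (b : ∀ m : ℕ, (U : SSet.{u}) _⦋m⦌ → GradedHom B X (m : ℤ)) : Prop where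
  isChainFamily_a : T.IsChainFamilyGraded A' X a
  isChainFamily_c : T.IsChainFamilyGraded B Y c
  isChainFamily_b : (U : SSet.{u}).IsChainFamilyGraded B X b
  w m t : (a m t).post f = (c m t).pre i
  pre_b m t : (b m t).pre i = a m t.1
  post_b m t : (b m t).post f = c m t.1

namespace FamilyLiftingProblem

variable {T : SSet.{u}} {U : T.Subcomplex}
    {a : ∀ m : ℕ, T _⦋m⦌ → GradedHom A' X (m : ℤ)} {c : ∀ m : ℕ, T _⦋m⦌ → GradedHom B Y (m : ℤ)}
    {b : ∀ m : ℕ, (U : SSet.{u}) _⦋m⦌ → GradedHom B X (m : ℤ)}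
    (P : FamilyLiftingProblem i f U a c b) (k : ∀ m : ℕ, GradedHom B X (m : ℤ))

include P

lemma pre_extend_of_mem {m : ℕ} {t : T _⦋m⦌} (ht : t ∈ U.obj (op ⦋m⦌)) :
    (extendFamily U b k m t).pre i = a m t :=
  (congr_arg _ (extendFamily_of_mem U b k ⟨t, ht⟩)).trans (P.pre_b m ⟨t, ht⟩)

lemma post_extend_of_mem {m : ℕ} {t : T _⦋m⦌} (ht : t ∈ U.obj (op ⦋m⦌)) :
    (extendFamily U b k m t).post f = c m t :=
  (congr_arg _ (extendFamily_of_mem U b k ⟨t, ht⟩)).trans (P.post_b m ⟨t, ht⟩)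

lemma D_extend_of_mem {m : ℕ} {t : T _⦋m + 1⦌} (ht : t ∈ U.obj (op ⦋m + 1⦌)) :
    GradedHom.D (n := ((m + 1 : ℕ) : ℤ)) (n' := (m : ℤ)) (by lia) (extendFamily U b k (m + 1) t) =
      ∑ i : Fin (m + 2), (-1 : ℤ) ^ (i : ℕ) • extendFamily U b k m (T.δ i t) := by
  refine (congr_arg _ (extendFamily_of_mem U b k ⟨t, ht⟩)).trans
    ((P.isChainFamily_b.d_eq m ⟨t, ht⟩).trans ?_)
  exact Finset.sum_congr rfl (fun i _ ↦ congr_arg _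
    (extendFamily_of_mem U b k ((U : SSet.{u}).δ i ⟨t, ht⟩)).symm)

lemma D_extend_zero_of_mem {t : T _⦋0⦌} (ht : t ∈ U.obj (op ⦋0⦌)) :
    GradedHom.D (n := ((0 : ℕ) : ℤ)) (n' := -1) (by lia) (extendFamily U b k 0 t) = 0 :=
  (congr_arg _ (extendFamily_of_mem U b k ⟨t, ht⟩)).trans (P.isChainFamily_b.zero ⟨t, ht⟩)

lemma exists_lift
    (h₁ : ∀ (m : ℕ) (t : T _⦋m + 1⦌), t ∉ U.obj _ → t ∉ T.degenerate _ →
      GradedHom.D (n := ((m + 1 : ℕ) : ℤ)) (n' := (m : ℤ)) (by lia) (k (m + 1)) =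
      ∑ i : Fin (m + 2), (-1 : ℤ) ^ (i : ℕ) • extendFamily U b k m (T.δ i t))
    (h₂ : ∀ t : T _⦋0⦌, t ∉ U.obj _ →
      GradedHom.D (n := ((0 : ℕ) : ℤ)) (n' := -1) (by lia) (k 0) = 0)
    (hpre : ∀ (m : ℕ) (t : T _⦋m⦌), t ∉ U.obj _ → t ∉ T.degenerate _ → (k m).pre i = a m t)
    (hpost : ∀ (m : ℕ) (t : T _⦋m⦌), t ∉ U.obj _ → t ∉ T.degenerate _ → (k m).post f = c m t) :
    ∃ x : ∀ m : ℕ, T _⦋m⦌ → GradedHom B X (m : ℤ), T.IsChainFamilyGraded B X x ∧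
      (∀ m (t : (U : SSet.{u}) _⦋m⦌), x m t.1 = b m t) ∧ (∀ m t, (x m t).pre i = a m t) ∧
      (∀ m t, (x m t).post f = c m t) := by
  refine ⟨extendFamily U b k, isChainFamily_extendFamily k P.isChainFamily_b
    (fun m ↦ map_zero (GradedHom.DHom B X (n := ((m + 1 : ℕ) : ℤ)) (n' := (m : ℤ)) (by lia)))
    h₁ h₂, fun m t ↦ extendFamily_of_mem U b k t, fun m t ↦ ?_, fun m t ↦ ?_⟩
  · by_cases ht : t ∈ U.obj (op ⦋m⦌)
    · exact P.pre_extend_of_mem k ht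
    · by_cases ht' : t ∈ T.degenerate m
      · rw [extendFamily_of_mem_degenerate k P.isChainFamily_b t ht',
          P.isChainFamily_a.degenerate m t ht']
        exact map_zero (GradedHom.preHom i X m)
      · rw [extendFamily_of_notMem _ _ _ _ ht ht', hpre m t ht ht']
  · by_cases ht : t ∈ U.obj (op ⦋m⦌)
    · exact P.post_extend_of_mem k ht
    · by_cases ht' : t ∈ T.degenerate m
      · rw [extendFamily_of_mem_degenerate k P.isChainFamily_b t ht',
          P.isChainFamily_c.degenerate m t ht']
        exact map_zero (GradedHom.postHom B f m)
      · rw [extendFamily_of_notMem _ _ _ _ ht ht', hpost m t ht ht']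

end FamilyLiftingProblem

lemma δ_topSimplex_notMem_degenerate {n : ℕ} (k : Fin (n + 2)) :
    (Δ[n + 1] : SSet.{u}).δ k (topSimplex (n + 1)) ∉ (Δ[n + 1] : SSet.{u}).degenerate n :=
  (stdSimplex.objEquiv_symm_mem_nonDegenerate_iff_mono (SimplexCategory.δ k)).2 inferInstance

lemma notMem_boundary {n m : ℕ} {t : (Δ[n] : SSet.{u}) _⦋m⦌} (ht : t ∉ (boundary.{u} n).obj _)
    (ht' : t ∉ (Δ[n] : SSet.{u}).degenerate m) : m = n := by
  refine le_antisymm (le_of_notMem_degenerate t ht') ?_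
  by_contra! h
  rw [boundary_obj_eq_univ m n h] at ht
  simp at ht

lemma notMem_horn {n m : ℕ} {k : Fin (n + 2)} {t : (Δ[n + 1] : SSet.{u}) _⦋m⦌}
    (ht : t ∉ (horn.{u} (n + 1) k).obj _)
    (ht' : t ∉ (Δ[n + 1] : SSet.{u}).degenerate m) : m = n ∨ m = n + 1 := by
  have h₁ := le_of_notMem_degenerate t ht'
  have h₂ : ¬ m < n := fun h ↦ by
    rw [horn_obj_eq_univ k m (by lia)] at ht
    simp at ht
  lia

section

variable (hi : ∀ ⦃X Y : PCh R⦄ (p : X ⟶ Y), (∀ n, Epi (p.f n)) → QuasiIso p →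
      HasLiftingProperty i p) (hf : ∀ n, Epi (f.f n)) [EnoughProjectives (PMod R)]

include hi hf

/-- The top simplex is the only nondegenerate simplex outside the boundary. Its value must have as
differential the alternating sum of the given values on its faces, which is a case of
`exists_lift_gradedHom_of_D`. -/
lemma exists_lift_boundary (hif : (∀ ⦃X Y : PCh R⦄ (p : X ⟶ Y), (∀ n, Epi (p.f n)) →
      HasLiftingProperty i p) ∨ QuasiIso f) {n : ℕ}
    {a : ∀ m : ℕ, (Δ[n] : SSet.{u}) _⦋m⦌ → GradedHom A' X (m : ℤ)}
    {c : ∀ m : ℕ, (Δ[n] : SSet.{u}) _⦋m⦌ → GradedHom B Y (m : ℤ)}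
    {b : ∀ m : ℕ, (boundary.{u} n : SSet.{u}) _⦋m⦌ → GradedHom B X (m : ℤ)}
    (P : FamilyLiftingProblem i f (boundary.{u} n) a c b) :
    ∃ x : ∀ m : ℕ, (Δ[n] : SSet.{u}) _⦋m⦌ → GradedHom B X (m : ℤ),
      (Δ[n] : SSet.{u}).IsChainFamilyGraded B X x ∧
      (∀ m (t : (boundary.{u} n : SSet.{u}) _⦋m⦌), x m t.1 = b m t) ∧
      (∀ m t, (x m t).pre i = a m t) ∧ (∀ m t, (x m t).post f = c m t) := by
  obtain _ | n := n
  -- The value on a vertex must be a cycle, so the prescribed differential is `0`, in degree `-1`.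
  · obtain ⟨h, h₁, h₂, h₃⟩ := exists_lift_gradedHom_of_D hi hf hif (n := ((0 : ℕ) : ℤ))
      (n' := -1) (by lia) (c 0 (topSimplex 0)) (a 0 (topSimplex 0)) 0
      (map_zero (GradedHom.DHom B X (by lia))) (P.w _ _)
      ((map_zero (GradedHom.preHom i X _)).trans (P.isChainFamily_a.zero _).symm)
      ((map_zero (GradedHom.postHom B f _)).trans (P.isChainFamily_c.zero _).symm)
    refine P.exists_lift (Function.update 0 0 h) (fun m t ht ht' ↦ ?_) (fun t ht ↦ ?_)
      (fun m t ht ht' ↦ ?_) (fun m t ht ht' ↦ ?_)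
    · simpa using notMem_boundary ht ht'
    · rw [Function.update_self]
      exact h₃
    · obtain rfl := notMem_boundary ht ht'
      rw [Function.update_self, h₁, eq_topSimplex t ht']
    · obtain rfl := notMem_boundary ht ht'
      rw [Function.update_self, h₂, eq_topSimplex t ht']
  · let s := topSimplex.{u} (n + 1)
    have hs (j : Fin (n + 2)) : (Δ[n + 1] : SSet.{u}).δ j s ∈ (boundary.{u} (n + 1)).obj _ := by
      rw [boundary_obj_eq_univ n (n + 1)]
      simp
    -- All faces lie in the boundary, so the default `0` in `extendFamily` never affects this sum.
    let z : GradedHom B X (n : ℤ) := ∑ j : Fin (n + 2),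
      (-1 : ℤ) ^ (j : ℕ) • extendFamily (boundary.{u} (n + 1)) b 0 n ((Δ[n + 1] : SSet.{u}).δ j s)
    have hz (n' : ℤ) (hn' : n' + 1 = n) : GradedHom.DHom B X hn' z = 0 := by
      rw [map_sum]
      -- If the faces are vertices, each term is a cycle; otherwise `D z` is a double alternating
      -- sum of faces.
      obtain _ | n := n
      · obtain rfl : n' = -1 := by lia
        refine Finset.sum_eq_zero (fun j _ ↦ ?_)
        rw [map_zsmul]
        exact (congr_arg _ (P.D_extend_zero_of_mem 0 (hs j))).trans (smul_zero _)
      · obtain rfl : n' = n := by lia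
        have H := sum_δ_δ_eq_zero (Δ[n + 2] : SSet.{u})
          (extendFamily (boundary.{u} (n + 2)) b 0 n) s
        refine Eq.trans ?_ H
        refine Finset.sum_congr rfl (fun j _ ↦ ?_)
        rw [map_zsmul]
        exact congr_arg _ (P.D_extend_of_mem 0 (hs j))
    obtain ⟨h, h₁, h₂, h₃⟩ := exists_lift_gradedHom_of_D hi hf hif (n := ((n + 1 : ℕ) : ℤ))
      (n' := n) (by lia) (c (n + 1) s) (a (n + 1) s) z (hz _ (by lia)) (P.w _ _)
      ((map_sum (GradedHom.preHom i X _) _ _).trans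
        (Eq.trans (Finset.sum_congr rfl (fun j _ ↦ (map_zsmul _ _ _).trans
          (congr_arg _ (P.pre_extend_of_mem 0 (hs j)))))
          (P.isChainFamily_a.d_eq _ _).symm))
      ((map_sum (GradedHom.postHom B f _) _ _).trans
        (Eq.trans (Finset.sum_congr rfl (fun j _ ↦ (map_zsmul _ _ _).trans
          (congr_arg _ (P.post_extend_of_mem 0 (hs j)))))
          (P.isChainFamily_c.d_eq _ _).symm))
    refine P.exists_lift (Function.update 0 (n + 1) h) (fun m t ht ht' ↦ ?_) (fun t ht ↦ ?_)
      (fun m t ht ht' ↦ ?_) (fun m t ht ht' ↦ ?_)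
    · obtain rfl : m = n := by simpa using notMem_boundary ht ht'
      obtain rfl := eq_topSimplex t ht'
      rw [Function.update_self, h₃]
      refine Finset.sum_congr rfl (fun j _ ↦ congr_arg _ ?_)
      exact (extendFamily_of_mem _ b _ ⟨_, hs j⟩).trans
        (extendFamily_of_mem _ b _ ⟨_, hs j⟩).symm
    · have := notMem_boundary ht (by simp)
      lia
    · obtain rfl := notMem_boundary ht ht'
      rw [Function.update_self, h₁, eq_topSimplex t ht']
    · obtain rfl := notMem_boundary ht ht'
      rw [Function.update_self, h₂, eq_topSimplex t ht']

/-- The top simplex and its face `k` are missing. The value `h` on the top simplex is lifted with no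
condition on its differential, so no acyclicity of `i` or `f` is needed; the value on the face is
then read off from `D h`. -/
lemma exists_lift_horn {n : ℕ} (k : Fin (n + 2))
    {a : ∀ m : ℕ, (Δ[n + 1] : SSet.{u}) _⦋m⦌ → GradedHom A' X (m : ℤ)}
    {c : ∀ m : ℕ, (Δ[n + 1] : SSet.{u}) _⦋m⦌ → GradedHom B Y (m : ℤ)}
    {b : ∀ m : ℕ, (horn.{u} (n + 1) k : SSet.{u}) _⦋m⦌ → GradedHom B X (m : ℤ)}
    (P : FamilyLiftingProblem i f (horn.{u} (n + 1) k) a c b) :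
    ∃ x : ∀ m : ℕ, (Δ[n + 1] : SSet.{u}) _⦋m⦌ → GradedHom B X (m : ℤ),
      (Δ[n + 1] : SSet.{u}).IsChainFamilyGraded B X x ∧
      (∀ m (t : (horn.{u} (n + 1) k : SSet.{u}) _⦋m⦌), x m t.1 = b m t) ∧
      (∀ m t, (x m t).pre i = a m t) ∧ (∀ m t, (x m t).post f = c m t) := by
  let s := topSimplex.{u} (n + 1)
  have hs (j : Fin (n + 2)) (hj : j ≠ k) :
      (Δ[n + 1] : SSet.{u}).δ j s ∈ (horn.{u} (n + 1) k).obj _ := by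
    rw [δ_topSimplex, objEquiv_symm_δ_mem_horn_iff]
    exact hj
  have hs' : (Δ[n + 1] : SSet.{u}).δ k s ∉ (horn.{u} (n + 1) k).obj _ := by
    rw [δ_topSimplex, objEquiv_symm_δ_notMem_horn_iff]
  have hn : (n : ℤ) + 1 = ((n + 1 : ℕ) : ℤ) := by lia
  obtain ⟨h, h₁, h₂⟩ := exists_lift_gradedHom hi hf (n := ((n + 1 : ℕ) : ℤ))
    (c (n + 1) s) (a (n + 1) s) (P.w _ _)
  let e (j : Fin (n + 2)) : GradedHom B X (n : ℤ) :=
    (-1 : ℤ) ^ (j : ℕ) • extendFamily (horn.{u} (n + 1) k) b 0 n ((Δ[n + 1] : SSet.{u}).δ j s)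
  -- This is the equation `D h = ∑ (-1) ^ j x (d_j s)` solved for the term `j = k`; the sign is its
  -- own inverse.
  let h' : GradedHom B X (n : ℤ) :=
    (-1 : ℤ) ^ (k : ℕ) • (GradedHom.DHom B X hn h - ∑ j ∈ Finset.univ.erase k, e j)
  let K : ∀ m : ℕ, GradedHom B X (m : ℤ) := Function.update (Function.update 0 n h') (n + 1) h
  have hK : K (n + 1) = h := Function.update_self _ _ _
  have hK' : K n = h' := by
    rw [show K n = Function.update (0 : ∀ m : ℕ, GradedHom B X (m : ℤ)) n h' n from
      Function.update_of_ne (by simp) _ _, Function.update_self]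
  have hx (j : Fin (n + 2)) (hj : j ≠ k) :
      extendFamily (horn.{u} (n + 1) k) b K n ((Δ[n + 1] : SSet.{u}).δ j s) =
        extendFamily (horn.{u} (n + 1) k) b 0 n ((Δ[n + 1] : SSet.{u}).δ j s) :=
    (extendFamily_of_mem _ b _ ⟨_, hs j hj⟩).trans (extendFamily_of_mem _ b _ ⟨_, hs j hj⟩).symm
  have hx' : extendFamily (horn.{u} (n + 1) k) b K n ((Δ[n + 1] : SSet.{u}).δ k s) = h' := by
    rw [extendFamily_of_notMem _ _ _ _ hs' (δ_topSimplex_notMem_degenerate k), hK']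
  have hD : GradedHom.DHom B X hn h = ∑ j : Fin (n + 2),
      (-1 : ℤ) ^ (j : ℕ) • extendFamily (horn.{u} (n + 1) k) b K n
        ((Δ[n + 1] : SSet.{u}).δ j s) := by
    rw [← Finset.add_sum_erase _ _ (Finset.mem_univ k), hx', neg_one_pow_smul_smul]
    rw [show ∑ j ∈ Finset.univ.erase k, (-1 : ℤ) ^ (j : ℕ) •
      extendFamily (horn.{u} (n + 1) k) b K n ((Δ[n + 1] : SSet.{u}).δ j s) =
      ∑ j ∈ Finset.univ.erase k, e j from Finset.sum_congr rfl (fun j hj ↦ by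
        rw [hx j (Finset.ne_of_mem_erase hj)])]
    abel
  have hDD (n' : ℤ) (hn' : n' + 1 = n) : ∑ j : Fin (n + 2), (-1 : ℤ) ^ (j : ℕ) •
      GradedHom.DHom B X hn' (extendFamily (horn.{u} (n + 1) k) b K n
        ((Δ[n + 1] : SSet.{u}).δ j s)) = 0 := by
    have H : GradedHom.DHom B X hn' (GradedHom.DHom B X hn h) = 0 := GradedHom.D_D hn hn' h
    rw [hD, map_sum] at H
    refine Eq.trans (Finset.sum_congr rfl (fun j _ ↦ ?_)) H
    rw [map_zsmul]
  -- Restrict the formula for `D h` along `i` and compare it with the one for `a` on the top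
  -- simplex. The terms `j ≠ k` agree since those faces lie in the horn, hence so do the terms `k`.
  have hpre : GradedHom.pre i h' = a n ((Δ[n + 1] : SSet.{u}).δ k s) := by
    have H : GradedHom.preHom i X n (GradedHom.DHom B X hn h) =
        GradedHom.DHom A' X hn (a (n + 1) s) :=
      (GradedHom.D_pre hn i h).symm.trans (congr_arg _ h₁)
    have H' : GradedHom.DHom A' X hn (a (n + 1) s) = _ := P.isChainFamily_a.d_eq n s
    rw [hD, map_sum, H', ← Finset.add_sum_erase _ _ (Finset.mem_univ k),
      ← Finset.add_sum_erase _ _ (Finset.mem_univ k), hx'] at H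
    rw [Finset.sum_congr rfl (fun j hj ↦ (map_zsmul (GradedHom.preHom i X n) _ _).trans
      (congr_arg _ (P.pre_extend_of_mem K (hs j (Finset.ne_of_mem_erase hj))))),
      add_left_inj, map_zsmul] at H
    have := congr_arg (fun x ↦ (-1 : ℤ) ^ (k : ℕ) • x) H
    simp only [neg_one_pow_smul_smul] at this
    exact this
  have hpost : GradedHom.post f h' = c n ((Δ[n + 1] : SSet.{u}).δ k s) := by
    have H : GradedHom.postHom B f n (GradedHom.DHom B X hn h) =
        GradedHom.DHom B Y hn (c (n + 1) s) :=
      (GradedHom.D_post hn f h).symm.trans (congr_arg _ h₂)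
    have H' : GradedHom.DHom B Y hn (c (n + 1) s) = _ := P.isChainFamily_c.d_eq n s
    rw [hD, map_sum, H', ← Finset.add_sum_erase _ _ (Finset.mem_univ k),
      ← Finset.add_sum_erase _ _ (Finset.mem_univ k), hx'] at H
    rw [Finset.sum_congr rfl (fun j hj ↦ (map_zsmul (GradedHom.postHom B f n) _ _).trans
      (congr_arg _ (P.post_extend_of_mem K (hs j (Finset.ne_of_mem_erase hj))))),
      add_left_inj, map_zsmul] at H
    have := congr_arg (fun x ↦ (-1 : ℤ) ^ (k : ℕ) • x) H
    simp only [neg_one_pow_smul_smul] at this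
    exact this
  refine P.exists_lift K (fun m t ht ht' ↦ ?_) (fun t ht ↦ ?_)
    (fun m t ht ht' ↦ ?_) (fun m t ht ht' ↦ ?_)
  -- For the missing face, `D (D h) = 0` is compared with the vanishing double sum of faces: all
  -- terms `j ≠ k` agree, which gives the required differential of `h'`.
  · obtain rfl | hm : m + 1 = n ∨ m = n := by simpa using notMem_horn ht ht'
    · obtain rfl := eq_δ_topSimplex k t ht' ht
      rw [hK']
      have H := hDD m (by lia)
      have H' := sum_δ_δ_eq_zero (Δ[m + 2] : SSet.{u})
        (extendFamily (horn.{u} (m + 2) k) b K m) s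
      rw [← Finset.add_sum_erase _ _ (Finset.mem_univ k), hx'] at H
      rw [← Finset.add_sum_erase _ _ (Finset.mem_univ k), ← H,
        Finset.sum_congr rfl (fun (j : Fin (m + 3)) hj ↦
          congr_arg (fun y ↦ (-1 : ℤ) ^ (j : ℕ) • y)
            (P.D_extend_of_mem K (hs j (Finset.ne_of_mem_erase hj))).symm)] at H'
      have := congr_arg (fun x ↦ (-1 : ℤ) ^ (k : ℕ) • x) (add_right_cancel H')
      simp only [neg_one_pow_smul_smul] at this
      exact this.symm
    · subst hm
      obtain rfl := eq_topSimplex t ht'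
      rw [hK]
      exact hD
  -- For a horn in `Δ[1]` the missing face is a vertex, and `h'` must be a cycle. The other vertex
  -- carries a cycle, so `D (D h) = 0` leaves only the term of `h'`.
  · obtain rfl : n = 0 := by
      have := notMem_horn ht (by simp)
      lia
    obtain rfl := eq_δ_topSimplex k t (by simp) ht
    rw [hK']
    have H := hDD (-1) (by lia)
    rw [← Finset.add_sum_erase _ _ (Finset.mem_univ k), hx'] at H
    replace H := (congr_arg (fun y ↦ _ + y) (Finset.sum_eq_zero (fun (j : Fin 2) hj ↦
      (congr_arg (fun y ↦ (-1 : ℤ) ^ (j : ℕ) • y)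
        (P.D_extend_zero_of_mem K (hs j (Finset.ne_of_mem_erase hj)))).trans
          (smul_zero _)))).symm.trans H
    rw [add_zero] at H
    have := congr_arg (fun x ↦ (-1 : ℤ) ^ (k : ℕ) • x) H
    simp only [neg_one_pow_smul_smul, smul_zero] at this
    exact this
  · obtain rfl | rfl := notMem_horn ht ht'
    · obtain rfl := eq_δ_topSimplex k t ht' ht
      rw [hK', hpre]
    · obtain rfl := eq_topSimplex t ht'
      rw [hK, h₁]
  · obtain rfl | rfl := notMem_horn ht ht'
    · obtain rfl := eq_δ_topSimplex k t ht' ht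
      rw [hK', hpost]
    · obtain rfl := eq_topSimplex t ht'
      rw [hK, h₂]

end

end SSet

end

noncomputable section

open scoped ZeroObject Simplicial

/-! ### The tensor product of maps from the unit -/

variable {C : Type u₁} [Category.{v₁} C] {R : Cᵒᵖ ⥤ CommRingCat.{u}}

section

variable {X Y Z : PCh R} {p q r : ℤ}

/-- The tensor product of two maps from the unit in given degrees, as a map to the component of
degree `n` (it is zero unless the degrees add up to `n`). -/
def tensorPoint (x : 𝟙_ (PMod R) ⟶ X.X p) (y : 𝟙_ (PMod R) ⟶ Y.X q) (n : ℤ) :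
    𝟙_ (PMod R) ⟶ (X ⊗ Y).X n :=
  if h : p + q = n then (λ_ _).inv ≫ x ▷ _ ≫ X.X p ◁ y ≫ tensorι X Y p q n h else 0

lemma tensorPoint_eq (x : 𝟙_ (PMod R) ⟶ X.X p) (y : 𝟙_ (PMod R) ⟶ Y.X q) {n : ℤ}
    (h : p + q = n) :
    tensorPoint x y n = (λ_ _).inv ≫ x ▷ _ ≫ X.X p ◁ y ≫ tensorι X Y p q n h := dif_pos h

lemma tensorPoint_eq_zero (x : 𝟙_ (PMod R) ⟶ X.X p) (y : 𝟙_ (PMod R) ⟶ Y.X q) {n : ℤ}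
    (h : p + q ≠ n) : tensorPoint x y n = 0 := dif_neg h

/-- The tensor product as an additive map in the first variable. -/
def tensorPointLeftHom (p : ℤ) (y : 𝟙_ (PMod R) ⟶ Y.X q) (n : ℤ) :
    (𝟙_ (PMod R) ⟶ X.X p) →+ (𝟙_ (PMod R) ⟶ (X ⊗ Y).X n) :=
  AddMonoidHom.mk' (fun x ↦ tensorPoint x y n) (fun x x' ↦ by
    by_cases h : p + q = n
    · simp only [tensorPoint_eq _ _ h, MonoidalPreadditive.add_whiskerRight,
        Preadditive.add_comp, Preadditive.comp_add]
    · simp only [tensorPoint_eq_zero _ _ h, add_zero])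

/-- The tensor product as an additive map in the second variable. -/
def tensorPointRightHom (x : 𝟙_ (PMod R) ⟶ X.X p) (q n : ℤ) :
    (𝟙_ (PMod R) ⟶ Y.X q) →+ (𝟙_ (PMod R) ⟶ (X ⊗ Y).X n) :=
  AddMonoidHom.mk' (fun y ↦ tensorPoint x y n) (fun y y' ↦ by
    by_cases h : p + q = n
    · simp only [tensorPoint_eq _ _ h, MonoidalPreadditive.whiskerLeft_add,
        Preadditive.add_comp, Preadditive.comp_add]
    · simp only [tensorPoint_eq_zero _ _ h, add_zero])

lemma zero_tensorPoint (y : 𝟙_ (PMod R) ⟶ Y.X q) (n : ℤ) :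
    tensorPoint (X := X) (p := p) 0 y n = 0 := map_zero (tensorPointLeftHom (X := X) p y n)

lemma tensorPoint_zero (x : 𝟙_ (PMod R) ⟶ X.X p) (n : ℤ) :
    tensorPoint (Y := Y) (q := q) x 0 n = 0 := map_zero (tensorPointRightHom (Y := Y) x q n)

lemma sum_tensorPoint {ι : Type*} (t : Finset ι) (x : ι → (𝟙_ (PMod R) ⟶ X.X p))
    (y : 𝟙_ (PMod R) ⟶ Y.X q) (n : ℤ) :
    tensorPoint (∑ i ∈ t, x i) y n = ∑ i ∈ t, tensorPoint (x i) y n :=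
  map_sum (tensorPointLeftHom (X := X) p y n) _ _

lemma tensorPoint_sum {ι : Type*} (t : Finset ι) (x : 𝟙_ (PMod R) ⟶ X.X p)
    (y : ι → (𝟙_ (PMod R) ⟶ Y.X q)) (n : ℤ) :
    tensorPoint x (∑ i ∈ t, y i) n = ∑ i ∈ t, tensorPoint x (y i) n :=
  map_sum (tensorPointRightHom (Y := Y) x q n) _ _

lemma zsmul_tensorPoint (c : ℤ) (x : 𝟙_ (PMod R) ⟶ X.X p) (y : 𝟙_ (PMod R) ⟶ Y.X q) (n : ℤ) :
    tensorPoint (c • x) y n = c • tensorPoint x y n :=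
  map_zsmul (tensorPointLeftHom (X := X) p y n) _ _

lemma tensorPoint_zsmul (c : ℤ) (x : 𝟙_ (PMod R) ⟶ X.X p) (y : 𝟙_ (PMod R) ⟶ Y.X q) (n : ℤ) :
    tensorPoint x (c • y) n = c • tensorPoint x y n :=
  map_zsmul (tensorPointRightHom (Y := Y) x q n) _ _

lemma tensorPoint_whiskerRight {X' : PCh R} (f : X ⟶ X') (x : 𝟙_ (PMod R) ⟶ X.X p)
    (y : 𝟙_ (PMod R) ⟶ Y.X q) (n : ℤ) :
    tensorPoint x y n ≫ (f ▷ Y).f n = tensorPoint (x ≫ f.f p) y n := by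
  by_cases h : p + q = n
  · rw [tensorPoint_eq _ _ h, tensorPoint_eq _ _ h, Category.assoc, Category.assoc, Category.assoc,
      tensorι_whiskerRight, whisker_exchange_assoc, comp_whiskerRight_assoc]
  · rw [tensorPoint_eq_zero _ _ h, tensorPoint_eq_zero _ _ h, zero_comp]

lemma tensorPoint_whiskerLeft {Y' : PCh R} (g : Y ⟶ Y') (x : 𝟙_ (PMod R) ⟶ X.X p)
    (y : 𝟙_ (PMod R) ⟶ Y.X q) (n : ℤ) :
    tensorPoint x y n ≫ (X ◁ g).f n = tensorPoint x (y ≫ g.f q) n := by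
  by_cases h : p + q = n
  · rw [tensorPoint_eq _ _ h, tensorPoint_eq _ _ h, Category.assoc, Category.assoc, Category.assoc,
      tensorι_whiskerLeft, MonoidalCategory.whiskerLeft_comp_assoc]
  · rw [tensorPoint_eq_zero _ _ h, tensorPoint_eq_zero _ _ h, zero_comp]

lemma tensorPoint_d (x : 𝟙_ (PMod R) ⟶ X.X p) (y : 𝟙_ (PMod R) ⟶ Y.X q) {p' q' n n' : ℤ}
    (h : p + q = n) (hp : p' + 1 = p) (hq : q' + 1 = q) (hn : n' + 1 = n) :
    tensorPoint x y n ≫ (X ⊗ Y).d n n' =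
      tensorPoint (x ≫ X.d p p') y n' + p.negOnePow • tensorPoint x (y ≫ Y.d q q') n' := by
  rw [tensorPoint_eq _ _ h, tensorPoint_eq _ _ (show p' + q = n' by lia),
    tensorPoint_eq _ _ (show p + q' = n' by lia), Category.assoc, Category.assoc, Category.assoc,
    tensorι_d X Y h hp hq hn, Preadditive.comp_add, Preadditive.comp_add, Preadditive.comp_add,
    whisker_exchange_assoc, comp_whiskerRight_assoc, MonoidalCategory.whiskerLeft_comp_assoc,
    Linear.comp_units_smul, Linear.comp_units_smul, Linear.comp_units_smul]

lemma tensorPoint_associator (x : 𝟙_ (PMod R) ⟶ X.X p) (y : 𝟙_ (PMod R) ⟶ Y.X q)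
    (z : 𝟙_ (PMod R) ⟶ Z.X r) {pq qr n : ℤ} (h₁ : p + q = pq) (h₂ : q + r = qr) :
    tensorPoint (tensorPoint x y pq) z n ≫ (α_ X Y Z).hom.f n =
      tensorPoint x (tensorPoint y z qr) n := by
  by_cases h : pq + r = n
  · rw [tensorPoint_eq _ _ h, tensorPoint_eq _ _ (show p + qr = n by lia), tensorPoint_eq _ _ h₁,
      tensorPoint_eq _ _ h₂]
    simp only [Category.assoc, MonoidalCategory.comp_whiskerRight,
      MonoidalCategory.whiskerLeft_comp]
    rw [← whisker_exchange_assoc, tensorι_associator X Y Z p q r pq qr n h₁ h₂ h (by lia),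
      associator_naturality_right_assoc, associator_naturality_middle_assoc,
      associator_naturality_left_assoc, ← whisker_exchange_assoc]
    -- The two unitors of the unit object agree, so the triangle identity can absorb the associator.
    nth_rewrite 2 [unitors_inv_equal]
    rw [triangle_assoc_comp_right_inv_assoc, whisker_exchange_assoc, whisker_exchange_assoc]
  · rw [tensorPoint_eq_zero _ _ h, tensorPoint_eq_zero _ _ (show p + qr ≠ n by lia), zero_comp]

/-- The canonical map from the unit to the unit complex. -/
def unitPoint (R : Cᵒᵖ ⥤ CommRingCat.{u}) (p : ℤ) (hp : p = 0) : 𝟙_ (PMod R) ⟶ (𝟙_ (PCh R)).X p :=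
  (HomologicalComplex.singleObjXIsoOfEq (ComplexShape.down ℤ) 0 (𝟙_ (PMod R)) p hp).inv

lemma point_leftUnitor_inv (hp : p = 0) (y : 𝟙_ (PMod R) ⟶ Y.X q) :
    y ≫ (λ_ Y).inv.f q = tensorPoint (unitPoint R p hp) y q := by
  subst hp
  rw [tensorPoint_eq _ _ (zero_add q), tensorι_leftUnitor_inv, leftUnitor_inv_naturality_assoc,
    whisker_exchange_assoc]
  rfl

lemma point_rightUnitor_inv (hq : q = 0) (x : 𝟙_ (PMod R) ⟶ X.X p) :
    x ≫ (ρ_ X).inv.f p = tensorPoint x (unitPoint R q hq) p := by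
  subst hq
  rw [tensorPoint_eq _ _ (add_zero p), tensorι_rightUnitor_inv, unitors_inv_equal,
    ← rightUnitor_inv_naturality_assoc]
  rfl

lemma isZero_unit_X (p : ℤ) (hp : p ≠ 0) : IsZero ((𝟙_ (PCh R)).X p) :=
  HomologicalComplex.isZero_single_obj_X _ _ _ _ hp

end

end

noncomputable section

open scoped ZeroObject Simplicial

/-! ### Front and back faces -/

namespace SimplexCategory

/-- The map `i ↦ i + j`, truncated at `n`. -/
def segment (j a n : ℕ) : ⦋a⦌ ⟶ ⦋n⦌ :=
  mkHom ⟨fun i ↦ ⟨min ((i : ℕ) + j) n, by lia⟩, fun i k (h : (i : ℕ) ≤ k) ↦ by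
    simp only [Fin.mk_le_mk]
    lia⟩

lemma segment_apply (j a n : ℕ) (i : Fin (a + 1)) :
    ((segment j a n).toOrderHom i : ℕ) = min ((i : ℕ) + j) n := rfl

/-- The coface map for a natural number. -/
def coface (j n : ℕ) : ⦋n⦌ ⟶ ⦋n + 1⦌ :=
  mkHom ⟨fun i ↦ ⟨if (i : ℕ) < j then i else i + 1, by split_ifs <;> lia⟩,
    fun i k (h : (i : ℕ) ≤ k) ↦ by
      simp only [Fin.mk_le_mk]
      split_ifs <;> lia⟩

lemma coface_apply (j n : ℕ) (i : Fin (n + 1)) :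
    ((coface j n).toOrderHom i : ℕ) = if (i : ℕ) < j then (i : ℕ) else i + 1 := rfl

lemma hom_ext_val {a n : ℕ} {f g : ⦋a⦌ ⟶ ⦋n⦌}
    (h : ∀ i : Fin (a + 1), (f.toOrderHom i : ℕ) = g.toOrderHom i) : f = g := by
  ext i : 3
  exact Fin.ext (h i)

lemma comp_apply_val {a b c : ℕ} (f : ⦋a⦌ ⟶ ⦋b⦌) (g : ⦋b⦌ ⟶ ⦋c⦌) (i : Fin (a + 1)) :
    ((f ≫ g).toOrderHom i : ℕ) = g.toOrderHom (f.toOrderHom i) := rfl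

lemma coface_eq_δ {n : ℕ} (j : Fin (n + 2)) : coface j n = δ j :=
  hom_ext_val (fun i ↦ by
    rw [coface_apply]
    change _ = ((j.succAbove i : Fin (n + 2)) : ℕ)
    simp only [Fin.succAbove, Fin.lt_def, Fin.val_castSucc]
    split_ifs <;> simp)

lemma segment_zero_self (n : ℕ) : segment 0 n n = 𝟙 _ :=
  hom_ext_val (fun i ↦ by
    rw [segment_apply]
    change _ = (i : ℕ)
    lia)

lemma segment_comp {j' a' j a n : ℕ} (h : a' + j' ≤ a) :
    segment j' a' a ≫ segment j a n = segment (j + j') a' n :=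
  hom_ext_val (fun i ↦ by
    simp only [comp_apply_val, segment_apply]
    lia)

lemma segment_coface_of_le {a b i : ℕ} (hi : i ≤ a) :
    segment a b (a + b) ≫ coface i (a + b) = segment (a + 1) b (a + b + 1) :=
  hom_ext_val (fun k ↦ by
    simp only [comp_apply_val, segment_apply, coface_apply]
    split_ifs <;> lia)

lemma segment_zero_coface_of_le {a b i : ℕ} (hi : i ≤ a) :
    segment 0 a (a + b) ≫ coface i (a + b) = coface i a ≫ segment 0 (a + 1) (a + b + 1) :=
  hom_ext_val (fun k ↦ by
    simp only [comp_apply_val, segment_apply, coface_apply]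
    split_ifs <;> lia)

lemma segment_zero_coface_of_lt {a b j : ℕ} :
    segment 0 a (a + b) ≫ coface (a + 1 + j) (a + b) = segment 0 a (a + b + 1) :=
  hom_ext_val (fun k ↦ by
    simp only [comp_apply_val, segment_apply, coface_apply]
    split_ifs <;> lia)

lemma segment_coface_of_lt {a b j : ℕ} :
    segment a b (a + b) ≫ coface (a + 1 + j) (a + b) =
      coface (j + 1) b ≫ segment a (b + 1) (a + b + 1) :=
  hom_ext_val (fun k ↦ by
    simp only [comp_apply_val, segment_apply, coface_apply]
    split_ifs <;> lia)

lemma coface_last_segment {a b : ℕ} :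
    coface (a + 1) a ≫ segment 0 (a + 1) (a + b + 1) = segment 0 a (a + b + 1) :=
  hom_ext_val (fun k ↦ by
    simp only [comp_apply_val, segment_apply, coface_apply]
    split_ifs <;> lia)

lemma coface_zero_segment {a b : ℕ} :
    coface 0 b ≫ segment a (b + 1) (a + b + 1) = segment (a + 1) b (a + b + 1) :=
  hom_ext_val (fun k ↦ by
    simp only [comp_apply_val, segment_apply, coface_apply]
    split_ifs <;> lia)

/-- `σ i` identifies `i` and `i + 1`, and two consecutive vertices lie both in the front segment
`[0, a]` or both in the back segment `[a, a + b]`. So every Alexander-Whitney term of a degenerate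
simplex has a degenerate factor. -/
lemma segment_σ_not_injective {a b m : ℕ} (hm : a + b = m + 1) (i : Fin (m + 1)) :
    ¬ Function.Injective (segment 0 a (m + 1) ≫ σ i).toOrderHom ∨
      ¬ Function.Injective (segment a b (m + 1) ≫ σ i).toOrderHom := by
  have key {j c : ℕ} (hc : c + j ≤ m + 1) (h₁ : j ≤ i) (h₂ : i + 1 ≤ c + j) :
      ¬ Function.Injective (segment j c (m + 1) ≫ σ i).toOrderHom := fun h ↦ by
    have h₃ : (⟨i - j, by lia⟩ : Fin (c + 1)) = ⟨i + 1 - j, by lia⟩ := h (by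
      change i.predAbove _ = i.predAbove _
      have e₁ : (segment j c (m + 1)).toOrderHom ⟨i - j, by lia⟩ = i.castSucc := Fin.ext (by
        simp [segment_apply]; lia)
      have e₂ : (segment j c (m + 1)).toOrderHom ⟨i + 1 - j, by lia⟩ = i.succ := Fin.ext (by
        simp [segment_apply]; lia)
      rw [e₁, e₂]
      simp)
    simp only [Fin.mk.injEq] at h₃
    lia
  by_cases h : (i : ℕ) < a
  · exact Or.inl (key (by lia) (by lia) (by lia))
  · exact Or.inr (key (by lia) (by lia) (by lia))

end SimplexCategory

/-- The restriction of a simplex to a segment of vertices. -/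
def SSet.seg (S : SSet.{u}) (j a : ℕ) {n : ℕ} (s : S _⦋n⦌) : S _⦋a⦌ :=
  S.map (SimplexCategory.segment j a n).op s

namespace SSet

variable (S : SSet.{u})

lemma map_map_apply {a b c : ℕ} (f : ⦋a⦌ ⟶ ⦋b⦌) (g : ⦋b⦌ ⟶ ⦋c⦌) (s : S _⦋c⦌) :
    S.map f.op (S.map g.op s) = S.map (f ≫ g).op s :=
  (congr_arg (fun h ↦ h s) (S.map_comp g.op f.op)).symm

lemma seg_zero_self {n : ℕ} (s : S _⦋n⦌) : S.seg 0 n s = s := by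
  rw [seg, SimplexCategory.segment_zero_self]
  exact congr_arg (fun h ↦ h s) (S.map_id _)

lemma seg_seg {j' a' j a n : ℕ} (h : a' + j' ≤ a) (s : S _⦋n⦌) :
    S.seg j' a' (S.seg j a s) = S.seg (j + j') a' s := by
  rw [seg, seg, seg, map_map_apply, SimplexCategory.segment_comp h]

variable {S} in
lemma app_seg {S' : SSet.{u}} (f : S ⟶ S') (j a : ℕ) {n : ℕ} (s : S _⦋n⦌) :
    f.app _ (S.seg j a s) = S'.seg j a (f.app _ s) :=
  ConcreteCategory.congr_hom (f.naturality (SimplexCategory.segment j a n).op) s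

lemma seg_degenerate (T : SSet.{u}) {a b m : ℕ} (hm : a + b = m + 1) (i : Fin (m + 1)) (s : S _⦋m⦌)
    (t : T _⦋m⦌) : S.seg 0 a (S.σ i s) ∈ S.degenerate a ∨ T.seg a b (T.σ i t) ∈ T.degenerate b := by
  have h₁ : S.seg 0 a (S.σ i s) = S.map (SimplexCategory.segment 0 a (m + 1) ≫
    SimplexCategory.σ i).op s := map_map_apply _ _ _ _
  have h₂ : T.seg a b (T.σ i t) = T.map (SimplexCategory.segment a b (m + 1) ≫
    SimplexCategory.σ i).op t := map_map_apply _ _ _ _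
  rw [h₁, h₂]
  exact (SimplexCategory.segment_σ_not_injective hm i).imp
    (map_mem_degenerate_of_not_injective _ _ _) (map_mem_degenerate_of_not_injective _ _ _)

end SSet

theorem Finset.sum_antidiagonal_antidiagonal {M : Type*} [AddCommMonoid M] (n : ℕ)
    (f : ℕ → ℕ → ℕ → M) :
    ∑ x ∈ antidiagonal n, ∑ y ∈ antidiagonal x.1, f y.1 y.2 x.2 =
      ∑ x ∈ antidiagonal n, ∑ y ∈ antidiagonal x.2, f x.1 y.1 y.2 := by
  rw [sum_sigma', sum_sigma']
  refine sum_nbij' (fun x ↦ ⟨(x.2.1, x.2.2 + x.1.2), (x.2.2, x.1.2)⟩)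
    (fun x ↦ ⟨(x.1.1 + x.2.1, x.2.2), (x.1.1, x.2.1)⟩) ?_ ?_ ?_ ?_ ?_ <;>
  simp +contextual [← add_assoc]
  all_goals grind

/-- The last term of the first sum and the first term of the second cancel. In the application these
are the last face of the front part and the first face of the back part; the remaining terms are the
faces of the whole simplex. -/
lemma sum_alternating_eq {G : Type*} [AddCommGroup G] (a b : ℕ) (u v w : ℕ → G)
    (h₁ : ∀ i ≤ a, w i = u i) (h₂ : ∀ j, w (a + 1 + j) = v (j + 1)) (h₃ : u (a + 1) = v 0) :
    ∑ i ∈ Finset.range (a + 2), (-1 : ℤ) ^ i • u i +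
      (-1 : ℤ) ^ a • ∑ j ∈ Finset.range (b + 2), (-1 : ℤ) ^ j • v j =
    ∑ i ∈ Finset.range (a + b + 2), (-1 : ℤ) ^ i • w i := by
  rw [show a + b + 2 = a + 1 + (b + 1) by lia, Finset.sum_range_add _ (a + 1) (b + 1),
    Finset.sum_range_succ _ (a + 1), Finset.sum_range_succ' _ (b + 1), h₃]
  rw [Finset.sum_congr rfl (fun i hi ↦ by
    rw [← h₁ i (by simpa [Nat.lt_succ_iff] using hi)] : ∀ i ∈ Finset.range (a + 1),
      (-1 : ℤ) ^ i • u i = (-1 : ℤ) ^ i • w i), add_assoc]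
  congr 1
  rw [smul_add, Finset.smul_sum, add_comm, add_assoc, smul_smul, ← add_smul]
  simp only [pow_succ, pow_zero, mul_one, mul_neg, add_neg_cancel, zero_smul, add_zero]
  refine Finset.sum_congr rfl (fun j _ ↦ ?_)
  rw [h₂, smul_smul]
  congr 1
  ring

end

noncomputable section

open scoped ZeroObject Simplicial

/-! ### The Alexander-Whitney map -/

variable {C : Type u₁} [Category.{v₁} C] {R : Cᵒᵖ ⥤ CommRingCat.{u}}

lemma natCast_negOnePow_smul {M : Type*} [AddCommGroup M] (a : ℕ) (x : M) :
    (a : ℤ).negOnePow • x = (-1 : ℤ) ^ a • x := by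
  rw [Int.negOnePow_def]
  simp [Units.smul_def]

section

variable {S T U : SSet.{u}} {X Y : PCh R}

/-- The alternating sum of the tensor products with the faces of a simplex on the left. -/
def leftFaces {q : ℤ} (y : 𝟙_ (PMod R) ⟶ Y.X q) (n : ℤ) {a : ℕ} (s : S _⦋a⦌) :
    𝟙_ (PMod R) ⟶ ((simplicialChains R).obj S ⊗ Y).X n :=
  match a, s with
  | 0, _ => 0
  | a + 1, s => ∑ i : Fin (a + 2), (-1 : ℤ) ^ (i : ℕ) • tensorPoint (chainCell R (S.δ i s)) y n

/-- The alternating sum of the tensor products with the faces of a simplex on the right. -/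
def rightFaces {p : ℤ} (x : 𝟙_ (PMod R) ⟶ X.X p) (n : ℤ) {b : ℕ} (t : T _⦋b⦌) :
    𝟙_ (PMod R) ⟶ (X ⊗ (simplicialChains R).obj T).X n :=
  match b, t with
  | 0, _ => 0
  | b + 1, t => ∑ i : Fin (b + 2), (-1 : ℤ) ^ (i : ℕ) • tensorPoint x (chainCell R (T.δ i t)) n

lemma leftFaces_eq {q : ℤ} (y : 𝟙_ (PMod R) ⟶ Y.X q) (n : ℤ) {a : ℕ} (s : S _⦋a⦌) {p' : ℤ}
    (hp : p' + 1 = a) :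
    tensorPoint (chainCell R s ≫ ((simplicialChains R).obj S).d a p') y n = leftFaces y n s := by
  obtain _ | a := a
  · rw [(isZero_chains_X R S p' (by lia)).eq_of_tgt (chainCell R s ≫ _) 0, zero_tensorPoint]
    rfl
  · obtain rfl : p' = a := by lia
    rw [chainCell_d, sum_tensorPoint]
    exact Finset.sum_congr rfl (fun i _ ↦ zsmul_tensorPoint _ _ _ _)

lemma rightFaces_eq {p : ℤ} (x : 𝟙_ (PMod R) ⟶ X.X p) (n : ℤ) {b : ℕ} (t : T _⦋b⦌) {q' : ℤ}
    (hq : q' + 1 = b) :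
    tensorPoint x (chainCell R t ≫ ((simplicialChains R).obj T).d b q') n = rightFaces x n t := by
  obtain _ | b := b
  · rw [(isZero_chains_X R T q' (by lia)).eq_of_tgt (chainCell R t ≫ _) 0, tensorPoint_zero]
    rfl
  · obtain rfl : q' = b := by lia
    rw [chainCell_d, tensorPoint_sum]
    exact Finset.sum_congr rfl (fun i _ ↦ tensorPoint_zsmul _ _ _ _)

lemma tensorPoint_chainCell_d {a b : ℕ} (s : S _⦋a⦌) (t : T _⦋b⦌) {n n' : ℤ}
    (h : (a : ℤ) + b = n) (hn : n' + 1 = n) :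
    tensorPoint (chainCell R s) (chainCell R t) n ≫
      ((simplicialChains R).obj S ⊗ (simplicialChains R).obj T).d n n' =
      leftFaces (chainCell R t) n' s + (-1 : ℤ) ^ a • rightFaces (chainCell R s) n' t := by
  rw [tensorPoint_d _ _ h (p' := a - 1) (q' := b - 1) (by lia) (by lia) hn,
    leftFaces_eq _ _ _ (by lia), rightFaces_eq _ _ _ (by lia), natCast_negOnePow_smul]

/-- The Alexander-Whitney map on simplices. -/
def alexanderWhitneyCell {n : ℕ} (s : S _⦋n⦌) (t : T _⦋n⦌) :
    𝟙_ (PMod R) ⟶ ((simplicialChains R).obj S ⊗ (simplicialChains R).obj T).X n :=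
  ∑ x ∈ Finset.HasAntidiagonal.antidiagonal n,
    tensorPoint (chainCell R (S.seg 0 x.1 s)) (chainCell R (T.seg x.1 x.2 t)) n

lemma alexanderWhitneyCell_σ {n : ℕ} (i : Fin (n + 1)) (s : S _⦋n⦌) (t : T _⦋n⦌) :
    alexanderWhitneyCell (R := R) (S.σ i s) (T.σ i t) = 0 := by
  refine Finset.sum_eq_zero (fun x hx ↦ ?_)
  obtain h | h := SSet.seg_degenerate S T (Finset.HasAntidiagonal.mem_antidiagonal.1 hx) i s t
  · rw [chainCell_eq_zero _ h, zero_tensorPoint]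
  · rw [chainCell_eq_zero _ h, tensorPoint_zero]

lemma SSet.δ_eq_map_coface (S : SSet.{u}) {n : ℕ} (i : Fin (n + 2)) (s : S _⦋n + 1⦌) :
    S.δ i s = S.map (SimplexCategory.coface i n).op s := by
  rw [SimplexCategory.coface_eq_δ]
  rfl

lemma leftFaces_add_rightFaces {a b : ℕ} (s : S _⦋a + b + 1⦌) (t : T _⦋a + b + 1⦌) :
    leftFaces (R := R) (chainCell R (T.seg (a + 1) b t)) ((a + b : ℕ) : ℤ) (S.seg 0 (a + 1) s) +
      (-1 : ℤ) ^ a • rightFaces (chainCell R (S.seg 0 a s)) ((a + b : ℕ) : ℤ) (T.seg a (b + 1) t) =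
    ∑ i : Fin (a + b + 2), (-1 : ℤ) ^ (i : ℕ) • tensorPoint (chainCell R (S.seg 0 a (S.δ i s)))
      (chainCell R (T.seg a b (T.δ i t))) ((a + b : ℕ) : ℤ) := by
  let u (i : ℕ) := tensorPoint
    (chainCell R (S.map (SimplexCategory.coface i a).op (S.seg 0 (a + 1) s)))
    (chainCell R (T.seg (a + 1) b t)) ((a + b : ℕ) : ℤ)
  let v (j : ℕ) := tensorPoint (chainCell R (S.seg 0 a s))
    (chainCell R (T.map (SimplexCategory.coface j b).op (T.seg a (b + 1) t))) ((a + b : ℕ) : ℤ)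
  let w (i : ℕ) := tensorPoint
    (chainCell R (S.seg 0 a (S.map (SimplexCategory.coface i (a + b)).op s)))
    (chainCell R (T.seg a b (T.map (SimplexCategory.coface i (a + b)).op t))) ((a + b : ℕ) : ℤ)
  refine Eq.trans (congr_arg₂ (fun x y ↦ x + (-1 : ℤ) ^ a • y) ?_ ?_)
    ((sum_alternating_eq a b u v w (fun i hi ↦ ?_) (fun j ↦ ?_) ?_).trans ?_)
  · rw [Finset.sum_range]
    exact Finset.sum_congr rfl (fun i _ ↦ by rw [SSet.δ_eq_map_coface])
  · rw [Finset.sum_range]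
    exact Finset.sum_congr rfl (fun i _ ↦ by rw [SSet.δ_eq_map_coface])
  · simp only [u, w, SSet.seg, SSet.map_map_apply, SimplexCategory.segment_coface_of_le hi,
      SimplexCategory.segment_zero_coface_of_le hi]
  · simp only [v, w, SSet.seg, SSet.map_map_apply, SimplexCategory.segment_coface_of_lt,
      SimplexCategory.segment_zero_coface_of_lt]
  · simp only [u, v, SSet.seg, SSet.map_map_apply, SimplexCategory.coface_last_segment,
      SimplexCategory.coface_zero_segment]
  · rw [Finset.sum_range]
    exact Finset.sum_congr rfl (fun i _ ↦ by rw [SSet.δ_eq_map_coface, SSet.δ_eq_map_coface])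

/-- The terms are grouped by the bidegree `(a, b)` of the result: left faces from `(a + 1, b)` and
right faces from `(a, b + 1)` combine by `leftFaces_add_rightFaces`. -/
lemma alexanderWhitneyCell_d {n : ℕ} (s : S _⦋n + 1⦌) (t : T _⦋n + 1⦌) :
    alexanderWhitneyCell (R := R) s t ≫
      ((simplicialChains R).obj S ⊗ (simplicialChains R).obj T).d ((n + 1 : ℕ) : ℤ) (n : ℤ) =
      ∑ i : Fin (n + 2), (-1 : ℤ) ^ (i : ℕ) • alexanderWhitneyCell (S.δ i s) (T.δ i t) := by
  rw [alexanderWhitneyCell, Preadditive.sum_comp]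
  refine (Finset.sum_congr rfl (fun x hx ↦ tensorPoint_chainCell_d _ _
    (by have := Finset.HasAntidiagonal.mem_antidiagonal.1 hx; lia) (by lia))).trans ?_
  -- The end terms split off here vanish, since a vertex has no faces; what remains is indexed by `a
  -- + b = n` in both sums.
  rw [Finset.sum_add_distrib, Finset.Nat.sum_antidiagonal_succ, Finset.Nat.sum_antidiagonal_succ']
  dsimp only [leftFaces, rightFaces]
  rw [zero_add, smul_zero, zero_add, ← Finset.sum_add_distrib]
  dsimp only [alexanderWhitneyCell]
  simp_rw [Finset.smul_sum]
  rw [Finset.sum_comm]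
  refine Finset.sum_congr rfl (fun x hx ↦ ?_)
  obtain ⟨a, b⟩ := x
  obtain rfl : a + b = n := Finset.HasAntidiagonal.mem_antidiagonal.1 hx
  exact (congr_arg (fun z ↦ _ + z) Finset.smul_sum.symm).trans
    (leftFaces_add_rightFaces (R := R) s t)

lemma isChainFamilyTo_alexanderWhitneyCell (S T : SSet.{u}) :
    (S ⊗ T : SSet.{u}).IsChainFamilyTo ((simplicialChains R).obj S ⊗ (simplicialChains R).obj T)
      (fun _ s ↦ alexanderWhitneyCell s.1 s.2) where
  degenerate n s hs := by
    obtain _ | n := n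
    · exact (Set.notMem_empty s (Set.ext_iff.1 (SSet.degenerate_zero (S ⊗ T)) s |>.1 hs)).elim
    · rw [SSet.degenerate_eq_iUnion_range_σ, Set.mem_iUnion] at hs
      obtain ⟨i, s, rfl⟩ := hs
      exact alexanderWhitneyCell_σ i s.1 s.2
  d_eq n s := alexanderWhitneyCell_d s.1 s.2
  zero s := by
    rw [alexanderWhitneyCell, Preadditive.sum_comp]
    refine Finset.sum_eq_zero (fun x hx ↦ (tensorPoint_chainCell_d _ _
      (by have := Finset.HasAntidiagonal.mem_antidiagonal.1 hx; lia) (by lia)).trans ?_)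
    obtain ⟨a, b⟩ := x
    obtain ⟨rfl, rfl⟩ : a = 0 ∧ b = 0 := by simpa using hx
    simp [leftFaces, rightFaces]

variable (R S T) in
/-- The Alexander-Whitney map. -/
def alexanderWhitney : (simplicialChains R).obj (S ⊗ T) ⟶
    (simplicialChains R).obj S ⊗ (simplicialChains R).obj T :=
  (exists_simplicialChains_hom _ (isChainFamilyTo_alexanderWhitneyCell S T)).choose

lemma chainCell_alexanderWhitney {n : ℕ} (s : (S ⊗ T : SSet.{u}) _⦋n⦌) :
    chainCell R s ≫ (alexanderWhitney R S T).f n = alexanderWhitneyCell s.1 s.2 :=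
  (exists_simplicialChains_hom _ (isChainFamilyTo_alexanderWhitneyCell S T)).choose_spec n s

end

end

noncomputable section

open scoped ZeroObject Simplicial

/-! ### The oplax monoidal structure on normalized chains -/

variable {C : Type u₁} [Category.{v₁} C] {R : Cᵒᵖ ⥤ CommRingCat.{u}}

section

variable {S T U : SSet.{u}}

lemma chainCell_alexanderWhitney_assoc {n : ℕ} (s : (S ⊗ T : SSet.{u}) _⦋n⦌) {M : PMod R}
    (f : ((simplicialChains R).obj S ⊗ (simplicialChains R).obj T).X n ⟶ M) :
    chainCell R s ≫ (alexanderWhitney R S T).f n ≫ f = alexanderWhitneyCell s.1 s.2 ≫ f := by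
  rw [← Category.assoc, chainCell_alexanderWhitney]

lemma alexanderWhitneyCell_whiskerRight {X : PCh R} (f : (simplicialChains R).obj S ⟶ X) {n : ℕ}
    (s : S _⦋n⦌) (t : T _⦋n⦌) :
    alexanderWhitneyCell (R := R) s t ≫ (f ▷ (simplicialChains R).obj T).f n =
      ∑ x ∈ Finset.HasAntidiagonal.antidiagonal n,
        tensorPoint (chainCell R (S.seg 0 x.1 s) ≫ f.f x.1) (chainCell R (T.seg x.1 x.2 t)) n := by
  rw [alexanderWhitneyCell, Preadditive.sum_comp]
  exact Finset.sum_congr rfl (fun x _ ↦ tensorPoint_whiskerRight _ _ _ _)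

lemma alexanderWhitneyCell_whiskerLeft {X : PCh R} (f : (simplicialChains R).obj T ⟶ X) {n : ℕ}
    (s : S _⦋n⦌) (t : T _⦋n⦌) :
    alexanderWhitneyCell (R := R) s t ≫ ((simplicialChains R).obj S ◁ f).f n =
      ∑ x ∈ Finset.HasAntidiagonal.antidiagonal n,
        tensorPoint (chainCell R (S.seg 0 x.1 s)) (chainCell R (T.seg x.1 x.2 t) ≫ f.f x.2) n := by
  rw [alexanderWhitneyCell, Preadditive.sum_comp]
  exact Finset.sum_congr rfl (fun x _ ↦ tensorPoint_whiskerLeft _ _ _ _)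

lemma alexanderWhitney_natural_left {S' : SSet.{u}} (f : S ⟶ S') (T : SSet.{u}) :
    alexanderWhitney R S T ≫ (simplicialChains R).map f ▷ (simplicialChains R).obj T =
      (simplicialChains R).map (f ▷ T) ≫ alexanderWhitney R S' T := by
  refine simplicialChains_hom_ext (fun n s ↦ ?_)
  rw [HomologicalComplex.comp_f, HomologicalComplex.comp_f, chainCell_alexanderWhitney_assoc,
    alexanderWhitneyCell_whiskerRight]
  refine Eq.trans ?_ ((reassoc_of% (chainCell_map (R := R) (f ▷ T) s)) _).symm
  refine Eq.trans ?_ (chainCell_alexanderWhitney _).symm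
  refine Finset.sum_congr rfl (fun x _ ↦ ?_)
  rw [chainCell_map, SSet.app_seg]
  rfl

lemma alexanderWhitney_natural_right (S : SSet.{u}) {T' : SSet.{u}} (g : T ⟶ T') :
    alexanderWhitney R S T ≫ (simplicialChains R).obj S ◁ (simplicialChains R).map g =
      (simplicialChains R).map (S ◁ g) ≫ alexanderWhitney R S T' := by
  refine simplicialChains_hom_ext (fun n s ↦ ?_)
  rw [HomologicalComplex.comp_f, HomologicalComplex.comp_f, chainCell_alexanderWhitney_assoc,
    alexanderWhitneyCell_whiskerLeft]
  refine Eq.trans ?_ ((reassoc_of% (chainCell_map (R := R) (S ◁ g) s)) _).symm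
  refine Eq.trans ?_ (chainCell_alexanderWhitney _).symm
  refine Finset.sum_congr rfl (fun x _ ↦ ?_)
  rw [chainCell_map, SSet.app_seg]
  rfl

/-- Both composites are the sum, over `a + b + c = n`, of the front `a`-face in `S`, the middle
`b`-face in `T` and the back `c`-face in `U`. -/
lemma alexanderWhitney_associativity (S T U : SSet.{u}) :
    alexanderWhitney R (S ⊗ T) U ≫ alexanderWhitney R S T ▷ (simplicialChains R).obj U ≫
        (α_ ((simplicialChains R).obj S) ((simplicialChains R).obj T)
          ((simplicialChains R).obj U)).hom =
      (simplicialChains R).map (α_ S T U).hom ≫ alexanderWhitney R S (T ⊗ U) ≫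
        (simplicialChains R).obj S ◁ alexanderWhitney R T U := by
  refine simplicialChains_hom_ext (fun n s ↦ ?_)
  let F (a b c : ℕ) := tensorPoint (chainCell R (S.seg 0 a s.1.1))
    (tensorPoint (chainCell R (T.seg a b s.1.2)) (chainCell R (U.seg (a + b) c s.2))
      ((b + c : ℕ) : ℤ)) (n : ℤ)
  refine Eq.trans (b := ∑ x ∈ Finset.HasAntidiagonal.antidiagonal n,
    ∑ y ∈ Finset.HasAntidiagonal.antidiagonal x.1, F y.1 y.2 x.2) ?_
    ((Finset.sum_antidiagonal_antidiagonal n F).trans ?_)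
  · refine (chainCell_alexanderWhitney_assoc _ _).trans ?_
    rw [HomologicalComplex.comp_f, ← Category.assoc, alexanderWhitneyCell_whiskerRight,
      Preadditive.sum_comp]
    refine Finset.sum_congr rfl (fun x hx ↦ ?_)
    refine (congr_arg (fun z ↦ tensorPoint z _ _ ≫ _) (chainCell_alexanderWhitney _)).trans ?_
    rw [alexanderWhitneyCell, sum_tensorPoint, Preadditive.sum_comp]
    refine Finset.sum_congr rfl (fun y hy ↦ ?_)
    rw [Finset.HasAntidiagonal.mem_antidiagonal] at hx hy
    refine (tensorPoint_associator _ _ _ (by lia) (qr := ((y.2 + x.2 : ℕ) : ℤ)) (by lia)).trans ?_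
    have h₁ : S.seg 0 y.1 (S.seg 0 x.1 s.1.1) = S.seg 0 y.1 s.1.1 := SSet.seg_seg S (by lia) _
    have h₂ : T.seg y.1 y.2 (T.seg 0 x.1 s.1.2) = T.seg y.1 y.2 s.1.2 :=
      (SSet.seg_seg T (by lia) _).trans (by rw [zero_add])
    simp only [F, ← h₁, ← h₂, hy]
    rfl
  · refine Eq.symm (((reassoc_of% (chainCell_map (R := R) (α_ S T U).hom s)) _).trans ?_)
    refine (chainCell_alexanderWhitney_assoc _ _).trans ?_
    rw [alexanderWhitneyCell_whiskerLeft]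
    refine Finset.sum_congr rfl (fun x hx ↦ ?_)
    refine (congr_arg (fun z ↦ tensorPoint _ z _) (chainCell_alexanderWhitney _)).trans ?_
    rw [alexanderWhitneyCell, tensorPoint_sum]
    refine Finset.sum_congr rfl (fun y hy ↦ ?_)
    rw [Finset.HasAntidiagonal.mem_antidiagonal] at hx hy
    have h₁ : T.seg 0 y.1 (T.seg x.1 x.2 s.1.2) = T.seg x.1 y.1 s.1.2 := SSet.seg_seg T (by lia) _
    have h₂ : U.seg y.1 y.2 (U.seg x.1 x.2 s.2) = U.seg (x.1 + y.1) y.2 s.2 :=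
      SSet.seg_seg U (by lia) _
    simp only [F, ← h₁, ← h₂]
    obtain ⟨a, _⟩ := x
    obtain rfl := hy
    rfl

/-- The family of maps defining the counit of normalized chains. -/
def chainsCounitCell (R : Cᵒᵖ ⥤ CommRingCat.{u}) (n : ℕ) : 𝟙_ (PMod R) ⟶ (𝟙_ (PCh R)).X n :=
  if h : (n : ℤ) = 0 then unitPoint R n h else 0

lemma isChainFamilyTo_chainsCounitCell :
    (𝟙_ SSet.{u}).IsChainFamilyTo (𝟙_ (PCh R)) (fun n _ ↦ chainsCounitCell R n) where
  degenerate n s hs := by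
    obtain _ | n := n
    · exact (Set.notMem_empty s (Set.ext_iff.1 (SSet.degenerate_zero _) s |>.1 hs)).elim
    · exact (isZero_unit_X _ (by lia)).eq_of_tgt _ _
  d_eq n s := by
    obtain _ | n := n
    -- In degree one the two faces of the edge take the same value with opposite signs.
    · refine Eq.trans ?_ (Fin.sum_univ_two _).symm
      rw [(isZero_unit_X (R := R) ((0 + 1 : ℕ) : ℤ) (by lia)).eq_of_src ((𝟙_ (PCh R)).d _ _) 0]
      simp
    · exact (isZero_unit_X _ (by lia)).eq_of_tgt _ _
  zero s := (isZero_unit_X _ (by lia)).eq_of_tgt _ _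

variable (R) in
/-- The counit of normalized chains. -/
def chainsCounit : (simplicialChains R).obj (𝟙_ SSet.{u}) ⟶ 𝟙_ (PCh R) :=
  (exists_simplicialChains_hom _ isChainFamilyTo_chainsCounitCell).choose

lemma chainCell_chainsCounit {n : ℕ} (s : (𝟙_ SSet.{u}) _⦋n⦌) :
    chainCell R s ≫ (chainsCounit R).f n = chainsCounitCell R n :=
  (exists_simplicialChains_hom _ isChainFamilyTo_chainsCounitCell).choose_spec n s

lemma chainsCounitCell_eq_zero {n : ℕ} (hn : n ≠ 0) : chainsCounitCell R n = 0 :=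
  dif_neg (by lia)

lemma alexanderWhitney_left_unitality (S : SSet.{u}) :
    (λ_ ((simplicialChains R).obj S)).inv =
      (simplicialChains R).map (λ_ S).inv ≫ alexanderWhitney R (𝟙_ SSet.{u}) S ≫
        chainsCounit R ▷ (simplicialChains R).obj S := by
  refine simplicialChains_hom_ext (fun n s ↦ ?_)
  refine (point_leftUnitor_inv (p := ((0 : ℕ) : ℤ)) (by lia) (chainCell R s)).trans ?_
  refine Eq.symm (((reassoc_of% (chainCell_map (R := R) (λ_ S).inv s)) _).trans ?_)
  refine (chainCell_alexanderWhitney_assoc _ _).trans ?_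
  -- The counit vanishes in positive degrees, so only the splitting with trivial front part
  -- survives.
  rw [alexanderWhitneyCell_whiskerRight, Finset.sum_eq_single (0, n)]
  · rw [chainCell_chainsCounit, SSet.seg_zero_self]
    rfl
  · intro x hx hx'
    rw [Finset.HasAntidiagonal.mem_antidiagonal] at hx
    rw [chainCell_chainsCounit, chainsCounitCell_eq_zero, zero_tensorPoint]
    rintro h
    exact hx' (Prod.ext h (by lia))
  · simp

lemma alexanderWhitney_right_unitality (S : SSet.{u}) :
    (ρ_ ((simplicialChains R).obj S)).inv =
      (simplicialChains R).map (ρ_ S).inv ≫ alexanderWhitney R S (𝟙_ SSet.{u}) ≫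
        (simplicialChains R).obj S ◁ chainsCounit R := by
  refine simplicialChains_hom_ext (fun n s ↦ ?_)
  refine (point_rightUnitor_inv (q := ((0 : ℕ) : ℤ)) (by lia) (chainCell R s)).trans ?_
  refine Eq.symm (((reassoc_of% (chainCell_map (R := R) (ρ_ S).inv s)) _).trans ?_)
  refine (chainCell_alexanderWhitney_assoc _ _).trans ?_
  rw [alexanderWhitneyCell_whiskerLeft, Finset.sum_eq_single (n, 0)]
  · rw [chainCell_chainsCounit, SSet.seg_zero_self]
    rfl
  · intro x hx hx'
    rw [Finset.HasAntidiagonal.mem_antidiagonal] at hx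
    rw [chainCell_chainsCounit, chainsCounitCell_eq_zero, tensorPoint_zero]
    rintro h
    exact hx' (Prod.ext (by lia) h)
  · simp

end

/-- The oplax monoidal structure on the normalized chains functor, given by the Alexander-Whitney
map. -/
instance : (simplicialChains R).OplaxMonoidal where
  η := chainsCounit R
  δ S T := alexanderWhitney R S T
  δ_natural_left := alexanderWhitney_natural_left
  δ_natural_right S g := alexanderWhitney_natural_right S g
  oplax_associativity := alexanderWhitney_associativity
  oplax_left_unitality := alexanderWhitney_left_unitality
  oplax_right_unitality := alexanderWhitney_right_unitality

/-- A right adjoint of an oplax monoidal functor is lax monoidal, its structure maps being the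
mates. This is what transports the enrichment to simplicial sets. -/
instance [EssentiallySmall.{u} C] : (simplicialSections R).LaxMonoidal :=
  (chainsAdjunction R).rightAdjointLaxMonoidal

end

noncomputable section

open scoped ZeroObject Simplicial

/-! ### The simplicial enrichment -/

namespace CategoryTheory

section

open Functor.LaxMonoidal

variable {V : Type u₁} [Category.{v₁} V] [MonoidalCategory V]
  {W : Type u₂} [Category.{v₂} W] [MonoidalCategory W]
  (D : Type u₃) [Category.{v₃} D] [EnrichedOrdinaryCategory V D] (F : V ⥤ W) [F.LaxMonoidal]
  (e : ∀ v : V, (𝟙_ V ⟶ v) ≃ (𝟙_ W ⟶ F.obj v)) (h : ∀ v f, e v f = ε F ≫ F.map f)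

/-- The enrichment of an ordinary category transported by a lax monoidal functor. -/
abbrev transportedEnrichment : EnrichedOrdinaryCategory W D :=
  TransportEnrichment.enrichedOrdinaryCategory D F e h

variable {D}

/-- By `h`, the transported point of `f` is the image of its point under `F`, composed with the unit
map. Naturality of the lax structure and unitality then remove both structure maps. -/
lemma transportedEnrichment_eHomWhiskerRight {X X' : D} (f : X ⟶ X') (Y : D) :
    letI := transportedEnrichment D F e h
    eHomWhiskerRight W f Y = F.map (eHomWhiskerRight V f Y) := by
  refine Eq.trans (b := (λ_ _).inv ≫ (e _ (eHomEquiv V f)) ▷ _ ≫ μ F _ _ ≫ F.map (eComp V X X' Y))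
    rfl ?_
  rw [h, comp_whiskerRight, Category.assoc, μ_natural_left_assoc, left_unitality_inv_assoc,
    ← F.map_comp, ← F.map_comp]
  rfl

lemma transportedEnrichment_eHomWhiskerLeft (X : D) {Y Y' : D} (g : Y ⟶ Y') :
    letI := transportedEnrichment D F e h
    eHomWhiskerLeft W X g = F.map (eHomWhiskerLeft V X g) := by
  refine Eq.trans (b := (ρ_ _).inv ≫ _ ◁ (e _ (eHomEquiv V g)) ≫ μ F _ _ ≫ F.map (eComp V X Y Y'))
    rfl ?_
  rw [h, MonoidalCategory.whiskerLeft_comp, Category.assoc, μ_natural_right_assoc,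
    right_unitality_inv_assoc, ← F.map_comp, ← F.map_comp]
  rfl

end

end CategoryTheory

variable {C : Type u₁} [Category.{v₁} C] {R : Cᵒᵖ ⥤ CommRingCat.{u}}

/-- The vertex of the simplicial set with one simplex in each degree. -/
def unitVertex : (𝟙_ SSet.{u}) _⦋0⦌ := PUnit.unit

variable (R) in
/-- The inverse of the counit of normalized chains. -/
def chainsCounitInv : 𝟙_ (PCh R) ⟶ (simplicialChains R).obj (𝟙_ SSet.{u}) :=
  HomologicalComplex.mkHomFromSingle (chainCell R unitVertex)
    (fun k hk ↦ (isZero_chains_X R _ k (by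
      have : k + 1 = ((0 : ℕ) : ℤ) := hk
      lia)).eq_of_tgt _ _)

lemma unitPoint_chainsCounitInv :
    unitPoint R ((0 : ℕ) : ℤ) rfl ≫ (chainsCounitInv R).f ((0 : ℕ) : ℤ) =
      chainCell R unitVertex := by
  refine (congr_arg (fun g ↦ unitPoint R ((0 : ℕ) : ℤ) rfl ≫ g)
    (HomologicalComplex.mkHomFromSingle_f _ _)).trans ?_
  exact Iso.inv_hom_id_assoc _ _

lemma chainsCounitCell_zero : chainsCounitCell R 0 = unitPoint R ((0 : ℕ) : ℤ) rfl := dif_pos rfl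

/-- The point has one simplex in each degree, degenerate in positive degrees, so its normalized
chains are the unit. Hence points of `D τ Γ X` are chain maps from the unit to `X`, and the
transported enrichment has the same underlying category. -/
instance : IsIso (chainsCounit R) := by
  refine ⟨chainsCounitInv R, simplicialChains_hom_ext (fun n s ↦ ?_), ?_⟩
  · rw [HomologicalComplex.comp_f, ← Category.assoc, chainCell_chainsCounit,
      HomologicalComplex.id_f, Category.comp_id]
    obtain _ | n := n
    · rw [chainsCounitCell_zero]
      exact unitPoint_chainsCounitInv
    · rw [chainsCounitCell_eq_zero (by lia), zero_comp, chainCell_eq_zero]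
      rw [SSet.degenerate_eq_iUnion_range_σ, Set.mem_iUnion]
      exact ⟨0, PUnit.unit, rfl⟩
  · refine HomologicalComplex.from_single_hom_ext ?_
    have : IsIso (unitPoint R ((0 : ℕ) : ℤ) rfl) := by unfold unitPoint; infer_instance
    refine (cancel_epi (unitPoint R ((0 : ℕ) : ℤ) rfl)).1 ?_
    refine (((reassoc_of% (unitPoint_chainsCounitInv (R := R)))
      ((chainsCounit R).f ((0 : ℕ) : ℤ))).trans ?_).trans (Category.comp_id _).symm
    rw [chainCell_chainsCounit, chainsCounitCell_zero]

variable [EssentiallySmall.{u} C]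

open Functor.LaxMonoidal Functor.OplaxMonoidal

lemma simplicialSections_ε : ε (simplicialSections R) =
    (chainsAdjunction R).homEquiv _ _ (chainsCounit R) := rfl

/-- The bijection between morphisms of complexes from the unit and points of the simplicial
sections. -/
def sectionsUnitEquiv (X : PCh R) :
    (𝟙_ (PCh R) ⟶ X) ≃ (𝟙_ SSet.{u} ⟶ (simplicialSections R).obj X) :=
  ((asIso (chainsCounit R)).homFromEquiv (Z := X)).symm.trans
    ((chainsAdjunction R).homEquiv _ _)

lemma sectionsUnitEquiv_apply (X : PCh R) (f : 𝟙_ (PCh R) ⟶ X) :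
    sectionsUnitEquiv X f = ε (simplicialSections R) ≫ (simplicialSections R).map f := by
  rw [simplicialSections_ε, ← Adjunction.homEquiv_naturality_right]
  rfl

open scoped MonoidalClosed

variable (R) in
/-- The simplicial enrichment of the category of complexes. -/
abbrev simplicialEnrichment : EnrichedOrdinaryCategory SSet.{u} (PCh R) :=
  transportedEnrichment (PCh R) (simplicialSections R) sectionsUnitEquiv sectionsUnitEquiv_apply

lemma simplicialEnrichment_eHomWhiskerRight {X X' : PCh R} (f : X ⟶ X') (Y : PCh R) :
    letI := simplicialEnrichment R
    eHomWhiskerRight SSet.{u} f Y = (simplicialSections R).map ((MonoidalClosed.pre f).app Y) :=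
  (transportedEnrichment_eHomWhiskerRight _ _ _ f Y).trans (congr_arg _
    (MonoidalClosed.enrichedOrdinaryCategorySelf_eHomWhiskerRight _ f Y))

lemma simplicialEnrichment_eHomWhiskerLeft (X : PCh R) {Y Y' : PCh R} (g : Y ⟶ Y') :
    letI := simplicialEnrichment R
    eHomWhiskerLeft SSet.{u} X g = (simplicialSections R).map ((ihom X).map g) :=
  (transportedEnrichment_eHomWhiskerLeft _ _ _ X g).trans (congr_arg _
    (MonoidalClosed.enrichedOrdinaryCategorySelf_eHomWhiskerLeft _ X g))

variable (R) in
/-- The enriched hom functor identifies to the mapping space functor. -/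
def eHomFunctorIso :
    letI := simplicialEnrichment R
    eHomFunctor SSet.{u} (PCh R) ≅ mappingSpace R :=
  letI := simplicialEnrichment R
  NatIso.ofComponents (fun X ↦ NatIso.ofComponents (fun Y ↦ Iso.refl _) (fun {Y Y'} g ↦ by
      refine (Category.comp_id _).trans (Eq.trans ?_ (Category.id_comp _).symm)
      exact simplicialEnrichment_eHomWhiskerLeft X.unop g))
    (fun {X X'} f ↦ by
      ext Y : 2
      refine (Category.comp_id _).trans (Eq.trans ?_ (Category.id_comp _).symm)
      exact simplicialEnrichment_eHomWhiskerRight f.unop Y)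

end

noncomputable section

open scoped ZeroObject Simplicial

/-! ### The symmetry of the tensor product of complexes -/

variable {C : Type u₁} [Category.{v₁} C] {R : Cᵒᵖ ⥤ CommRingCat.{u}}

/-- The symmetry of the tensor product in a given degree. -/
def tensorSwapX (X Y : PCh R) (n : ℤ) : (X ⊗ Y).X n ⟶ (Y ⊗ X).X n :=
  tensorDesc (fun p q h ↦ (p * q).negOnePow • ((β_ (X.X p) (Y.X q)).hom ≫
    tensorι Y X q p n (by lia)))

lemma tensorι_swapX (X Y : PCh R) (p q n : ℤ) (h : p + q = n) :
    tensorι X Y p q n h ≫ tensorSwapX X Y n =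
      (p * q).negOnePow • ((β_ (X.X p) (Y.X q)).hom ≫ tensorι Y X q p n (by lia)) :=
  tensorι_desc _ _ _ _

/-- The symmetry of the tensor product, with the Koszul sign. -/
def tensorSwap (X Y : PCh R) : X ⊗ Y ⟶ Y ⊗ X where
  f n := tensorSwapX X Y n
  comm' n n' hn := tensorι_hom_ext (fun p q h ↦ by
    have hn : n' + 1 = n := hn
    have hp : p - 1 + 1 = p := by lia
    have hq : q - 1 + 1 = q := by lia
    refine ((reassoc_of% (tensorι_swapX X Y p q n h)) ((Y ⊗ X).d n n')).trans (Eq.trans ?_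
      ((reassoc_of% (tensorι_d X Y h hp hq hn)) (tensorSwapX X Y n')).symm)
    rw [Linear.units_smul_comp, Category.assoc, tensorι_d Y X (by lia) hq hp hn,
      Preadditive.comp_add, Preadditive.add_comp, Category.assoc, tensorι_swapX,
      Linear.units_smul_comp, Category.assoc, tensorι_swapX, Linear.comp_units_smul,
      Linear.comp_units_smul, Linear.comp_units_smul, smul_add, smul_smul, smul_smul, add_comm,
      BraidedCategory.braiding_naturality_left_assoc,
      BraidedCategory.braiding_naturality_right_assoc, ← Int.negOnePow_add, ← Int.negOnePow_add]
    -- For the term with the differential of `X`, the signs `pq + q` and `(p - 1)q` differ by `2q`;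
    -- for that of `Y`, `p + p(q - 1)` equals `pq`.
    congr 2
    · rw [Int.negOnePow_eq_iff]
      exact ⟨q, by ring⟩
    · congr 1
      ring)

lemma tensorι_swap (X Y : PCh R) (p q n : ℤ) (h : p + q = n) :
    tensorι X Y p q n h ≫ (tensorSwap X Y).f n =
      (p * q).negOnePow • ((β_ (X.X p) (Y.X q)).hom ≫ tensorι Y X q p n (by lia)) :=
  tensorι_swapX X Y p q n h

lemma tensorSwap_tensorSwap (X Y : PCh R) : tensorSwap X Y ≫ tensorSwap Y X = 𝟙 _ := by
  ext n : 1
  refine tensorι_hom_ext (fun p q h ↦ ?_)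
  refine ((reassoc_of% (tensorι_swap X Y p q n h)) ((tensorSwap Y X).f n)).trans ?_
  rw [Linear.units_smul_comp, Category.assoc, tensorι_swap, Linear.comp_units_smul, smul_smul,
    mul_comm q p, Int.units_mul_self, one_smul, SymmetricCategory.symmetry_assoc]
  exact (Category.comp_id _).symm

/-- The symmetry isomorphism of the tensor product. -/
def tensorSwapIso (X Y : PCh R) : X ⊗ Y ≅ Y ⊗ X where
  hom := tensorSwap X Y
  inv := tensorSwap Y X
  hom_inv_id := tensorSwap_tensorSwap X Y
  inv_hom_id := tensorSwap_tensorSwap Y X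

lemma tensorSwap_naturality_left {X X' : PCh R} (f : X ⟶ X') (Y : PCh R) :
    f ▷ Y ≫ tensorSwap X' Y = tensorSwap X Y ≫ Y ◁ f := by
  ext n : 1
  refine tensorι_hom_ext (fun p q h ↦ ?_)
  refine ((reassoc_of% (tensorι_whiskerRight f Y p q n h)) ((tensorSwap X' Y).f n)).trans
    (Eq.trans ?_ ((reassoc_of% (tensorι_swap X Y p q n h)) ((Y ◁ f).f n)).symm)
  rw [tensorι_swap, Linear.units_smul_comp, Linear.comp_units_smul, Category.assoc,
    tensorι_whiskerLeft, BraidedCategory.braiding_naturality_left_assoc]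

lemma tensorSwap_naturality_right (X : PCh R) {Y Y' : PCh R} (g : Y ⟶ Y') :
    X ◁ g ≫ tensorSwap X Y' = tensorSwap X Y ≫ g ▷ X := by
  ext n : 1
  refine tensorι_hom_ext (fun p q h ↦ ?_)
  refine ((reassoc_of% (tensorι_whiskerLeft X g p q n h)) ((tensorSwap X Y').f n)).trans
    (Eq.trans ?_ ((reassoc_of% (tensorι_swap X Y p q n h)) ((g ▷ X).f n)).symm)
  rw [tensorι_swap, Linear.units_smul_comp, Linear.comp_units_smul, Category.assoc,
    tensorι_whiskerRight, BraidedCategory.braiding_naturality_right_assoc]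

/-- The natural isomorphism `A ⊗ (X ⊗ Z) ≅ (X ⊗ A) ⊗ Z`. -/
def tensorMiddleIso (X A Z : PCh R) : A ⊗ (X ⊗ Z) ≅ (X ⊗ A) ⊗ Z :=
  (α_ A X Z).symm ≪≫ whiskerRightIso (tensorSwapIso A X) Z

lemma tensorMiddleIso_hom (X A Z : PCh R) :
    (tensorMiddleIso X A Z).hom = (α_ A X Z).inv ≫ tensorSwap A X ▷ Z := rfl

lemma tensorMiddleIso_naturality_right (X A : PCh R) {Z Z' : PCh R} (h : Z ⟶ Z') :
    A ◁ X ◁ h ≫ (tensorMiddleIso X A Z').hom = (tensorMiddleIso X A Z).hom ≫ (X ⊗ A) ◁ h := by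
  rw [tensorMiddleIso_hom, tensorMiddleIso_hom, associator_inv_naturality_right_assoc, Category.assoc, whisker_exchange]

lemma tensorMiddleIso_naturality_left {X X' : PCh R} (f : X ⟶ X') (A Z : PCh R) :
    A ◁ f ▷ Z ≫ (tensorMiddleIso X' A Z).hom = (tensorMiddleIso X A Z).hom ≫ (f ▷ A) ▷ Z := by
  rw [tensorMiddleIso_hom, tensorMiddleIso_hom, associator_inv_naturality_middle_assoc, Category.assoc, ← comp_whiskerRight,
    ← comp_whiskerRight, tensorSwap_naturality_right]

lemma tensorMiddleIso_naturality_middle (X : PCh R) {A A' : PCh R} (g : A ⟶ A') (Z : PCh R) :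
    g ▷ (X ⊗ Z) ≫ (tensorMiddleIso X A' Z).hom = (tensorMiddleIso X A Z).hom ≫ (X ◁ g) ▷ Z := by
  rw [tensorMiddleIso_hom, tensorMiddleIso_hom, associator_inv_naturality_left_assoc, Category.assoc, ← comp_whiskerRight,
    ← comp_whiskerRight, tensorSwap_naturality_left]

variable [EssentiallySmall.{u} C]

open MonoidalClosed

/-- The canonical map from the inner hom out of a tensor product to the iterated inner hom. -/
def ihomTensorHom (X A Y : PCh R) :
    (ihom (X ⊗ A)).obj Y ⟶ (ihom X).obj ((ihom A).obj Y) :=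
  curry (curry ((tensorMiddleIso X A _).hom ≫ (ihom.ev (X ⊗ A)).app Y))

/-- As `ihom A` is right adjoint to `A ⊗ -`, the double transpose has source `A ⊗ (X ⊗ Z)` and not
`(X ⊗ A) ⊗ Z`, so the symmetry is needed. This formula reduces invertibility and all naturalities to
those of `tensorMiddleIso`. -/
lemma uncurry_uncurry_comp_ihomTensorHom {X A Y Z : PCh R} (f : Z ⟶ (ihom (X ⊗ A)).obj Y) :
    uncurry (uncurry (f ≫ ihomTensorHom X A Y)) = (tensorMiddleIso X A Z).hom ≫ uncurry f := by
  rw [ihomTensorHom, ← curry_natural_left, ← curry_natural_left, uncurry_curry, uncurry_curry,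
    ← Category.assoc, tensorMiddleIso_naturality_right, Category.assoc, uncurry_eq]

/-- The isomorphism between the inner hom out of a tensor product and the iterated inner hom. -/
def ihomTensorIso (X A Y : PCh R) :
    (ihom (X ⊗ A)).obj Y ≅ (ihom X).obj ((ihom A).obj Y) where
  hom := ihomTensorHom X A Y
  inv := curry ((tensorMiddleIso X A _).inv ≫ uncurry (uncurry (𝟙 _)))
  hom_inv_id := by
    apply uncurry_injective
    rw [uncurry_natural_left, uncurry_curry, ← cancel_epi (tensorMiddleIso X A _).hom,
      ← Category.assoc, ← tensorMiddleIso_naturality_right, Category.assoc, Iso.hom_inv_id_assoc,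
      ← uncurry_natural_left, ← uncurry_natural_left, Category.comp_id,
      ← uncurry_uncurry_comp_ihomTensorHom, Category.id_comp]
  inv_hom_id := by
    apply uncurry_injective
    apply uncurry_injective
    rw [uncurry_uncurry_comp_ihomTensorHom, uncurry_curry, Iso.hom_inv_id_assoc]

lemma ihomTensorHom_naturality_right (X A : PCh R) {Y Y' : PCh R} (h : Y ⟶ Y') :
    (ihom (X ⊗ A)).map h ≫ ihomTensorHom X A Y' =
      ihomTensorHom X A Y ≫ (ihom X).map ((ihom A).map h) := by
  apply uncurry_injective
  apply uncurry_injective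
  rw [uncurry_uncurry_comp_ihomTensorHom, uncurry_natural_right, uncurry_natural_right,
    ← Category.id_comp (ihomTensorHom X A Y), uncurry_uncurry_comp_ihomTensorHom,
    ← Category.id_comp ((ihom (X ⊗ A)).map h), uncurry_natural_right, Category.assoc]

lemma ihomTensorHom_naturality_left {X X' : PCh R} (f : X ⟶ X') (A Y : PCh R) :
    (pre (f ▷ A)).app Y ≫ ihomTensorHom X A Y =
      ihomTensorHom X' A Y ≫ (pre f).app ((ihom A).obj Y) := by
  apply uncurry_injective
  apply uncurry_injective
  rw [uncurry_uncurry_comp_ihomTensorHom, uncurry_pre_app, uncurry_natural_left,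
    ← Category.id_comp (ihomTensorHom X' A Y), uncurry_uncurry_comp_ihomTensorHom,
    ← Category.id_comp ((pre (f ▷ A)).app Y), uncurry_pre_app, ← Category.assoc,
    ← Category.assoc, tensorMiddleIso_naturality_left]

lemma ihomTensorHom_naturality_middle (X : PCh R) {A A' : PCh R} (g : A ⟶ A') (Y : PCh R) :
    (pre (X ◁ g)).app Y ≫ ihomTensorHom X A Y =
      ihomTensorHom X A' Y ≫ (ihom X).map ((pre g).app Y) := by
  apply uncurry_injective
  apply uncurry_injective
  rw [uncurry_uncurry_comp_ihomTensorHom, uncurry_natural_right, uncurry_pre_app,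
    ← Category.id_comp (ihomTensorHom X A' Y), uncurry_uncurry_comp_ihomTensorHom,
    ← Category.id_comp ((pre (X ◁ g)).app Y), uncurry_pre_app, ← Category.assoc,
    ← Category.assoc, tensorMiddleIso_naturality_middle]

/-! ### The simplicial tensor -/

/-- The bijection between maps from the tensor `X ⊗ C(S)` and maps from `S` to the mapping
space. -/
def homMapEquiv (X : PCh R) (S : SSet.{u}) (Y : PCh R) :
    (S ⟶ (simplicialSections R).obj ((ihom X).obj Y)) ≃ (X ⊗ (simplicialChains R).obj S ⟶ Y) :=
  ((chainsAdjunction R).homEquiv S _).symm.trans ((ihom.adjunction X).homEquiv _ Y).symm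

lemma homMapEquiv_apply {X : PCh R} {S : SSet.{u}} {Y : PCh R}
    (a : S ⟶ (simplicialSections R).obj ((ihom X).obj Y)) :
    homMapEquiv X S Y a = uncurry (((chainsAdjunction R).homEquiv S _).symm a) := rfl

lemma homMapEquiv_pre {X X' : PCh R} (f : X ⟶ X') (S : SSet.{u}) (Y : PCh R)
    (a : S ⟶ (simplicialSections R).obj ((ihom X').obj Y)) :
    homMapEquiv X S Y (a ≫ (simplicialSections R).map ((pre f).app Y)) =
      f ▷ (simplicialChains R).obj S ≫ homMapEquiv X' S Y a := by
  rw [homMapEquiv_apply, homMapEquiv_apply, Adjunction.homEquiv_naturality_right_symm,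
    uncurry_pre_app]

lemma homMapEquiv_comp (X : PCh R) {S S' : SSet.{u}} (g : S ⟶ S') (Y : PCh R)
    (a : S' ⟶ (simplicialSections R).obj ((ihom X).obj Y)) :
    homMapEquiv X S Y (g ≫ a) = X ◁ (simplicialChains R).map g ≫ homMapEquiv X S' Y a := by
  rw [homMapEquiv_apply, homMapEquiv_apply, Adjunction.homEquiv_naturality_left_symm,
    uncurry_natural_left]

lemma homMapEquiv_map (X : PCh R) (S : SSet.{u}) {Y Y' : PCh R} (h : Y ⟶ Y')
    (a : S ⟶ (simplicialSections R).obj ((ihom X).obj Y)) :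
    homMapEquiv X S Y' (a ≫ (simplicialSections R).map ((ihom X).map h)) =
      homMapEquiv X S Y a ≫ h := by
  rw [homMapEquiv_apply, homMapEquiv_apply, Adjunction.homEquiv_naturality_right_symm,
    uncurry_natural_right]

end

noncomputable section

open scoped ZeroObject Simplicial

/-! ### Trivial fibrations of simplicial sets are weak equivalences -/

namespace SSet

open MonoidalClosed

variable {E B : SSet.{u}}

/-- The subcomplex of `E ⊗ Δ[1]` given by both ends of the cylinder. -/
def cylinderEnds (E : SSet.{u}) : (E ⊗ Δ[1] : SSet.{u}).Subcomplex :=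
  Subcomplex.range (ι₀ (X := E)) ⊔ Subcomplex.range (ι₁ (X := E))

/-- The two ends are disjoint, because the coordinate in `Δ[1]` is constantly `0` on one and `1` on
the other. Hence a map out of both ends is just a pair of maps. -/
lemma bicartSq_cylinderEnds (E : SSet.{u}) :
    Subcomplex.BicartSq ⊥ (Subcomplex.range (ι₀ (X := E))) (Subcomplex.range (ι₁ (X := E)))
      (cylinderEnds E) where
  sup_eq := rfl
  inf_eq := by
    refine le_bot_iff.1 (fun n x hx ↦ ?_)
    induction n using Opposite.rec with | op n => ?_
    induction n using SimplexCategory.rec with | mk n => ?_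
    obtain ⟨⟨y, rfl⟩, ⟨z, hz⟩⟩ := hx
    have h := congr_arg (fun t : (E ⊗ Δ[1] : SSet.{u}) _⦋n⦌ ↦ t.2 0) hz
    exact (zero_ne_one (α := Fin 2) h.symm).elim

/-- The identity of `E` and `p ≫ s` have the same composite with `p`, so the constant homotopy
downstairs lifts relative to the two ends of the cylinder. -/
lemma exists_homotopy_of_rlp {p : E ⟶ B} (hp : (MorphismProperty.monomorphisms SSet.{u}).rlp p)
    {s : B ⟶ E} (hs : s ≫ p = 𝟙 B) :
    ∃ H : E ⊗ Δ[1] ⟶ E, ι₀ ≫ H = 𝟙 E ∧ ι₁ ≫ H = p ≫ s := by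
  have sq := (bicartSq_cylinderEnds E).isPushout
  let φ : (cylinderEnds E : SSet.{u}) ⟶ E := sq.desc
    ((Subcomplex.range ι₀).ι ≫ CartesianMonoidalCategory.fst E Δ[1])
    ((Subcomplex.range ι₁).ι ≫ CartesianMonoidalCategory.fst E Δ[1] ≫ p ≫ s)
    (Subcomplex.isInitialBot.hom_ext _ _)
  have w : CommSq φ (cylinderEnds E).ι p (CartesianMonoidalCategory.fst E Δ[1] ≫ p) := ⟨by
    apply sq.hom_ext
    · rw [sq.inl_desc_assoc]
      rfl
    · rw [sq.inr_desc_assoc, Category.assoc, Category.assoc, Category.assoc, hs, Category.comp_id]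
      rfl⟩
  have := hp (cylinderEnds E).ι (inferInstanceAs (Mono _))
  refine ⟨w.lift, ?_, ?_⟩
  · exact (congr_arg (fun g ↦ Subcomplex.toRange (ι₀ (X := E)) ≫ Subcomplex.homOfLE le_sup_left ≫ g)
      w.fac_left).trans (Subcomplex.toRange ι₀ ≫= sq.inl_desc _ _ _)
  · exact (congr_arg (fun g ↦ Subcomplex.toRange (ι₁ (X := E)) ≫ Subcomplex.homOfLE le_sup_right ≫ g)
      w.fac_left).trans (Subcomplex.toRange ι₁ ≫= sq.inr_desc _ _ _)

lemma π₀_mk_eq_of_stdSimplex (W : SSet.{u}) (g : Δ[1] ⟶ W) :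
    π₀.mk (g.app _ (stdSimplex.obj₀Equiv.symm 0)) =
      π₀.mk (g.app _ (stdSimplex.obj₀Equiv.symm 1)) := by
  have h : π₀.mk (stdSimplex.obj₀Equiv.{u}.symm (0 : Fin 2)) =
      π₀.mk (stdSimplex.obj₀Equiv.symm 1) := by
    refine Eq.trans (congr_arg _ ?_) ((π₀.sound (Edge.mk' (topSimplex.{u} 1))).trans
      (congr_arg _ ?_))
    · ext i
      fin_cases i
      rfl
    · ext i
      fin_cases i
      rfl
  exact congr_arg (mapπ₀ g) h

lemma curry'_pre {X X' Z : SSet.{u}} (f : X ⟶ X') (φ : X' ⟶ Z) :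
    curry' φ ≫ (pre f).app Z = curry' (f ≫ φ) := by
  rw [curry', curry', curry_pre_app, rightUnitor_naturality_assoc]

/-- A homotopy curries to an edge of the function complex, which joins the two vertices. -/
lemma π₀_mk_curry'_eq {X Z : SSet.{u}} (H : X ⊗ Δ[1] ⟶ Z) :
    π₀.mk (unitHomEquiv _ (curry' (ι₀ ≫ H))) = π₀.mk (unitHomEquiv _ (curry' (ι₁ ≫ H))) := by
  have h₀ : curry' (ι₀ ≫ H) = (const (stdSimplex.obj₀Equiv.{u}.symm 0) : 𝟙_ SSet.{u} ⟶ Δ[1]) ≫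
      curry H := by
    rw [curry', ← curry_natural_left]
    rfl
  have h₁ : curry' (ι₁ ≫ H) = (const (stdSimplex.obj₀Equiv.{u}.symm 1) : 𝟙_ SSet.{u} ⟶ Δ[1]) ≫
      curry H := by
    rw [curry', ← curry_natural_left]
    rfl
  rw [h₀, h₁]
  refine Eq.trans (congr_arg (fun t ↦ π₀.mk ((curry H).app _ t)) ?_)
    ((π₀_mk_eq_of_stdSimplex _ (curry H)).trans
      (congr_arg (fun t ↦ π₀.mk ((curry H).app _ t)) ?_))
  · ext i
    rfl
  · ext i
    rfl

/-- Lifting the identity of `B` against `∅ ⟶ B` gives a section `s`. Restriction along `s` inverts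
restriction along `p` on `π₀`: `s ≫ p` is the identity, and `p ≫ s` is homotopic to it. -/
lemma isWeakHomotopyEquivalence_of_rlp_monomorphisms {p : E ⟶ B}
    (hp : (MorphismProperty.monomorphisms SSet.{u}).rlp p) : IsWeakHomotopyEquivalence p := by
  intro Z _
  have w : CommSq (Subcomplex.isInitialBot.to E) (⊥ : B.Subcomplex).ι p (𝟙 B) :=
    ⟨Subcomplex.isInitialBot.hom_ext _ _⟩
  have := hp (⊥ : B.Subcomplex).ι (inferInstanceAs (Mono _))
  let s := w.lift
  have hs : s ≫ p = 𝟙 B := w.fac_right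
  obtain ⟨H, h₀, h₁⟩ := exists_homotopy_of_rlp hp hs
  refine ⟨Function.LeftInverse.injective (g := mapπ₀ ((pre s).app Z)) (fun x ↦ ?_),
    Function.RightInverse.surjective (g := mapπ₀ ((pre s).app Z)) (fun x ↦ ?_)⟩
  · rw [← mapπ₀_comp_apply, ← NatTrans.comp_app, ← pre_map, hs, pre_id, NatTrans.id_app,
      mapπ₀_id_apply]
  · induction x with | mk x => ?_
    obtain ⟨y, rfl⟩ := (unitHomEquiv _).surjective x
    obtain ⟨φ, rfl⟩ : ∃ φ, curry' φ = y := ⟨uncurry' y, curry'_uncurry' y⟩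
    rw [← mapπ₀_comp_apply, ← NatTrans.comp_app, ← pre_map, mapπ₀_mk]
    have h := π₀_mk_curry'_eq (H ≫ φ)
    rw [← Category.assoc, ← Category.assoc, h₀, h₁, Category.id_comp] at h
    refine Eq.trans ?_ h.symm
    exact congr_arg (fun z ↦ π₀.mk (unitHomEquiv _ z)) (curry'_pre (p ≫ s) φ)

end SSet

end

noncomputable section

open scoped ZeroObject Simplicial

/-! ### The pushout-product property of the mapping spaces -/

variable {C : Type u₁} [Category.{v₁} C] [EssentiallySmall.{u} C] {R : Cᵒᵖ ⥤ CommRingCat.{u}}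

open ChainComplexLifting

instance : EnoughProjectives (PMod R) where
  presentation M := by
    obtain ⟨ι, c, p, hp⟩ := exists_epi_sigma_freeR R M
    have (j : ι) : Projective (freeR R ((equivSmallModel C).inverse.obj (c j))) :=
      projective_freeR R _
    have h : Projective (∐ fun j ↦ freeR R ((equivSmallModel C).inverse.obj (c j))) := by
      refine ⟨fun f e _ ↦ ⟨Sigma.desc fun j ↦ Projective.factorThru (Sigma.ι
        (fun j ↦ freeR R ((equivSmallModel C).inverse.obj (c j))) j ≫ f) e, ?_⟩⟩
      refine Sigma.hom_ext _ _ (fun j ↦ ?_)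
      rw [Sigma.ι_desc_assoc, Projective.factorThru_comp]
    exact ⟨{ p := _, projective := h, f := p }⟩

section

variable {A B X Y : PCh R} {i : A ⟶ B} {f : X ⟶ Y}

variable (i f) in
/-- The map from the mapping space of `B` and `X` to the space of commutative squares. -/
abbrev mappingSpacePullbackHom (w : (simplicialSections R).map ((MonoidalClosed.pre i).app X) ≫
      (simplicialSections R).map ((ihom A).map f) =
    (simplicialSections R).map ((ihom B).map f) ≫
      (simplicialSections R).map ((MonoidalClosed.pre i).app Y)) :
    (simplicialSections R).obj ((ihom B).obj X) ⟶
      pullback ((simplicialSections R).map ((ihom A).map f))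
        ((simplicialSections R).map ((MonoidalClosed.pre i).app Y)) :=
  pullback.lift _ _ w

/-- `homMapEquiv` turns a square into compatible maps out of tensor products with chains of `T` and
`U`, and `gradedCell` turns these into families `a`, `b`, `c` of graded maps; the lift translates
back in the same way. -/
lemma hasLiftingProperty_mappingSpacePullbackHom {T : SSet.{u}} (U : T.Subcomplex)
    (hU : ∀ ⦃a : ∀ m : ℕ, T _⦋m⦌ → GradedHom A X (m : ℤ)⦄
      ⦃c : ∀ m : ℕ, T _⦋m⦌ → GradedHom B Y (m : ℤ)⦄
      ⦃b : ∀ m : ℕ, (U : SSet.{u}) _⦋m⦌ → GradedHom B X (m : ℤ)⦄,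
      SSet.FamilyLiftingProblem i f U a c b →
      ∃ x : ∀ m : ℕ, T _⦋m⦌ → GradedHom B X (m : ℤ), T.IsChainFamilyGraded B X x ∧
        (∀ m (t : (U : SSet.{u}) _⦋m⦌), x m t.1 = b m t) ∧
        (∀ m t, (x m t).pre i = a m t) ∧ (∀ m t, (x m t).post f = c m t))
    (w : (simplicialSections R).map ((MonoidalClosed.pre i).app X) ≫
      (simplicialSections R).map ((ihom A).map f) =
    (simplicialSections R).map ((ihom B).map f) ≫
      (simplicialSections R).map ((MonoidalClosed.pre i).app Y)) :
    HasLiftingProperty U.ι (mappingSpacePullbackHom i f w) where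
  sq_hasLift {g h} sq := by
    have h₁ : g ≫ (simplicialSections R).map ((MonoidalClosed.pre i).app X) =
        U.ι ≫ h ≫ pullback.fst _ _ := by
      rw [← reassoc_of% sq.w, pullback.lift_fst]
    have h₂ : g ≫ (simplicialSections R).map ((ihom B).map f) =
        U.ι ≫ h ≫ pullback.snd _ _ := by
      rw [← reassoc_of% sq.w, pullback.lift_snd]
    have h₃ : (h ≫ pullback.fst _ _) ≫ (simplicialSections R).map ((ihom A).map f) =
        (h ≫ pullback.snd _ _) ≫ (simplicialSections R).map ((MonoidalClosed.pre i).app Y) := by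
      rw [Category.assoc, Category.assoc, pullback.condition]
    obtain ⟨x, hx, hb, ha, hc⟩ := hU (a := fun _ t ↦ gradedCell (homMapEquiv A T X
      (h ≫ pullback.fst _ _)) t) (c := fun _ t ↦ gradedCell (homMapEquiv B T Y
      (h ≫ pullback.snd _ _)) t) (b := fun _ t ↦ gradedCell (homMapEquiv B _ X g) t)
      { isChainFamily_a := isChainFamilyGraded_gradedCell _
        isChainFamily_c := isChainFamilyGraded_gradedCell _
        isChainFamily_b := isChainFamilyGraded_gradedCell _
        w m t := by
          rw [← gradedCell_comp, ← homMapEquiv_map, h₃, homMapEquiv_pre, gradedCell_whiskerRight]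
        pre_b m t := by
          rw [← gradedCell_whiskerRight, ← homMapEquiv_pre, h₁, homMapEquiv_comp,
            gradedCell_whiskerLeft]
          rfl
        post_b m t := by
          rw [← gradedCell_comp, ← homMapEquiv_map, h₂, homMapEquiv_comp,
            gradedCell_whiskerLeft]
          rfl }
    obtain ⟨φ, hφ⟩ := exists_gradedCell_eq x hx
    refine ⟨⟨{ l := (homMapEquiv B T X).symm φ, fac_left := ?_, fac_right := ?_ }⟩⟩
    · apply (homMapEquiv B _ X).injective
      rw [homMapEquiv_comp, Equiv.apply_symm_apply]
      refine hom_ext_of_gradedCell (fun m s ↦ ?_)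
      rw [gradedCell_whiskerLeft, hφ]
      exact hb m s
    · apply pullback.hom_ext
      · rw [Category.assoc, pullback.lift_fst]
        apply (homMapEquiv A _ X).injective
        rw [homMapEquiv_pre, Equiv.apply_symm_apply]
        refine hom_ext_of_gradedCell (fun m s ↦ ?_)
        rw [gradedCell_whiskerRight, hφ, ha]
      · rw [Category.assoc, pullback.lift_snd]
        apply (homMapEquiv B _ Y).injective
        rw [homMapEquiv_map, Equiv.apply_symm_apply]
        refine hom_ext_of_gradedCell (fun m s ↦ ?_)
        rw [gradedCell_comp, hφ, hc]

lemma hasLiftingProperty_of_projectiveCofibrations (hi : projectiveCofibrations R i) ⦃X Y : PCh R⦄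
    (p : X ⟶ Y) (hp : ∀ n, Epi (p.f n)) (hp' : QuasiIso p) : HasLiftingProperty i p :=
  hi _ (by
    rw [smallGenCofibrations_rlp]
    exact ⟨hp, hp'⟩)

lemma isKanFibration_mappingSpacePullbackHom (hi : projectiveCofibrations R i)
    (hf : degreewiseEpi R f) (w) : SSet.IsKanFibration (mappingSpacePullbackHom i f w) := by
  intro _ _ j hj
  simp only [SSet.modelCategoryQuillen.J, MorphismProperty.iSup_iff] at hj
  obtain ⟨n, ⟨k⟩⟩ := hj
  exact hasLiftingProperty_mappingSpacePullbackHom _ (fun _ _ _ P ↦ SSet.exists_lift_horn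
    (hasLiftingProperty_of_projectiveCofibrations hi) hf k P) w

lemma isWeakHomotopyEquivalence_mappingSpacePullbackHom (hi : projectiveCofibrations R i)
    (hf : degreewiseEpi R f) (hif : QuasiIso i ∨ QuasiIso f) (w) :
    SSet.IsWeakHomotopyEquivalence (mappingSpacePullbackHom i f w) := by
  apply SSet.isWeakHomotopyEquivalence_of_rlp_monomorphisms
  -- Boundary inclusions generate the monomorphisms, so it suffices to lift against them.
  rw [SSet.rlp_monomorphisms]
  rintro _ _ _ ⟨n⟩
  refine hasLiftingProperty_mappingSpacePullbackHom _ (fun _ _ _ P ↦ SSet.exists_lift_boundary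
    (hasLiftingProperty_of_projectiveCofibrations hi) hf (hif.imp_left (fun h ↦ ?_)) P) w
  have : (degreewiseEpi R).llp i := by
    rw [degreewiseEpi_llp]
    exact ⟨hi, h⟩
  exact fun _ _ p hp ↦ this p hp

end

/-- The whiskerings of the enrichment are only propositionally equal to the images under
`simplicialSections`, and the pullback depends on them; substitution carries (M7) across. -/
lemma pullbackLift_of_eq (P : MorphismProperty SSet.{u}) {W X₁ X₂ Z : SSet.{u}} {r r' : X₁ ⟶ Z}
    {s s' : X₂ ⟶ Z} {t t' : W ⟶ X₁} {v v' : W ⟶ X₂} (hr : r = r') (hs : s = s') (ht : t = t')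
    (hv : v = v') (w : t ≫ r = v ≫ s)
    (h : ∀ w', P (pullback.lift (f := r') (g := s') t' v' w')) :
    P (pullback.lift (f := r) (g := s) t v w) := by
  subst hr hs ht hv
  exact h w

variable (R) in
/-- The quasi-simplicial structure on chain complexes of presheaves of modules. -/
def quasiSimplicialStructure :
    letI := projectiveModelStructure R
    QuasiSimplicialStructure.{u} (PCh R) :=
  letI := projectiveModelStructure R
  letI := simplicialEnrichment R
  { enriched := simplicialEnrichment R
    tensor := simplicialTensor R
    cotensor := simplicialCotensor R
    mapTensorIso X S Y :=
      (simplicialSections R).mapIso (ihomTensorIso X ((simplicialChains R).obj S) Y)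
    mapTensorIso_naturality_left f S Y := by
      rw [simplicialEnrichment_eHomWhiskerRight, simplicialEnrichment_eHomWhiskerRight]
      exact ((simplicialSections R).map_comp _ _).symm.trans ((congr_arg _
        (ihomTensorHom_naturality_left f _ Y)).trans ((simplicialSections R).map_comp _ _))
    mapTensorIso_naturality_middle X S S' g Y := by
      rw [simplicialEnrichment_eHomWhiskerRight, simplicialEnrichment_eHomWhiskerLeft]
      exact ((simplicialSections R).map_comp _ _).symm.trans ((congr_arg _
        (ihomTensorHom_naturality_middle X _ Y)).trans ((simplicialSections R).map_comp _ _))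
    mapTensorIso_naturality_right X S Y Y' h := by
      rw [simplicialEnrichment_eHomWhiskerLeft, simplicialEnrichment_eHomWhiskerLeft]
      exact ((simplicialSections R).map_comp _ _).symm.trans ((congr_arg _
        (ihomTensorHom_naturality_right X _ h)).trans ((simplicialSections R).map_comp _ _))
    homMapEquiv X S Y := homMapEquiv X S Y
    homMapEquiv_naturality_left f S Y a := by
      rw [simplicialEnrichment_eHomWhiskerRight]
      exact homMapEquiv_pre f S Y a
    homMapEquiv_naturality_middle X S S' g Y a := homMapEquiv_comp X g Y a
    homMapEquiv_naturality_right X S Y Y' h a := by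
      rw [simplicialEnrichment_eHomWhiskerLeft]
      exact homMapEquiv_map X S h a
    isKanFibration {A B X Y} i f hi hf := by
      exact pullbackLift_of_eq (fun _ _ g ↦ SSet.IsKanFibration g)
        (simplicialEnrichment_eHomWhiskerLeft A f)
        (simplicialEnrichment_eHomWhiskerRight i Y) (simplicialEnrichment_eHomWhiskerRight i X)
        (simplicialEnrichment_eHomWhiskerLeft B f) _
        (isKanFibration_mappingSpacePullbackHom hi hf)
    isWeakHomotopyEquivalence {A B X Y} i f hi hf hif := by
      exact pullbackLift_of_eq (fun _ _ g ↦ SSet.IsWeakHomotopyEquivalence g)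
        (simplicialEnrichment_eHomWhiskerLeft A f)
        (simplicialEnrichment_eHomWhiskerRight i Y) (simplicialEnrichment_eHomWhiskerRight i X)
        (simplicialEnrichment_eHomWhiskerLeft B f) _
        (isWeakHomotopyEquivalence_mappingSpacePullbackHom hi hf hif) }

end

theorem mainTheorem9 {C : Type u₁} [Category.{v₁} C] [EssentiallySmall.{u} C]
    (J : GrothendieckTopology C) (R : Sheaf J CommRingCat.{u}) :
    ∃ M : ModelCategory (PCh R.obj), IsProjectiveModelStructure R.obj M ∧
      ∃ Q : QuasiSimplicialStructure.{u} (PCh R.obj),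
        Q.tensor = simplicialTensor R.obj ∧
        Q.cotensor = simplicialCotensor R.obj ∧
        (letI := Q.enriched
         Nonempty (eHomFunctor SSet.{u} (PCh R.obj) ≅ mappingSpace R.obj)) :=
  ⟨projectiveModelStructure R.obj, isProjectiveModelStructure R.obj,
    quasiSimplicialStructure R.obj, rfl, rfl, ⟨eHomFunctorIso R.obj⟩⟩
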